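/- Throughout $d\ge 2$ and $m=d^2-2$. A function on $\mathbb T^m$ is a function on $\mathbb R^m$ that is $2\pi$-periodic in each coordinate; it is *piecewise smooth* if it is $C^\infty$ on each of countably many disjoint open pieces covering everything up to a null set. **Euler angles.** For $1\le r\le d-1$ let $R_r(\xi,\varphi,\eta)$ be the $d\times d$ matrix which acts on the coordinates $r,r+1$ as $\begin{pmatrix}\cos\xi\,e^{i\eta}&-\sin\xi\,e^{i\varphi}\\ \sin\xi\,e^{-i\varphi}&\cos\xi\,e^{-i\eta}\end{pmatrix}$ and as the identity on the others. For $1\le j\le d-1$ put $$E_j=R_j(\xi_{j,j},0,\varphi_{j,j})\,R_{j-1}(\xi_{j-1,j},0,\varphi_{j-1,j})\cdots R_2(\xi_{2,j},0,\varphi_{2,j})\,R_1(\xi_{1,j},\varphi_{1,j},\eta_j),\qquad V=E_1E_2\cdots E_{d-1},$$ and substitute $\xi_{r,j}=\arcsin\big(|1-\theta_{r,j}/\pi|^{1/(2r)}\big)$, $\theta_{r,j}\in[0,2\pi)$ (extended periodically). Here $1\le r\le j\le d-1$, so that there are $d^2-1$ angles $\theta_{r,j},\varphi_{r,j},\eta_j$.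 **(1)** The map $(\theta_{r,j},\varphi_{r,j},\eta_j)\mapsto V$ carries the uniform probability measure on $\mathbb T^{d^2-1}$ to the Haar probability measure of $\operatorname{SU}(d)$, and it is onto $\operatorname{SU}(d)$. **(2)** Let $q_1,\dots,q_{d-1},\omega_1,\dots,\omega_m$ be rationally independent reals (such reals exist). Distribute $\omega_1,\dots,\omega_m$ in any order over the $d^2-2$ angles other than $\eta_{d-1}$; let each of these angles equal its frequency times $t$, except that $\varphi_{1,d-1}=(\omega-q_1)t$, with $\omega$ the frequency assigned to $\varphi_{1,d-1}$; and let $\eta_{d-1}=q_1t$. Write $V(\boldsymbol\omega t,q_1t)$ for the resulting matrix (so $V(\boldsymbol\theta,0)$ is the value of $V$ at tone angles $\boldsymbol\theta\in\mathbb T^m$ and $\eta_{d-1}=0$), $V_0$ for $V$ with all angles $\theta,\varphi,\eta$ equal to $0$, and $$U(t)=V(\boldsymbol\omega t,q_1t)\,e^{-i\widetilde Qt}\,V_0^\dagger ,\qquad \widetilde Q=\operatorname{diag}\Big(-\sum_{\alpha\ge2}q_\alpha,\,0,\,q_2,\dots,q_{d-1}\Big).$$ Then: * (Quasiperiodic Hamiltonian.)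 $U(t)\in\operatorname{SU}(d)$, and off the times at which some $\theta_{r,j}\in\pi\mathbb Z$, $U$ is differentiable and $H(t)=i(\partial_tU(t))U(t)^\dagger$ equals $\hat H(\boldsymbol\omega t)$ for an explicit Hermitian, piecewise-smooth parent $\hat H$ on $\mathbb T^m$ (smooth off the hyperplanes $\theta_{r,j}\in\pi\mathbb Z$, on which it is set to $0$). $H$ is locally integrable and $U$ is continuous with $U(t)=\mathbb 1-i\int_0^tH(s)U(s)\,ds$, i.e. $U$ is the evolution operator of $H$. * (Quasienergy eigenstates.) $U(t)=P(\boldsymbol\omega t)e^{-iQt}$, where $P(\boldsymbol\theta)=V(\boldsymbol\theta,0)V_0^\dagger$ is a continuous, piecewise-smooth unitary on $\mathbb T^m$ with $P(\mathbf 0)=\mathbb 1$, and $Q=V_0\operatorname{diag}(q_0,q_1,\dots,q_{d-1})V_0^\dagger$ with $q_0=-\sum_{\alpha\ge1}q_\alpha$. Hence $|\alpha(\boldsymbol\theta)\rangle=P(\boldsymbol\theta)V_0e_\alpha$ ($\alpha=0,\dots,d-1$) is a basis of quasienergy eigenstates: $U(t)|\alpha(\mathbf 0)\rangle=e^{-iq_\alpha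 t}|\alpha(\boldsymbol\omega t)\rangle$. * (Complete unitary ergodicity.) The channels $U(t)^*\otimes U(t)$, $t\ge0$, are distributed in time as $W^*\otimes W$ with $W$ Haar-random in $\operatorname U(d)$: for every bounded continuous $f$, $\lim_{T\to\infty}\frac1T\int_0^Tf\,dt=\mathbb E_{\rm Haar}f$. Also, for every $k$, the time average of $(U(t)^*\otimes U(t))^{\otimes k}$ equals $\mathbb E_{\rm Haar}[(W^*\otimes W)^{\otimes k}]$. * (Complete Hilbert-space ergodicity.) For every pure initial state $\psi$ the states $U(t)\psi U(t)^\dagger$, $t\ge0$, are distributed in time (in the same sense) according to the unitarily invariant measure on pure states, and for every $k$ the time average of $(U(t)\psi U(t)^\dagger)^{\otimes k}$ equals $\mathbb E_{\rm Haar}[\phi^{\otimes k}]$. **(3) Qubit, two tones.** Let $d=2$, let $\omega_1,\omega_2,q$ be rationally independent, let $\xi(\theta)=\arccos\sqrt{|1-\theta/\pi|}$ for $\theta\in[0,2\pi)$ (extended periodically), and $$U(t)=\begin{pmatrix}\cos\xi(\omega_1t)\,e^{iqt}&-\sin\xi(\omega_1t)\,e^{i(\omega_2-q)t}\\ \sin\xi(\omega_1t)\,e^{-i(\omega_2-q)t}&\cos\xi(\omega_1t)\,e^{-iqt}\end{pmatrix},\quad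 P(\theta_1,\theta_2)=\begin{pmatrix}\cos\xi(\theta_1)&-\sin\xi(\theta_1)e^{i\theta_2}\\ \sin\xi(\theta_1)e^{-i\theta_2}&\cos\xi(\theta_1)\end{pmatrix},\quad Q=\operatorname{diag}(-q,q).$$ All conclusions of (2) hold for this $U$, $P$, $Q$ with $m=2$, quasienergies $-q,q$, eigenstates $P(\boldsymbol\theta)e_\alpha$ and singular times $\omega_1t\in\pi\mathbb Z$. Moreover its Hamiltonian cannot be written as $\hat H'(\boldsymbol\omega't)$ with fewer than two rationally independent frequencies and a piecewise-smooth parent $\hat H'$. -/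

import Mathlib

open MeasureTheory Filter Topology Set Matrix
open scoped BoundedContinuousFunction Kronecker

noncomputable section

namespace QuasiErgodic

/-! ### Haar measures on the unitary groups -/

instance instMeasurableSpaceMatrix {ι κ : Type*} : MeasurableSpace (Matrix ι κ ℂ) := borel _

instance instBorelSpaceMatrix {ι κ : Type*} : BorelSpace (Matrix ι κ ℂ) := ⟨rfl⟩

theorem isCompact_unitaryGroup (d : ℕ) :
    IsCompact (Matrix.unitaryGroup (Fin d) ℂ : Set (Matrix (Fin d) (Fin d) ℂ)) := by
  have hK : IsCompact (Set.univ.pi fun _ : Fin d => Set.univ.pi fun _ : Fin d =>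
      Metric.closedBall (0 : ℂ) 1) :=
    isCompact_univ_pi fun _ => isCompact_univ_pi fun _ => isCompact_closedBall _ _
  refine IsCompact.of_isClosed_subset (s := Set.univ.pi fun _ : Fin d => Set.univ.pi
    fun _ : Fin d => Metric.closedBall (0 : ℂ) 1) hK ?_ ?_
  · exact isClosed_unitary (R := Matrix (Fin d) (Fin d) ℂ)
  · intro U hU i _ j _
    simpa using entry_norm_bound_of_unitary hU i j

instance instCompactSpaceU (d : ℕ) : CompactSpace (Matrix.unitaryGroup (Fin d) ℂ) :=
  isCompact_iff_compactSpace.mp (isCompact_unitaryGroup d)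

instance instCompactSpaceSU (d : ℕ) : CompactSpace (Matrix.specialUnitaryGroup (Fin d) ℂ) := by
  apply isCompact_iff_compactSpace.mp
  have h : (Matrix.specialUnitaryGroup (Fin d) ℂ : Set (Matrix (Fin d) (Fin d) ℂ)) =
      (Matrix.unitaryGroup (Fin d) ℂ : Set (Matrix (Fin d) (Fin d) ℂ)) ∩ {A | A.det = 1} := by
    ext A; exact Matrix.mem_specialUnitaryGroup_iff
  rw [h]
  exact (isCompact_unitaryGroup d).inter_right
    (isClosed_eq (Continuous.matrix_det continuous_id) continuous_const)

instance instIsTopologicalGroupSU (d : ℕ) :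
    IsTopologicalGroup (Matrix.specialUnitaryGroup (Fin d) ℂ) where
  continuous_inv := continuous_induced_rng.mpr
    (continuous_subtype_val.matrix_conjTranspose)

/-- The Haar probability measure of `U(d)`. -/
def haarU (d : ℕ) : Measure (Matrix.unitaryGroup (Fin d) ℂ) := Measure.haarMeasure ⊤

/-- The Haar probability measure of `SU(d)`. -/
def haarSU (d : ℕ) : Measure (Matrix.specialUnitaryGroup (Fin d) ℂ) := Measure.haarMeasure ⊤

/-! ### Temporal ensembles and ergodicity -/

/-- The temporal ensemble `{x t}_{t ≥ 0}` is distributed according to `μ`: the time averages over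
`[0, T]` converge weakly to `μ` as `T → ∞`. -/
def TemporalEnsembleHasLaw {X : Type*} [TopologicalSpace X] [MeasurableSpace X]
    (x : ℝ → X) (μ : Measure X) : Prop :=
  ∀ f : X →ᵇ ℝ, Tendsto (fun T : ℝ => T⁻¹ * ∫ t in (0 : ℝ)..T, f (x t)) atTop
    (𝓝 (∫ y, f y ∂μ))

/-- The infinite-time average of `x` over `t ≥ 0` exists and equals `c`. -/
def HasTimeAverage (x : ℝ → ℂ) (c : ℂ) : Prop :=
  Tendsto (fun T : ℝ => (T : ℂ)⁻¹ * ∫ t in (0 : ℝ)..T, x t) atTop (𝓝 c)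

/-- The `k`-fold tensor power of a matrix. -/
def tensorPow {ι : Type*} (k : ℕ) (A : Matrix ι ι ℂ) : Matrix (Fin k → ι) (Fin k → ι) ℂ :=
  Matrix.of fun a b => ∏ i, A (a i) (b i)

/-- The vectorized channel `V^* ⊗ V` (entrywise complex conjugate), an element of `PU(d)` when `V`
is unitary. -/
def channel {d : ℕ} (V : Matrix (Fin d) (Fin d) ℂ) :
    Matrix (Fin d × Fin d) (Fin d × Fin d) ℂ :=
  V.map (starRingEnd ℂ) ⊗ₖ V

/-- The projector `|ψ⟩⟨ψ|`. -/
def proj {d : ℕ} (ψ : Fin d → ℂ) : Matrix (Fin d) (Fin d) ℂ := Matrix.vecMulVec ψ (star ψ)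

/-- Unitary `k`-ergodicity of the evolution `U`. -/
def IsUE {d : ℕ} (k : ℕ) (U : ℝ → Matrix (Fin d) (Fin d) ℂ) : Prop :=
  ∀ a b, HasTimeAverage (fun t => tensorPow k (channel (U t)) a b)
    (∫ V : Matrix.unitaryGroup (Fin d) ℂ, tensorPow k (channel (V : Matrix _ _ ℂ)) a b ∂haarU d)

/-- Hilbert-space `k`-ergodicity of the evolution `U`, for every initial state `ψ` (and any
reference state `φ` for the uniform ensemble). -/
def IsHSE {d : ℕ} (k : ℕ) (U : ℝ → Matrix (Fin d) (Fin d) ℂ) : Prop :=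
  ∀ ψ φ : Fin d → ℂ, star ψ ⬝ᵥ ψ = 1 → star φ ⬝ᵥ φ = 1 →
    ∀ a b, HasTimeAverage (fun t => tensorPow k (U t * proj ψ * (U t)ᴴ) a b)
      (∫ V : Matrix.unitaryGroup (Fin d) ℂ,
        tensorPow k ((V : Matrix _ _ ℂ) * proj φ * (V : Matrix _ _ ℂ)ᴴ) a b ∂haarU d)

/-- Complete unitary ergodicity: the channels `U(t)^* ⊗ U(t)` are Haar distributed in time. -/
def IsCUE {d : ℕ} (U : ℝ → Matrix (Fin d) (Fin d) ℂ) : Prop :=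
  TemporalEnsembleHasLaw (fun t => channel (U t))
    ((haarU d).map fun V : Matrix.unitaryGroup (Fin d) ℂ => channel (V : Matrix (Fin d) (Fin d) ℂ))

/-- Complete Hilbert-space ergodicity: for every initial state `ψ`, the projectors `ψ(t)` are
distributed in time according to the unitarily invariant measure on pure states. -/
def IsCHSE {d : ℕ} (U : ℝ → Matrix (Fin d) (Fin d) ℂ) : Prop :=
  ∀ ψ φ : Fin d → ℂ, star ψ ⬝ᵥ ψ = 1 → star φ ⬝ᵥ φ = 1 →
    TemporalEnsembleHasLaw (fun t => U t * proj ψ * (U t)ᴴ)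
      ((haarU d).map fun V : Matrix.unitaryGroup (Fin d) ℂ => (V : Matrix (Fin d) (Fin d) ℂ) * proj φ *
        (V : Matrix (Fin d) (Fin d) ℂ)ᴴ)

/-! ### Quasiperiodic Hamiltonians and quasienergy eigenstates -/

/-- Functions on the torus `T^m` are `2π`-periodic functions on `ℝ^m`. -/
def TorusPeriodic {m : ℕ} {α : Type*} (F : (Fin m → ℝ) → α) : Prop :=
  ∀ (θ : Fin m → ℝ) (k : Fin m → ℤ), F (fun j => θ j + k j * (2 * Real.pi)) = F θ

/-- Piecewise smoothness with countably many pieces: the function is smooth on each of countably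
many disjoint open pieces, which cover everything up to a set of measure zero. -/
def PiecewiseSmooth {m d : ℕ} (F : (Fin m → ℝ) → Matrix (Fin d) (Fin d) ℂ) : Prop :=
  ∃ O : ℕ → Set (Fin m → ℝ), (∀ i, IsOpen (O i)) ∧ Pairwise (Function.onFun Disjoint O) ∧
    volume (⋃ i, O i)ᶜ = 0 ∧ ∀ i a b, ContDiffOn ℝ ((⊤ : ℕ∞) : WithTop ℕ∞) (fun θ => F θ a b) (O i)

/-- `H(t) = Ĥ(ω t)` with `m` rationally independent frequencies and a piecewise-smooth parent `Ĥ`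
on the torus `T^m`. -/
def HasTones {d : ℕ} (m : ℕ) (H : ℝ → Matrix (Fin d) (Fin d) ℂ) : Prop :=
  ∃ (ω : Fin m → ℝ) (Hhat : (Fin m → ℝ) → Matrix (Fin d) (Fin d) ℂ),
    LinearIndependent ℤ ω ∧ TorusPeriodic Hhat ∧ PiecewiseSmooth Hhat ∧
      ∀ t : ℝ, H t = Hhat (t • ω)

/-- `U` is the evolution operator generated by the (locally integrable) Hamiltonian `H`: the
continuous solution of the Schrödinger equation in integral form with `U(0) = 1`. -/
structure IsEvolutionOperator {d : ℕ} (H U : ℝ → Matrix (Fin d) (Fin d) ℂ) : Prop where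
  locallyIntegrable : ∀ a b, LocallyIntegrable (fun t => H t a b) volume
  continuous : Continuous U
  integral_eq : ∀ t a b, U t a b =
    (1 : Matrix (Fin d) (Fin d) ℂ) a b - Complex.I * ∫ s in (0 : ℝ)..t, (H s * U s) a b

/-- The generalized Floquet decomposition `U(t) = P(ω t) exp(-i Q t)`. -/
structure IsFloquetDecomposition {m d : ℕ} (ω : Fin m → ℝ) (U : ℝ → Matrix (Fin d) (Fin d) ℂ)
    (P : (Fin m → ℝ) → Matrix (Fin d) (Fin d) ℂ) (Q : Matrix (Fin d) (Fin d) ℂ) : Prop where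
  periodic : TorusPeriodic P
  continuous : Continuous P
  piecewiseSmooth : PiecewiseSmooth P
  unitary : ∀ θ, P θ ∈ Matrix.unitaryGroup (Fin d) ℂ
  at_zero : P 0 = 1
  hermitian : Q.IsHermitian
  decomposition : ∀ t : ℝ, U t = P (t • ω) * NormedSpace.exp ((-(Complex.I * (t : ℂ))) • Q)

open Classical in
/-- The parent `i (ω·∇P) P† + P Q P†` of the Hamiltonian `H(t) = i (∂ₜ U) U†` generated by
`U(t) = P(ω t) exp(-i Q t)`; it is set to zero on the singular set `S`. -/
def parentHamiltonian {m d : ℕ} (ω : Fin m → ℝ) (S : Set (Fin m → ℝ))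
    (P : (Fin m → ℝ) → Matrix (Fin d) (Fin d) ℂ) (Q : Matrix (Fin d) (Fin d) ℂ)
    (θ : Fin m → ℝ) : Matrix (Fin d) (Fin d) ℂ :=
  if θ ∈ S then 0 else
    Complex.I • (Matrix.of (fun a b => lineDeriv ℝ (fun x => P x a b) θ ω) * (P θ)ᴴ)
      + P θ * Q * (P θ)ᴴ

/-- The drive with evolution operator `U`, `m` rationally independent frequencies `ω` and parent
Hamiltonian `Hhat` (regular off `S`) has a basis of quasienergy eigenstates, given by `P`, `Q`, with
quasienergies `q`, and is completely unitarily and Hilbert-space ergodic. -/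
structure IsErgodicDrive {m d : ℕ} (ω : Fin m → ℝ) (S : Set (Fin m → ℝ))
    (Hhat : (Fin m → ℝ) → Matrix (Fin d) (Fin d) ℂ) (U : ℝ → Matrix (Fin d) (Fin d) ℂ)
    (P : (Fin m → ℝ) → Matrix (Fin d) (Fin d) ℂ) (Q : Matrix (Fin d) (Fin d) ℂ)
    (q : Fin d → ℝ) : Prop where
  independent : LinearIndependent ℤ ω
  parent_periodic : TorusPeriodic Hhat
  parent_piecewiseSmooth : PiecewiseSmooth Hhat
  parent_hermitian : ∀ θ, (Hhat θ).IsHermitian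
  evolution_unitary : ∀ t, U t ∈ Matrix.specialUnitaryGroup (Fin d) ℂ
  evolution : IsEvolutionOperator (fun t => Hhat (t • ω)) U
  /-- `H(t) = i (∂ₜ U(t)) U(t)†` off the singular times -/
  schroedinger : ∀ t : ℝ, t • ω ∉ S →
    (∀ a b, DifferentiableAt ℝ (fun τ => U τ a b) t) ∧
    Hhat (t • ω) = Complex.I • (Matrix.of (fun a b => deriv (fun τ => U τ a b) t) * (U t)ᴴ)
  floquet : IsFloquetDecomposition ω U P Q
  /-- the columns `|α⟩` of `W` are the eigenbasis of `Q`, and `|α(θ)⟩ = P(θ) |α⟩` -/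
  quasienergy_eigenstates : ∃ W ∈ Matrix.unitaryGroup (Fin d) ℂ,
    ∀ α, Q *ᵥ W.col α = (q α : ℂ) • W.col α ∧
      ∀ t : ℝ, U t *ᵥ W.col α =
        Complex.exp (-(Complex.I * (q α * t : ℝ))) • (P (t • ω) *ᵥ W.col α)
  cue : IsCUE U
  ue : ∀ k, IsUE k U
  chse : IsCHSE U
  hse : ∀ k, IsHSE k U

/-! ### Hurwitz's Euler-angle parametrization; the dimension is `d = n + 2` -/

/-- The two-level rotation acting on the (zero-based) coordinates `r`, `r + 1`. -/
def rot (d r : ℕ) (ξ φ η : ℝ) : Matrix (Fin d) (Fin d) ℂ :=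
  Matrix.of fun a b =>
    if (a : ℕ) = r ∧ (b : ℕ) = r then Real.cos ξ * Complex.exp (Complex.I * η)
    else if (a : ℕ) = r ∧ (b : ℕ) = r + 1 then -(Real.sin ξ * Complex.exp (Complex.I * φ))
    else if (a : ℕ) = r + 1 ∧ (b : ℕ) = r then Real.sin ξ * Complex.exp (-(Complex.I * φ))
    else if (a : ℕ) = r + 1 ∧ (b : ℕ) = r + 1 then Real.cos ξ * Complex.exp (-(Complex.I * η))
    else if a = b then 1 else 0

/-- Pairs `(j, r)` with `r ≤ j`; the zero-based `⟨j, r⟩` stands for the one-based pair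
`(r + 1, j + 1)`, `1 ≤ r + 1 ≤ j + 1 ≤ d - 1`. -/
abbrev AnglePair (n : ℕ) := (j : Fin (n + 1)) × Fin ((j : ℕ) + 1)

/-- `E_j = R_j R_{j-1} ⋯ R_2 R_1`: the factors with `r ≥ 2` carry the phase `φ_{r,j}` on the
diagonal, the last factor is `R_1(ξ_{1,j}, φ_{1,j}, η_j)`. -/
def hurwitzE (n : ℕ) (ξ φ : AnglePair n → ℝ) (η : Fin (n + 1) → ℝ) (j : Fin (n + 1)) :
    Matrix (Fin (n + 2)) (Fin (n + 2)) ℂ :=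
  ((List.ofFn fun r : Fin ((j : ℕ) + 1) =>
    if (r : ℕ) = 0 then rot (n + 2) 0 (ξ ⟨j, r⟩) (φ ⟨j, r⟩) (η j)
    else rot (n + 2) r (ξ ⟨j, r⟩) 0 (φ ⟨j, r⟩)).reverse).prod

/-- `V = E_1 E_2 ⋯ E_{d-1}`. -/
def hurwitzV (n : ℕ) (ξ φ : AnglePair n → ℝ) (η : Fin (n + 1) → ℝ) :
    Matrix (Fin (n + 2)) (Fin (n + 2)) ℂ :=
  (List.ofFn fun j : Fin (n + 1) => hurwitzE n ξ φ η j).prod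

/-- The representative of an angle in `[0, 2π)`. -/
def angleMod (θ : ℝ) : ℝ := toIcoMod Real.two_pi_pos 0 θ

/-- `ξ(θ) = arcsin (|1 - θ/π|^{1/(2r)})` for `θ ∈ [0, 2π)`, extended periodically (here `r ≥ 1` is
one-based). -/
def xiOf (r : ℕ) (θ : ℝ) : ℝ :=
  Real.arcsin (|1 - angleMod θ / Real.pi| ^ (1 / (2 * (r : ℝ))))

/-- Index set of the `d² - 1` angles: the `θ_{r,j}`, the `φ_{r,j}` and the `η_j`. -/
abbrev EulerIndex (n : ℕ) := AnglePair n ⊕ AnglePair n ⊕ Fin (n + 1)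

/-- The map `(θ, φ, η) ↦ V(ξ(θ), φ, η)` on the torus of dimension `d² - 1`. -/
def hurwitzTorus (n : ℕ) (x : EulerIndex n → ℝ) : Matrix (Fin (n + 2)) (Fin (n + 2)) ℂ :=
  hurwitzV n (fun p => xiOf ((p.2 : ℕ) + 1) (x (Sum.inl p))) (fun p => x (Sum.inr (Sum.inl p)))
    (fun j => x (Sum.inr (Sum.inr j)))

/-- The uniform probability measure on the torus `[0, 2π)^{d² - 1}`. -/
def torusMeasure (n : ℕ) : Measure (EulerIndex n → ℝ) :=
  Measure.pi fun _ => ProbabilityTheory.cond volume (Set.Ico (0 : ℝ) (2 * Real.pi))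

/-! ### The drive with `d² - 2` tones -/

/-- Index set of the tones: one for each Euler angle other than `η_{d-1}`. -/
abbrev ToneIndex (n : ℕ) := AnglePair n ⊕ AnglePair n ⊕ Fin n

theorem card_toneIndex (n : ℕ) : Fintype.card (ToneIndex n) = (n + 2) ^ 2 - 2 := by
  have h : ∑ j : Fin (n + 1), ((j : ℕ) + 1) = (n + 1) * (n + 2) / 2 := by
    rw [Fin.sum_univ_eq_sum_range (fun j => j + 1) (n + 1)]
    have := Finset.sum_range_succ' (fun j => j) (n + 1)
    rw [Finset.sum_range_id] at this
    simp at this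
    rw [← this, mul_comm]
  have h2 : (n + 1) * (n + 2) / 2 * 2 = (n + 1) * (n + 2) :=
    Nat.div_mul_cancel (Nat.even_mul_succ_self (n + 1)).two_dvd
  simp only [Fintype.card_sum, Fintype.card_sigma, Fintype.card_fin, h]
  have h3 : (n + 2) ^ 2 = (n + 1) * (n + 2) + n + 2 := by ring
  omega

/-- The pair `(1, d - 1)`. -/
def lastPair (n : ℕ) : AnglePair n := ⟨Fin.last n, 0⟩

/-- All Euler angles equal their tone `y`, except `η_{d-1} = s` and
`φ_{1,d-1} = y_{φ_{1,d-1}} - s`. -/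
def assignAngles (n : ℕ) (y : ToneIndex n → ℝ) (s : ℝ) : EulerIndex n → ℝ :=
  Sum.elim (fun p => y (Sum.inl p)) <| Sum.elim
    (fun p => y (Sum.inr (Sum.inl p)) - if p = lastPair n then s else 0)
    (Fin.snoc (α := fun _ => ℝ) (fun j : Fin n => y (Sum.inr (Sum.inr j))) s)

/-- The quasienergies `(-∑ q_α, q_1, …, q_{d-1})`. -/
def quasienergy (n : ℕ) (q : Fin (n + 1) → ℝ) : Fin (n + 2) → ℝ :=
  Fin.cons (α := fun _ => ℝ) (-∑ α, q α) q

/-- The diagonal entries `(-∑_{α ≥ 2} q_α, 0, q_2, …, q_{d-1})` of `Q̃`. -/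
def reducedQuasienergy (n : ℕ) (q : Fin (n + 1) → ℝ) : Fin (n + 2) → ℝ :=
  Fin.cons (α := fun _ => ℝ) (-∑ α : Fin n, q α.succ)
    (Fin.cons (α := fun _ => ℝ) 0 (fun α : Fin n => q α.succ))

/-- `U(t) = V(ω t, q_1 t) exp(-i Q̃ t) V(0)†`, the tones being enumerated by `e`. -/
def driveU (n : ℕ) {m : ℕ} (e : ToneIndex n ≃ Fin m) (q : Fin (n + 1) → ℝ) (ω : Fin m → ℝ)
    (t : ℝ) : Matrix (Fin (n + 2)) (Fin (n + 2)) ℂ :=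
  hurwitzTorus n (assignAngles n (fun i => ω (e i) * t) (q 0 * t)) *
    Matrix.diagonal (fun α => Complex.exp (-(Complex.I * (reducedQuasienergy n q α * t : ℝ)))) *
    (hurwitzTorus n 0)ᴴ

/-- `P(θ) = V(θ, 0) V(0)†`, where the argument `0` replaces `q_1 t`. -/
def driveP (n : ℕ) {m : ℕ} (e : ToneIndex n ≃ Fin m) (θ : Fin m → ℝ) :
    Matrix (Fin (n + 2)) (Fin (n + 2)) ℂ :=
  hurwitzTorus n (assignAngles n (fun i => θ (e i)) 0) * (hurwitzTorus n 0)ᴴ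

/-- The generalized Floquet Hamiltonian `Q = V(0) diag(q_0, …, q_{d-1}) V(0)†`. -/
def driveQ (n : ℕ) (q : Fin (n + 1) → ℝ) : Matrix (Fin (n + 2)) (Fin (n + 2)) ℂ :=
  hurwitzTorus n 0 * Matrix.diagonal (fun α => (quasienergy n q α : ℂ)) * (hurwitzTorus n 0)ᴴ

/-- The hyperplanes `θ_{r,j} ∈ πℤ`. -/
def driveS (n : ℕ) {m : ℕ} (e : ToneIndex n ≃ Fin m) : Set (Fin m → ℝ) :=
  {θ | ∃ (p : AnglePair n) (k : ℤ), θ (e (Sum.inl p)) = k * Real.pi}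

/-! ### The qubit drive with two tones -/

/-- `ξ(θ) = arccos √|1 - θ/π|` for `θ ∈ [0, 2π)`. -/
def qubitXi (θ : ℝ) : ℝ := Real.arccos (Real.sqrt |1 - angleMod θ / Real.pi|)

/-- The matrix whose columns are the quasienergy states `|0(θ)⟩`, `|1(θ)⟩`. -/
def qubitP (θ : Fin 2 → ℝ) : Matrix (Fin 2) (Fin 2) ℂ :=
  !![(Real.cos (qubitXi (θ 0)) : ℂ),
      -(Real.sin (qubitXi (θ 0)) * Complex.exp (Complex.I * (θ 1 : ℝ)));
    Real.sin (qubitXi (θ 0)) * Complex.exp (-(Complex.I * (θ 1 : ℝ))),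
      (Real.cos (qubitXi (θ 0)) : ℂ)]

/-- The qubit evolution operator. -/
def qubitU (ω : Fin 2 → ℝ) (q t : ℝ) : Matrix (Fin 2) (Fin 2) ℂ :=
  !![Real.cos (qubitXi (ω 0 * t)) * Complex.exp (Complex.I * (q * t : ℝ)),
      -(Real.sin (qubitXi (ω 0 * t)) * Complex.exp (Complex.I * ((ω 1 - q) * t : ℝ)));
    Real.sin (qubitXi (ω 0 * t)) * Complex.exp (-(Complex.I * ((ω 1 - q) * t : ℝ))),
      Real.cos (qubitXi (ω 0 * t)) * Complex.exp (-(Complex.I * (q * t : ℝ)))]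

/-- `Q = diag(-q, q)`. -/
def qubitQ (q : ℝ) : Matrix (Fin 2) (Fin 2) ℂ := Matrix.diagonal ![((-q : ℝ) : ℂ), (q : ℂ)]

/-- The hyperplanes `θ_1 ∈ πℤ`. -/
def qubitS : Set (Fin 2 → ℝ) := {θ | ∃ k : ℤ, θ 0 = k * Real.pi}

end QuasiErgodic

end

/-! Parametrization. All factors of `V` except `E_{d-1}` fix the last coordinate, so `V = (V' ⊕ 1)
E_{d-1}` with `V'` the parametrization of `SU(d-1)`, and the last row of `V` is that of `E_{d-1}`.
Its entries carry independent uniform phases, and its squared moduli arise by stick breaking with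
the factors `sin² ξ_r`. The exponent `1/(2r)` gives `sin² ξ_r` the density `r y^(r-1)`
(`lintegral_xiOf`), which is the law of the fraction of the squared norm that the first `r` of `r +
1` complex coordinates carry under Lebesgue measure. Hence the row is the direction of a
Lebesgue-distributed vector (`exists_lintegral_spherical`), and its law is unitarily invariant. The
last row separates the cosets of `SU(d-1)` in `SU(d)`, so a Haar matrix of `SU(d-1)` times an
independent matrix with invariant row law is Haar (`integral_extendSU_mul`), and induction on `d`
gives the Haar measure. The image is compact and has full Haar measure, so it is everything.

Drive. The angle `η_{d-1}`, compensated in `φ_{1,d-1}`, factors out of `V` on the right as a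
diagonal matrix (`hurwitzTorus_assignAngles`). Merged with `exp(-i Q̃ t)` it becomes `exp(-i diag(q)
t)`, which is the Floquet decomposition. The only analytic difficulty is that the derivatives of
`sin ξ` and `cos ξ` are unbounded near `πℤ`. These functions are monotone in `cos θ`, so the
derivatives are still locally integrable. Functions that are continuous, smooth off the hyperplanes
and have an integrable derivative along the flow form an algebra (`regularAlgebra`) which contains
the entries of `P`.

Ergodicity. `U(t)` is a continuous function of a linear flow on the torus of the `d² - 1` Euler
angles and the `d - 2` phases of `Q̃`. The frequencies are rationally independent, so Weyl's theorem
turns time averages into torus averages. For fixed phases of `Q̃` the Euler angles give a Haar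
matrix, and right invariance removes the other factors. The channels and the states do not see a
global phase, which allows the passage from `SU(d)` to `U(d)`.

Qubit. Shifting its `θ` tone by `π` exchanges sine and cosine, so the qubit drive is a shifted
instance with `d = 2`. Its off-diagonal Hamiltonian entry is nonzero off the singular times and
rotates with the second tone, which excludes periodicity in time. -/

noncomputable section

namespace QuasiErgodic

/-! ### Embeddings of smaller matrix groups -/

section BlockEmb

variable {m k : Type*} [DecidableEq m] [Fintype k] [DecidableEq k]

/-- For an isometry `A`, the matrix acting as `M` on the range of `A` and as the identity on its
orthogonal complement. -/
def blockEmb (A : Matrix m k ℂ) (M : Matrix k k ℂ) : Matrix m m ℂ := 1 + A * (M - 1) * Aᴴ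

theorem blockEmb_one (A : Matrix m k ℂ) : blockEmb A 1 = 1 := by simp [blockEmb]

/-- Since `Aᴴ * A = 1` collapses the middle of the product, the claim reduces to `(M - 1) + (N - 1)
+ (M - 1)(N - 1) = MN - 1`. -/
theorem blockEmb_mul [Fintype m] {A : Matrix m k ℂ} (hA : Aᴴ * A = 1) (M N : Matrix k k ℂ) :
    blockEmb A (M * N) = blockEmb A M * blockEmb A N := by
  have h : A * (M - 1) * Aᴴ * (A * (N - 1) * Aᴴ) = A * ((M - 1) * (N - 1)) * Aᴴ := by
    calc A * (M - 1) * Aᴴ * (A * (N - 1) * Aᴴ)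
        = A * (M - 1) * (Aᴴ * A) * (N - 1) * Aᴴ := by simp only [Matrix.mul_assoc]
      _ = _ := by rw [hA]; simp only [Matrix.mul_assoc, Matrix.one_mul]
  unfold blockEmb
  rw [Matrix.add_mul, Matrix.one_mul, Matrix.mul_add, Matrix.mul_one, h, add_assoc,
    ← Matrix.add_mul, ← Matrix.add_mul, ← Matrix.mul_add, ← Matrix.mul_add]
  congr 3
  noncomm_ring

theorem blockEmb_conjTranspose (A : Matrix m k ℂ) (M : Matrix k k ℂ) :
    (blockEmb A M)ᴴ = blockEmb A Mᴴ := by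
  simp [blockEmb, Matrix.mul_assoc, conjTranspose_mul]

/-- Sylvester's identity `det (1 + XY) = det (1 + YX)` brings `Aᴴ` next to `A`, leaving `1 + (M -
1)`. -/
theorem det_blockEmb [Fintype m] {A : Matrix m k ℂ} (hA : Aᴴ * A = 1) (M : Matrix k k ℂ) :
    (blockEmb A M).det = M.det := by
  rw [blockEmb, Matrix.mul_assoc, det_one_add_mul_comm, Matrix.mul_assoc, hA]
  simp

theorem blockEmb_mem_specialUnitaryGroup [Fintype m] {A : Matrix m k ℂ} (hA : Aᴴ * A = 1) {M : Matrix k k ℂ}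
    (hM : M ∈ specialUnitaryGroup k ℂ) : blockEmb A M ∈ specialUnitaryGroup m ℂ := by
  rw [mem_specialUnitaryGroup_iff] at hM ⊢
  refine ⟨?_, by rw [det_blockEmb hA, hM.2]⟩
  rw [mem_unitaryGroup_iff', star_eq_conjTranspose, blockEmb_conjTranspose, ← blockEmb_mul hA,
    ← star_eq_conjTranspose, mem_unitaryGroup_iff'.1 hM.1, blockEmb_one]

end BlockEmb

/-- The inclusion of the coordinates `r, …, r + k - 1`. -/
def coordIncl (d k r : ℕ) : Matrix (Fin d) (Fin k) ℂ :=
  Matrix.of fun a j => if (a : ℕ) = r + j then 1 else 0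

theorem coordIncl_isometry {d k r : ℕ} (h : r + k ≤ d) :
    (coordIncl d k r)ᴴ * coordIncl d k r = 1 := by
  ext i j
  rw [Matrix.mul_apply, Finset.sum_eq_single ⟨r + i, by omega⟩]
  · by_cases hij : i = j
    · simp [coordIncl, hij, one_apply]
    · have : (i : ℕ) ≠ j := fun h => hij (Fin.ext h)
      simp [coordIncl, hij, this]
  · intro b _ hb
    have : (b : ℕ) ≠ r + i := fun h => hb (Fin.ext h)
    simp [coordIncl, this]
  · simp

/-- The `2 × 2` rotation block. -/
def rotBlock (ξ φ η : ℝ) : Matrix (Fin 2) (Fin 2) ℂ :=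
  !![Real.cos ξ * Complex.exp (Complex.I * η), -(Real.sin ξ * Complex.exp (Complex.I * φ));
    Real.sin ξ * Complex.exp (-(Complex.I * φ)), Real.cos ξ * Complex.exp (-(Complex.I * η))]

theorem conj_exp_I_mul (x : ℝ) :
    (starRingEnd ℂ) (Complex.exp (Complex.I * x)) = Complex.exp (-(Complex.I * x)) := by
  rw [← Complex.exp_conj]; simp

theorem conj_exp_neg_I_mul (x : ℝ) :
    (starRingEnd ℂ) (Complex.exp (-(Complex.I * x))) = Complex.exp (Complex.I * x) := by
  rw [← Complex.exp_conj]; simp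

theorem rotBlock_mem (ξ φ η : ℝ) : rotBlock ξ φ η ∈ specialUnitaryGroup (Fin 2) ℂ := by
  have h1 : Complex.exp (Complex.I * η) * Complex.exp (-(Complex.I * η)) = 1 := by
    rw [← Complex.exp_add]; simp
  have h2 : Complex.exp (Complex.I * φ) * Complex.exp (-(Complex.I * φ)) = 1 := by
    rw [← Complex.exp_add]; simp
  have h3 : (Real.cos ξ : ℂ) ^ 2 + (Real.sin ξ : ℂ) ^ 2 = 1 := by
    exact_mod_cast Real.cos_sq_add_sin_sq ξ
  rw [mem_specialUnitaryGroup_iff]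
  constructor
  · rw [mem_unitaryGroup_iff', star_eq_conjTranspose]
    ext i j
    fin_cases i <;> fin_cases j <;>
      simp only [rotBlock, Matrix.mul_apply, Fin.sum_univ_two, conjTranspose_apply, of_apply, cons_val',
        cons_val_zero, cons_val_one, cons_val_fin_one, map_neg, map_mul, RCLike.star_def,
        conj_exp_I_mul, conj_exp_neg_I_mul, Complex.conj_ofReal, Fin.zero_eta, Fin.mk_one,
        one_apply_eq, ne_eq, zero_ne_one, one_ne_zero, not_false_eq_true, one_apply_ne]
    · linear_combination (Real.cos ξ : ℂ) ^ 2 * h1 + (Real.sin ξ : ℂ) ^ 2 * h2 + h3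
    · ring
    · ring
    · linear_combination (Real.cos ξ : ℂ) ^ 2 * h1 + (Real.sin ξ : ℂ) ^ 2 * h2 + h3
  · rw [rotBlock, det_fin_two_of]
    linear_combination (Real.cos ξ : ℂ) ^ 2 * h1 + (Real.sin ξ : ℂ) ^ 2 * h2 + h3

theorem rot_eq_blockEmb {d r : ℕ} (h : r + 1 < d) (ξ φ η : ℝ) :
    rot d r ξ φ η = blockEmb (coordIncl d 2 r) (rotBlock ξ φ η) := by
  have key : ∀ c : Fin d, (c = ⟨r, by omega⟩ ∨ c = ⟨r + 1, h⟩) ∨ ((c : ℕ) ≠ r ∧ (c : ℕ) ≠ r + 1) := by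
    intro c
    simp only [Fin.ext_iff]
    omega
  ext a b
  rw [blockEmb, Matrix.add_apply, Matrix.mul_apply, Fin.sum_univ_two]
  simp only [Matrix.mul_apply, Fin.sum_univ_two]
  rcases key a with (rfl | rfl) | ⟨ha, ha'⟩ <;> rcases key b with (rfl | rfl) | ⟨hb, hb'⟩
  · simp [rot, coordIncl, rotBlock]
  · simp [rot, coordIncl, rotBlock]
  · simp [rot, coordIncl, hb, hb', one_apply]
  · simp [rot, coordIncl, rotBlock]
  · simp [rot, coordIncl, rotBlock]
  · simp [rot, coordIncl, hb, hb', one_apply]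
  · simp [rot, coordIncl, ha, ha', one_apply]
  · simp [rot, coordIncl, ha, ha', one_apply]
  · simp [rot, coordIncl, ha, ha', one_apply]

theorem rot_mem {d r : ℕ} (h : r + 1 < d) (ξ φ η : ℝ) :
    rot d r ξ φ η ∈ specialUnitaryGroup (Fin d) ℂ := by
  rw [rot_eq_blockEmb h]
  exact blockEmb_mem_specialUnitaryGroup (coordIncl_isometry (by omega)) (rotBlock_mem _ _ _)

theorem hurwitzE_mem (n : ℕ) (ξ φ : AnglePair n → ℝ) (η : Fin (n + 1) → ℝ) (j : Fin (n + 1)) :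
    hurwitzE n ξ φ η j ∈ specialUnitaryGroup (Fin (n + 2)) ℂ := by
  refine Submonoid.list_prod_mem _ fun M hM => ?_
  rw [List.mem_reverse, List.mem_ofFn] at hM
  obtain ⟨r, rfl⟩ := hM
  split_ifs
  · exact rot_mem (by omega) _ _ _
  · exact rot_mem (by omega) _ _ _

theorem hurwitzV_mem (n : ℕ) (ξ φ : AnglePair n → ℝ) (η : Fin (n + 1) → ℝ) :
    hurwitzV n ξ φ η ∈ specialUnitaryGroup (Fin (n + 2)) ℂ := by
  refine Submonoid.list_prod_mem _ fun M hM => ?_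
  rw [List.mem_ofFn] at hM
  obtain ⟨j, rfl⟩ := hM
  exact hurwitzE_mem _ _ _ _ _

theorem hurwitzTorus_mem (n : ℕ) (x : EulerIndex n → ℝ) :
    hurwitzTorus n x ∈ specialUnitaryGroup (Fin (n + 2)) ℂ := hurwitzV_mem _ _ _ _

/-! ### Adding one dimension -/

/-- The embedding `M ↦ M ⊕ 1`. -/
def extendLast {d : ℕ} (M : Matrix (Fin d) (Fin d) ℂ) : Matrix (Fin (d + 1)) (Fin (d + 1)) ℂ :=
  blockEmb (coordIncl (d + 1) d 0) M

theorem coordIncl_castSucc {d : ℕ} (i j : Fin d) :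
    coordIncl (d + 1) d 0 i.castSucc j = if i = j then 1 else 0 := by
  simp [coordIncl, Fin.ext_iff]

theorem coordIncl_last {d : ℕ} (j : Fin d) : coordIncl (d + 1) d 0 (Fin.last d) j = 0 := by
  have : (d : ℕ) ≠ j := by omega
  simp [coordIncl, this]

@[simp] theorem extendLast_castSucc_castSucc {d : ℕ} (M : Matrix (Fin d) (Fin d) ℂ) (i j : Fin d) :
    extendLast M i.castSucc j.castSucc = M i j := by
  simp [extendLast, blockEmb, Matrix.mul_apply, coordIncl_castSucc, one_apply]

@[simp] theorem extendLast_last_castSucc {d : ℕ} (M : Matrix (Fin d) (Fin d) ℂ) (j : Fin d) :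
    extendLast M (Fin.last d) j.castSucc = 0 := by
  simp [extendLast, blockEmb, Matrix.mul_apply, coordIncl_last, one_apply, (Fin.castSucc_ne_last j).symm]

@[simp] theorem extendLast_castSucc_last {d : ℕ} (M : Matrix (Fin d) (Fin d) ℂ) (j : Fin d) :
    extendLast M j.castSucc (Fin.last d) = 0 := by
  simp [extendLast, blockEmb, Matrix.mul_apply, coordIncl_last, one_apply, Fin.castSucc_ne_last j]

@[simp] theorem extendLast_last_last {d : ℕ} (M : Matrix (Fin d) (Fin d) ℂ) :
    extendLast M (Fin.last d) (Fin.last d) = 1 := by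
  simp [extendLast, blockEmb, Matrix.mul_apply, coordIncl_last, one_apply]

/-- `M ↦ M ⊕ 1` as a homomorphism of monoids. -/
def extendLastHom (d : ℕ) :
    Matrix (Fin d) (Fin d) ℂ →* Matrix (Fin (d + 1)) (Fin (d + 1)) ℂ where
  toFun := extendLast
  map_one' := blockEmb_one _
  map_mul' := blockEmb_mul (coordIncl_isometry (by omega))

theorem extendLast_mem {d : ℕ} {M : Matrix (Fin d) (Fin d) ℂ}
    (hM : M ∈ specialUnitaryGroup (Fin d) ℂ) :
    extendLast M ∈ specialUnitaryGroup (Fin (d + 1)) ℂ :=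
  blockEmb_mem_specialUnitaryGroup (coordIncl_isometry (by omega)) hM

theorem extendLast_rot {d r : ℕ} (h : r + 1 < d) (ξ φ η : ℝ) :
    extendLast (rot d r ξ φ η) = rot (d + 1) r ξ φ η := by
  ext a b
  refine Fin.lastCases ?_ (fun i => ?_) a <;> refine Fin.lastCases ?_ (fun j => ?_) b
  · have h1 : d ≠ r := by omega
    have h2 : d ≠ r + 1 := by omega
    simp [rot, h1, h2]
  · have h1 : d ≠ r := by omega
    have h2 : d ≠ r + 1 := by omega
    simp [rot, h1, h2, (Fin.castSucc_ne_last j).symm]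
  · have h1 : d ≠ r := by omega
    have h2 : d ≠ r + 1 := by omega
    simp [rot, h1, h2, Fin.castSucc_ne_last i]
  · simp [rot]

theorem extendLast_hurwitzE (n : ℕ) (ξ φ : AnglePair (n + 1) → ℝ) (η : Fin (n + 2) → ℝ)
    (j : Fin (n + 1)) :
    extendLast (hurwitzE n (fun p => ξ ⟨p.1.castSucc, p.2⟩) (fun p => φ ⟨p.1.castSucc, p.2⟩)
      (fun i => η i.castSucc) j) = hurwitzE (n + 1) ξ φ η j.castSucc := by
  change extendLastHom _ _ = _
  unfold hurwitzE
  rw [map_list_prod, List.map_reverse, List.map_ofFn]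
  congr 3
  funext r
  change extendLast _ = _
  dsimp only
  have hr : (r : ℕ) < j + 1 := r.2
  rw [apply_ite extendLast, extendLast_rot (by omega), extendLast_rot (by omega)]

/-- Only the last factor touches the last coordinate. This recursion carries the induction on the
dimension. -/
theorem hurwitzV_succ (n : ℕ) (ξ φ : AnglePair (n + 1) → ℝ) (η : Fin (n + 2) → ℝ) :
    hurwitzV (n + 1) ξ φ η =
      extendLast (hurwitzV n (fun p => ξ ⟨p.1.castSucc, p.2⟩) (fun p => φ ⟨p.1.castSucc, p.2⟩)
        (fun i => η i.castSucc)) * hurwitzE (n + 1) ξ φ η (Fin.last (n + 1)) := by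
  unfold hurwitzV
  rw [List.ofFn_succ', List.prod_concat]
  congr 1
  change _ = extendLastHom _ _
  rw [map_list_prod, List.map_ofFn]
  congr 2
  funext j
  exact (extendLast_hurwitzE n ξ φ η j).symm

theorem hurwitzV_zero (ξ φ : AnglePair 0 → ℝ) (η : Fin 1 → ℝ) :
    hurwitzV 0 ξ φ η = hurwitzE 0 ξ φ η (Fin.last 0) := by
  simp [hurwitzV]

/-! ### The last factor -/

/-- The product `R_{k+1} ⋯ R_1` with angles given by sequences. -/
def rotChain (d : ℕ) (ξ φ : ℕ → ℝ) (η : ℝ) : ℕ → Matrix (Fin d) (Fin d) ℂ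
  | 0 => rot d 0 (ξ 0) (φ 0) η
  | k + 1 => rot d (k + 1) (ξ (k + 1)) 0 (φ (k + 1)) * rotChain d ξ φ η k

theorem rotChain_eq_prod (d : ℕ) (ξ φ : ℕ → ℝ) (η : ℝ) (k : ℕ) :
    rotChain d ξ φ η k = ((List.ofFn fun r : Fin (k + 1) =>
      if (r : ℕ) = 0 then rot d 0 (ξ r) (φ r) η else rot d r (ξ r) 0 (φ r)).reverse).prod := by
  induction k with
  | zero => simp [rotChain]
  | succ k ih =>
    rw [List.ofFn_succ', List.concat_eq_append, List.reverse_concat, List.prod_cons, rotChain, ih]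
    simp

/-- Angles given by sequences on `ℕ` allow recursion on the length of the chain without dependent
index types. -/
theorem hurwitzE_eq_rotChain (n : ℕ) (ξ φ : AnglePair n → ℝ) (η : Fin (n + 1) → ℝ)
    (j : Fin (n + 1)) (ξ' φ' : ℕ → ℝ) (hξ : ∀ r : Fin ((j : ℕ) + 1), ξ' r = ξ ⟨j, r⟩)
    (hφ : ∀ r : Fin ((j : ℕ) + 1), φ' r = φ ⟨j, r⟩) :
    hurwitzE n ξ φ η j = rotChain (n + 2) ξ' φ' (η j) j := by
  rw [rotChain_eq_prod, hurwitzE]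
  simp only [hξ, hφ]

/-- The coordinates of the last row of `R_k ⋯ R_1`, as a function of `k` angles `θ` and `k + 1`
phases. -/
def lastRow : (k : ℕ) → (Fin k ⊕ Fin (k + 1) → ℝ) → Fin (k + 1) → ℂ
  | 0, x => fun _ => Complex.exp (-(Complex.I * x (Sum.inr 0)))
  | k + 1, x => Fin.snoc (α := fun _ => ℂ)
      (fun i => Real.sin (xiOf (k + 1) (x (Sum.inl (Fin.last k)))) *
        lastRow k (x ∘ Sum.map Fin.castSucc Fin.castSucc) i)
      (Real.cos (xiOf (k + 1) (x (Sum.inl (Fin.last k)))) *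
        Complex.exp (-(Complex.I * x (Sum.inr (Fin.last (k + 1))))))

theorem rotChain_apply_of_lt {d : ℕ} (ξ φ : ℕ → ℝ) (η : ℝ) (k : ℕ) (a b : Fin d)
    (ha : k + 1 < a) : rotChain d ξ φ η k a b = if a = b then 1 else 0 := by
  induction k generalizing b with
  | zero =>
    have h0 : (a : ℕ) ≠ 0 := by omega
    have h1 : (a : ℕ) ≠ 1 := by omega
    simp [rotChain, rot, h0, h1]
  | succ k ih =>
    have h0 : (a : ℕ) ≠ k + 1 := by omega
    have h1 : (a : ℕ) ≠ k + 1 + 1 := by omega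
    simp [rotChain, rot, Matrix.mul_apply, h0, h1, ih b (by omega)]

theorem rot_apply_right_of_lt {d : ℕ} (r : ℕ) (ξ φ η : ℝ) (a b : Fin d) (hb : r + 1 < b) :
    rot d r ξ φ η a b = if a = b then 1 else 0 := by
  have h0 : (b : ℕ) ≠ r := by omega
  have h1 : (b : ℕ) ≠ r + 1 := by omega
  simp [rot, h0, h1]

theorem rotChain_apply_right_of_lt {d : ℕ} (ξ φ : ℕ → ℝ) (η : ℝ) (k : ℕ) (a b : Fin d)
    (hb : k + 1 < b) : rotChain d ξ φ η k a b = if a = b then 1 else 0 := by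
  induction k with
  | zero => exact rot_apply_right_of_lt _ _ _ _ _ _ hb
  | succ k ih =>
    rw [rotChain, Matrix.mul_apply]
    have : ∀ c, rotChain d ξ φ η k c b = if c = b then 1 else 0 := by
      intro c
      clear ih
      induction k generalizing c with
      | zero => exact rot_apply_right_of_lt _ _ _ _ _ _ (by omega)
      | succ k ih =>
        rw [rotChain, Matrix.mul_apply]
        simp [ih (by omega), rot_apply_right_of_lt (k + 1) _ _ _ c b (by omega)]
    simp [this, rot_apply_right_of_lt (k + 1) _ _ _ a b (by omega)]

/-- The leftmost rotation mixes two adjacent rows, the lower of which is still a unit vector. So the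
old last row is scaled by `sin ξ` and one entry `cos ξ` with a fresh phase is appended. The phases
of the row are, in order, `φ_1`, `η`, `φ_2`, `φ_3`, …: `R_1` alone contributes two of them. -/
theorem rotChain_lastRow {d : ℕ} (ξ φ : ℕ → ℝ) (η : ℝ) (k : ℕ) (hk : k + 1 < d)
    (x : Fin (k + 1) ⊕ Fin (k + 2) → ℝ)
    (hξ : ∀ r : Fin (k + 1), ξ r = xiOf (r + 1) (x (Sum.inl r)))
    (h0 : x (Sum.inr 0) = φ 0) (h1 : x (Sum.inr 1) = η)
    (hφ : ∀ r : Fin k, x (Sum.inr r.succ.succ) = φ (r + 1)) (i : Fin (k + 2)) :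
    rotChain d ξ φ η k ⟨k + 1, hk⟩ ⟨i, by omega⟩ = lastRow (k + 1) x i := by
  induction k with
  | zero =>
    have h := hξ 0
    simp only [Fin.val_zero, zero_add] at h
    fin_cases i
    · simp [rotChain, rot, lastRow, h, Fin.snoc, h0]
    · have h1' : x (Sum.inr 1) = η := h1
      simp [rotChain, rot, lastRow, h, Fin.snoc, h1']
  | succ k ih =>
    have hlast := hξ (Fin.last (k + 1))
    have hφl := hφ (Fin.last k)
    simp only [Fin.val_last, Fin.succ_last] at hlast hφl
    have key := ih (by omega) (x ∘ Sum.map Fin.castSucc Fin.castSucc)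
      (fun r => by simpa using hξ r.castSucc) (by simpa using h0) (by simpa using h1)
      (fun r => by
        have := hφ r.castSucc
        simpa using this)
    -- The row of index `k + 2` of the new rotation is supported on the columns `k + 1` and `k + 2`.
    rw [rotChain, Matrix.mul_apply, lastRow,
      Finset.sum_eq_add (⟨k + 1, by omega⟩ : Fin d) (⟨k + 1 + 1, hk⟩ : Fin d)
        (by simp) ?_ (by simp) (by simp)]
    · refine Fin.lastCases ?_ (fun i => ?_) i
      · rw [Fin.snoc_last, rotChain_apply_of_lt _ _ _ _ ⟨k + 1 + 1, hk⟩ _ (by simp),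
          rotChain_apply_right_of_lt _ _ _ _ _ _ (by simp)]
        simp [rot, hlast, hφl]
      · rw [Fin.snoc_castSucc, ← key i, rotChain_apply_of_lt _ _ _ _ ⟨k + 1 + 1, hk⟩ _ (by simp)]
        have : k + 1 + 1 ≠ i := by omega
        simp [rot, hlast, this]
    · rintro c - ⟨hc1, hc2⟩
      have e1 : (c : ℕ) ≠ k + 1 := fun h => hc1 (Fin.ext h)
      have e2 : (c : ℕ) ≠ k + 1 + 1 := fun h => hc2 (Fin.ext h)
      have e3 : (⟨k + 1 + 1, hk⟩ : Fin d) ≠ c := fun h => hc2 h.symm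
      simp [rot, e1, e2, e3]

/-! ### The angle `ξ` -/

theorem angleMod_mem (θ : ℝ) : angleMod θ ∈ Set.Ico 0 (2 * Real.pi) := by
  simpa [angleMod] using toIcoMod_mem_Ico Real.two_pi_pos 0 θ

theorem cos_angleMod (θ : ℝ) : Real.cos (angleMod θ) = Real.cos θ := by
  have h : angleMod θ = θ - toIcoDiv Real.two_pi_pos 0 θ * (2 * Real.pi) := by
    rw [angleMod, toIcoMod, zsmul_eq_mul]
  rw [h, Real.cos_sub_int_mul_two_pi]

/-- The triangle wave is written through `cos θ`, which makes periodicity and continuity evident and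
confines the loss of smoothness to `cos θ = ±1`. -/
theorem abs_one_sub_angleMod_div_pi (θ : ℝ) :
    |1 - angleMod θ / Real.pi| = Real.arccos (-Real.cos θ) / Real.pi := by
  have hπ := Real.pi_pos
  obtain ⟨h0, h1⟩ := angleMod_mem θ
  have h2 : |1 - angleMod θ / Real.pi| = |Real.pi - angleMod θ| / Real.pi := by
    rw [← abs_of_pos hπ, ← abs_div, abs_of_pos hπ]
    congr 1
    field_simp
  rw [h2, ← cos_angleMod, ← Real.cos_pi_sub, ← Real.cos_abs, Real.arccos_cos (abs_nonneg _)]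
  rw [abs_le]
  constructor <;> linarith

theorem xiOf_eq (r : ℕ) (θ : ℝ) :
    xiOf r θ = Real.arcsin ((Real.arccos (-Real.cos θ) / Real.pi) ^ (1 / (2 * (r : ℝ)))) := by
  rw [xiOf, abs_one_sub_angleMod_div_pi]

theorem xiOf_add_int_mul_two_pi (r : ℕ) (θ : ℝ) (k : ℤ) :
    xiOf r (θ + k * (2 * Real.pi)) = xiOf r θ := by
  rw [xiOf_eq, xiOf_eq, Real.cos_add_int_mul_two_pi]

theorem continuous_xiOf (r : ℕ) : Continuous (xiOf r) := by
  have : xiOf r = fun θ =>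
      Real.arcsin ((Real.arccos (-Real.cos θ) / Real.pi) ^ (1 / (2 * (r : ℝ)))) :=
    funext (xiOf_eq r)
  rw [this]
  refine Real.continuous_arcsin.comp (Continuous.rpow_const ?_ fun _ => Or.inr (by positivity))
  exact (Real.continuous_arccos.comp Real.continuous_cos.neg).div_const _

theorem abs_cos_lt_one {θ : ℝ} (h : ∀ k : ℤ, θ ≠ k * Real.pi) : |Real.cos θ| < 1 := by
  have hs : Real.sin θ ≠ 0 := fun h0 => by
    obtain ⟨k, hk⟩ := Real.sin_eq_zero_iff.1 h0
    exact h k hk.symm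
  rw [← sq_lt_one_iff_abs_lt_one]
  have := Real.sin_sq_add_cos_sq θ
  have := pow_pos (abs_pos.2 hs) 2
  rw [sq_abs] at this
  linarith

theorem arccos_neg_cos_div_pi_mem {θ : ℝ} (h : ∀ k : ℤ, θ ≠ k * Real.pi) :
    Real.arccos (-Real.cos θ) / Real.pi ∈ Set.Ioo (0 : ℝ) 1 := by
  have h1 := abs_lt.1 (abs_cos_lt_one h)
  refine ⟨div_pos (Real.arccos_pos.2 (by linarith)) Real.pi_pos, (div_lt_one Real.pi_pos).2 ?_⟩
  refine lt_of_le_of_ne (Real.arccos_le_pi _) fun h2 => ?_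
  rw [Real.arccos_eq_pi] at h2
  linarith

/-- Off `πℤ` the cosine lies strictly between `-1` and `1`. Then the base of the power and the
argument of `arcsin` stay away from the points where these functions fail to be smooth. -/
theorem contDiffAt_xiOf {r : ℕ} (hr : 0 < r) {θ : ℝ} (h : ∀ k : ℤ, θ ≠ k * Real.pi)
    {n : WithTop ℕ∞} : ContDiffAt ℝ n (xiOf r) θ := by
  have : xiOf r = fun θ =>
      Real.arcsin ((Real.arccos (-Real.cos θ) / Real.pi) ^ (1 / (2 * (r : ℝ)))) :=
    funext (xiOf_eq r)
  rw [this]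
  have h1 := abs_lt.1 (abs_cos_lt_one h)
  obtain ⟨h2, h3⟩ := arccos_neg_cos_div_pi_mem h
  have hpos : (0 : ℝ) < 1 / (2 * (r : ℝ)) := by positivity
  have h4 := Real.rpow_lt_one h2.le h3 hpos
  have h5 := Real.rpow_nonneg h2.le (1 / (2 * (r : ℝ)))
  refine (Real.contDiffAt_arcsin (by linarith) (by linarith)).comp θ ?_
  refine ContDiffAt.rpow_const_of_ne ?_ h2.ne'
  refine ContDiffAt.div_const ?_ _
  exact (Real.contDiffAt_arccos (by linarith) (by linarith)).comp θ Real.contDiff_cos.neg.contDiffAt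

/-- A shift by `π` replaces the triangle wave by its complement to `1`, that is, it exchanges `sin²
ξ` and `cos² ξ`. This makes the qubit drive a shifted instance of the general one. -/
theorem qubitXi_eq_xiOf (θ : ℝ) : qubitXi θ = xiOf 1 (θ + Real.pi) := by
  have hπ := Real.pi_pos
  rw [qubitXi, xiOf_eq, Real.cos_add_pi, neg_neg, abs_one_sub_angleMod_div_pi, Real.arccos_neg]
  have h : (0 : ℝ) ≤ Real.arccos (Real.cos θ) / Real.pi :=
    div_nonneg (Real.arccos_nonneg _) hπ.le
  have h' : Real.arccos (Real.cos θ) / Real.pi ≤ 1 := (div_le_one hπ).2 (Real.arccos_le_pi _)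
  rw [Real.arccos_eq_arcsin (Real.sqrt_nonneg _), Real.sq_sqrt, Real.sqrt_eq_rpow]
  · congr 1
    simp only [Nat.cast_one, mul_one]
    congr 1
    field_simp
    ring
  · rw [sub_div, div_self hπ.ne']; linarith

/-! ### Entries in a function algebra -/

section Entries

variable {X : Type*} (A : Subalgebra ℂ (X → ℂ))

/-- All entries of the matrix function belong to the function algebra. -/
def EntriesIn {ι κ : Type*} (F : X → Matrix ι κ ℂ) : Prop := ∀ a b, (fun x => F x a b) ∈ A

variable {A}

theorem EntriesIn.const {ι κ : Type*} (M : Matrix ι κ ℂ) : EntriesIn A fun _ => M :=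
  fun a b => A.algebraMap_mem (M a b)

theorem EntriesIn.mul {ι κ l : Type*} [Fintype κ] {F : X → Matrix ι κ ℂ} {G : X → Matrix κ l ℂ}
    (hF : EntriesIn A F) (hG : EntriesIn A G) : EntriesIn A fun x => F x * G x := by
  intro a b
  have : (fun x => (F x * G x) a b) = ∑ c, (fun x => F x a c) * fun x => G x c b := by
    ext x; simp [Matrix.mul_apply]
  rw [this]
  exact sum_mem fun c _ => mul_mem (hF a c) (hG c b)

theorem EntriesIn.list_prod {ι J : Type*} [Fintype ι] [DecidableEq ι] (l : List J)
    {F : J → X → Matrix ι ι ℂ} (hF : ∀ j, EntriesIn A (F j)) :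
    EntriesIn A fun x => (l.map fun j => F j x).prod := by
  induction l with
  | nil => simpa using EntriesIn.const 1
  | cons j l ih => simpa using (hF j).mul ih

theorem entriesIn_rot (d r : ℕ) {ξ φ η : X → ℝ} (hc : (fun x => (Real.cos (ξ x) : ℂ)) ∈ A)
    (hs : (fun x => (Real.sin (ξ x) : ℂ)) ∈ A)
    (hφ : (fun x => Complex.exp (Complex.I * φ x)) ∈ A)
    (hφ' : (fun x => Complex.exp (-(Complex.I * φ x))) ∈ A)
    (hη : (fun x => Complex.exp (Complex.I * η x)) ∈ A)
    (hη' : (fun x => Complex.exp (-(Complex.I * η x))) ∈ A) :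
    EntriesIn A fun x => rot d r (ξ x) (φ x) (η x) := by
  intro a b
  simp only [rot, of_apply]
  split_ifs
  · exact mul_mem hc hη
  · exact neg_mem (mul_mem hs hφ)
  · exact mul_mem hs hφ'
  · exact mul_mem hc hη'
  · exact one_mem A
  · exact zero_mem A

/-- The entries are polynomials in the sines, cosines and phases. The lemma is applied to the
algebra of continuous functions and to `regularAlgebra`. -/
theorem entriesIn_hurwitzV (n : ℕ) {ξ φ : X → AnglePair n → ℝ} {η : X → Fin (n + 1) → ℝ}
    (hc : ∀ p, (fun x => (Real.cos (ξ x p) : ℂ)) ∈ A)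
    (hs : ∀ p, (fun x => (Real.sin (ξ x p) : ℂ)) ∈ A)
    (hφ : ∀ p, (fun x => Complex.exp (Complex.I * φ x p)) ∈ A)
    (hφ' : ∀ p, (fun x => Complex.exp (-(Complex.I * φ x p))) ∈ A)
    (hη : ∀ p, (fun x => Complex.exp (Complex.I * η x p)) ∈ A)
    (hη' : ∀ p, (fun x => Complex.exp (-(Complex.I * η x p))) ∈ A) :
    EntriesIn A fun x => hurwitzV n (ξ x) (φ x) (η x) := by
  have h1 : (fun _ : X => (1 : ℂ)) ∈ A := one_mem A
  unfold hurwitzV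
  simp only [List.ofFn_eq_map]
  refine EntriesIn.list_prod _ fun j => ?_
  unfold hurwitzE
  simp only [List.ofFn_eq_map, ← List.map_reverse]
  refine EntriesIn.list_prod _ fun r => ?_
  split_ifs
  · exact entriesIn_rot _ _ (hc _) (hs _) (hφ _) (hφ' _) (hη _) (hη' _)
  · exact entriesIn_rot _ _ (hc _) (hs _) (by simpa using h1) (by simpa using h1)
      (hφ _) (hφ' _)

end Entries

theorem continuous_hurwitzTorus (n : ℕ) : Continuous (hurwitzTorus n) := by
  let A : Subalgebra ℂ ((EulerIndex n → ℝ) → ℂ) :=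
    { carrier := {f | Continuous f}
      mul_mem' := fun hf hg => hf.mul hg
      add_mem' := fun hf hg => hf.add hg
      algebraMap_mem' := fun _ => continuous_const }
  have hmem : ∀ f, f ∈ A ↔ Continuous f := fun _ => Iff.rfl
  have hx : ∀ r, Continuous (xiOf r) := continuous_xiOf
  refine continuous_matrix fun a b => ?_
  refine entriesIn_hurwitzV (A := A) n ?_ ?_ ?_ ?_ ?_ ?_ a b <;> intro p <;> rw [hmem]
  · exact Complex.continuous_ofReal.comp (Real.continuous_cos.comp ((hx _).comp (continuous_apply _)))
  · exact Complex.continuous_ofReal.comp (Real.continuous_sin.comp ((hx _).comp (continuous_apply _)))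
  all_goals fun_prop

theorem exp_I_mul_add_int (x : ℝ) (k : ℤ) :
    Complex.exp (Complex.I * ((x + k * (2 * Real.pi) : ℝ) : ℂ)) = Complex.exp (Complex.I * x) := by
  rw [show Complex.I * ((x + k * (2 * Real.pi) : ℝ) : ℂ) =
    Complex.I * x + k * (2 * Real.pi * Complex.I) by push_cast; ring, Complex.exp_add,
    Complex.exp_int_mul_two_pi_mul_I, mul_one]

theorem exp_neg_I_mul_add_int (x : ℝ) (k : ℤ) :
    Complex.exp (-(Complex.I * ((x + k * (2 * Real.pi) : ℝ) : ℂ))) =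
      Complex.exp (-(Complex.I * x)) := by
  rw [Complex.exp_neg, Complex.exp_neg, exp_I_mul_add_int]

theorem rot_add_int (d r : ℕ) (ξ φ η : ℝ) (k l : ℤ) :
    rot d r ξ (φ + k * (2 * Real.pi)) (η + l * (2 * Real.pi)) = rot d r ξ φ η := by
  unfold rot
  simp only [exp_I_mul_add_int, exp_neg_I_mul_add_int]

theorem hurwitzTorus_add_int (n : ℕ) (x : EulerIndex n → ℝ) (k : EulerIndex n → ℤ) :
    hurwitzTorus n (fun i => x i + k i * (2 * Real.pi)) = hurwitzTorus n x := by
  unfold hurwitzTorus hurwitzV hurwitzE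
  simp only [xiOf_add_int_mul_two_pi]
  congr 3
  funext j
  congr 4
  funext r
  split_ifs
  · exact rot_add_int _ _ _ _ _ _ _
  · simpa using rot_add_int (n + 2) r _ 0 _ 0 _

/-! ### Separating the phase `η_{d-1}` -/

/-- The diagonal phases `(e^{is}, e^{-is}, 1, …, 1)`. -/
def leadPhase (d : ℕ) (s : ℝ) (a : Fin d) : ℂ :=
  if (a : ℕ) = 0 then Complex.exp (Complex.I * s)
  else if (a : ℕ) = 1 then Complex.exp (-(Complex.I * s)) else 1

/-- Adding `s` to `η` and subtracting it from `φ` multiplies the first column by `e^{is}` and the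
second by `e^{-is}`. -/
theorem rot_zero_leadPhase (d : ℕ) (ξ φ s : ℝ) :
    rot d 0 ξ (φ - s) s = rot d 0 ξ φ 0 * Matrix.diagonal (leadPhase d s) := by
  ext a b
  rw [Matrix.mul_diagonal]
  by_cases ha : (a : ℕ) = 0 <;> by_cases ha' : (a : ℕ) = 1 <;> by_cases hb : (b : ℕ) = 0 <;>
    by_cases hb' : (b : ℕ) = 1 <;> first
    | omega
    | (simp [rot, leadPhase, ha, ha', hb, hb', mul_sub, Complex.exp_sub, Complex.exp_neg,
        div_eq_mul_inv, Fin.ext_iff]; done)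
    | (simp [rot, leadPhase, ha, ha', hb, hb', mul_sub, Complex.exp_sub, Complex.exp_neg,
        div_eq_mul_inv, Fin.ext_iff]; ring)

theorem rotChain_leadPhase (d : ℕ) (ξ φ φ' : ℕ → ℝ) (s : ℝ) (k : ℕ) (h0 : φ' 0 = φ 0 - s)
    (h : ∀ r, φ' (r + 1) = φ (r + 1)) :
    rotChain d ξ φ' s k = rotChain d ξ φ 0 k * Matrix.diagonal (leadPhase d s) := by
  induction k with
  | zero => rw [rotChain, rotChain, h0, rot_zero_leadPhase]
  | succ k ih => rw [rotChain, rotChain, ih, h, Matrix.mul_assoc]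

theorem hurwitzV_eq_mul (n : ℕ) (ξ φ : AnglePair n → ℝ) (η : Fin (n + 1) → ℝ) :
    hurwitzV n ξ φ η = (List.ofFn fun j : Fin n => hurwitzE n ξ φ η j.castSucc).prod *
      hurwitzE n ξ φ η (Fin.last n) := by
  rw [hurwitzV, List.ofFn_succ', List.prod_concat]

theorem hurwitzE_congr (n : ℕ) {ξ ξ' φ φ' : AnglePair n → ℝ} {η η' : Fin (n + 1) → ℝ}
    {j : Fin (n + 1)} (hξ : ∀ r, ξ ⟨j, r⟩ = ξ' ⟨j, r⟩) (hφ : ∀ r, φ ⟨j, r⟩ = φ' ⟨j, r⟩)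
    (hη : η j = η' j) : hurwitzE n ξ φ η j = hurwitzE n ξ' φ' η' j := by
  unfold hurwitzE
  simp only [hξ, hφ, hη]

/-- A function on `Fin (k + 1)` as a sequence. -/
def extendSeq {k : ℕ} (f : Fin (k + 1) → ℝ) (r : ℕ) : ℝ := f (Fin.ofNat (k + 1) r)

theorem extendSeq_val {k : ℕ} (f : Fin (k + 1) → ℝ) (r : Fin (k + 1)) : extendSeq f r = f r := by
  simp [extendSeq]

/-- `R_1` in `E_{d-1}` is the rightmost factor of `V`, so its column phases can be pulled out of the
whole product. This is why `φ_{1,d-1}` is driven at `ω - q_1`. -/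
theorem hurwitzTorus_assignAngles (n : ℕ) (y : ToneIndex n → ℝ) (s : ℝ) :
    hurwitzTorus n (assignAngles n y s) =
      hurwitzTorus n (assignAngles n y 0) * Matrix.diagonal (leadPhase (n + 2) s) := by
  unfold hurwitzTorus
  rw [hurwitzV_eq_mul, hurwitzV_eq_mul, Matrix.mul_assoc]
  congr 1
  · congr 2
    funext j
    refine hurwitzE_congr n (fun r => rfl) (fun r => ?_) ?_
    · have : (⟨j.castSucc, r⟩ : AnglePair n) ≠ lastPair n := fun h =>
        Fin.castSucc_ne_last j (congrArg Sigma.fst h)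
      simp [assignAngles, this]
    · simp [assignAngles]
  · let ξ' : ℕ → ℝ := extendSeq (k := n) fun r =>
      xiOf ((r : ℕ) + 1) (y (Sum.inl ⟨Fin.last n, r⟩))
    let φ0 : ℕ → ℝ := extendSeq (k := n) fun r => y (Sum.inr (Sum.inl ⟨Fin.last n, r⟩))
    let φ1 : ℕ → ℝ := fun r => φ0 r - if r = 0 then s else 0
    have hlp : ∀ r : Fin (n + 1), (⟨Fin.last n, r⟩ : AnglePair n) = lastPair n ↔ (r : ℕ) = 0 := by
      intro r
      constructor
      · intro h
        have := eq_of_heq (Sigma.mk.inj h).2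
        rw [this]; rfl
      · intro h
        have : r = 0 := Fin.ext h
        rw [this]; rfl
    rw [hurwitzE_eq_rotChain n _ _ _ (Fin.last n) ξ' φ1
        (fun r => extendSeq_val (k := n) _ r) (fun r => ?_),
      hurwitzE_eq_rotChain n _ _ _ (Fin.last n) ξ' φ0
        (fun r => extendSeq_val (k := n) _ r) (fun r => ?_)]
    · have e1 : assignAngles n y s (Sum.inr (Sum.inr (Fin.last n))) = s := by simp [assignAngles]
      have e2 : assignAngles n y 0 (Sum.inr (Sum.inr (Fin.last n))) = 0 := by simp [assignAngles]
      rw [e1, e2]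
      exact rotChain_leadPhase _ _ _ _ _ _ (by simp [φ1]) (fun r => by simp [φ1])
    · have := extendSeq_val (k := n) (fun r => y (Sum.inr (Sum.inl ⟨Fin.last n, r⟩))) r
      simpa [assignAngles] using this
    · have := extendSeq_val (k := n) (fun r => y (Sum.inr (Sum.inl ⟨Fin.last n, r⟩))) r
      have h2 := hlp r
      simp only [φ1, φ0, assignAngles, Sum.elim_inr, Sum.elim_inl, this]
      by_cases hr : (r : ℕ) = 0
      · rw [if_pos hr, if_pos (h2.2 hr)]
      · rw [if_neg hr, if_neg (fun h => hr (h2.1 h))]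

/-! ### Uniform angles -/

/-- The uniform probability measure on `[0, 2π)`. -/
abbrev unifAngle : Measure ℝ := ProbabilityTheory.cond volume (Set.Ico (0 : ℝ) (2 * Real.pi))

instance : IsProbabilityMeasure unifAngle := by
  refine ProbabilityTheory.cond_isProbabilityMeasure_of_finite ?_ ?_
  · simp [Real.pi_pos]
  · rw [Real.volume_Ico]; exact ENNReal.ofReal_ne_top

instance (n : ℕ) : IsProbabilityMeasure (torusMeasure n) :=
  inferInstanceAs (IsProbabilityMeasure (Measure.pi fun _ => unifAngle))

theorem unifAngle_eq : unifAngle =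
    (ENNReal.ofReal (2 * Real.pi))⁻¹ • volume.restrict (Set.Ico (0 : ℝ) (2 * Real.pi)) := by
  simp [unifAngle, ProbabilityTheory.cond]

theorem integral_unifAngle (f : ℝ → ℂ) :
    ∫ x, f x ∂unifAngle = ((2 * Real.pi : ℝ) : ℂ)⁻¹ * ∫ x in (0 : ℝ)..(2 * Real.pi), f x := by
  rw [unifAngle_eq, integral_smul_measure, intervalIntegral.integral_of_le Real.two_pi_pos.le,
    ← integral_Ico_eq_integral_Ioc, ENNReal.toReal_inv, ENNReal.toReal_ofReal Real.two_pi_pos.le,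
    Complex.real_smul, Complex.ofReal_inv]

theorem integral_unifAngle_exp (n : ℤ) :
    ∫ x, Complex.exp (n * x * Complex.I) ∂unifAngle = if n = 0 then 1 else 0 := by
  rw [integral_unifAngle]
  split_ifs with hn
  · have : (Real.pi : ℂ) ≠ 0 := by exact_mod_cast Real.pi_ne_zero
    simp only [hn, Int.cast_zero, zero_mul, Complex.exp_zero, intervalIntegral.integral_const]
    simp
    field_simp
  · have hc : (n * Complex.I : ℂ) ≠ 0 := by simp [hn]
    have : (fun x : ℝ => Complex.exp (n * x * Complex.I)) =
        fun x : ℝ => Complex.exp ((n * Complex.I) * x) := by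
      ext x; ring_nf
    rw [this, integral_exp_mul_complex hc]
    have h2 : Complex.exp ((n * Complex.I) * ((2 * Real.pi : ℝ) : ℂ)) = 1 := by
      rw [show (n * Complex.I) * ((2 * Real.pi : ℝ) : ℂ) = n * (2 * Real.pi * Complex.I) by
        push_cast; ring, Complex.exp_int_mul_two_pi_mul_I]
    rw [h2]; simp

/-! ### Equidistribution of linear flows -/

/-- The integral over `[0, T]` is bounded by `2‖z‖ / |a|` uniformly in `T`. -/
theorem hasTimeAverage_exp {a : ℝ} (ha : a ≠ 0) (z : ℂ) :
    HasTimeAverage (fun t => z * Complex.exp (a * t * Complex.I)) 0 := by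
  unfold HasTimeAverage
  have hc : (a * Complex.I : ℂ) ≠ 0 := by simp [ha]
  have h : ∀ T : ℝ, (T : ℂ)⁻¹ * ∫ t in (0 : ℝ)..T, z * Complex.exp (a * t * Complex.I) =
      (T : ℂ)⁻¹ * (z * ((Complex.exp (a * Complex.I * T) - 1) / (a * Complex.I))) := by
    intro T
    have : (fun x : ℝ => Complex.exp (a * x * Complex.I)) =
        fun x : ℝ => Complex.exp ((a * Complex.I) * x) := by
      ext x; ring_nf
    rw [intervalIntegral.integral_const_mul, this, integral_exp_mul_complex hc]
    simp
  simp only [h]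
  refine squeeze_zero_norm' (a := fun T : ℝ => T⁻¹ * (‖z‖ * (2 / ‖(a * Complex.I : ℂ)‖))) ?_ ?_
  · filter_upwards [eventually_gt_atTop 0] with T hT
    rw [norm_mul, norm_mul, norm_div, norm_inv, Complex.norm_real, Real.norm_of_nonneg hT.le]
    gcongr
    refine (norm_sub_le _ _).trans ?_
    rw [show (a * Complex.I * T : ℂ) = ((a * T : ℝ) : ℂ) * Complex.I by push_cast; ring,
      Complex.norm_exp_ofReal_mul_I]
    norm_num
  · simpa using tendsto_inv_atTop_zero.mul_const (‖z‖ * (2 / ‖(a * Complex.I : ℂ)‖))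

theorem hasTimeAverage_const (z : ℂ) : HasTimeAverage (fun _ => z) z := by
  unfold HasTimeAverage
  refine Tendsto.congr' ?_ tendsto_const_nhds
  filter_upwards [eventually_gt_atTop 0] with T hT
  have : (T : ℂ) ≠ 0 := by exact_mod_cast hT.ne'
  simp [this]

section Average

variable {K Y : Type*} [TopologicalSpace K] [CompactSpace K] [TopologicalSpace Y]
  [MeasurableSpace Y] [OpensMeasurableSpace Y]

theorem integrable_comp_continuousMap (μ : Measure Y) [IsProbabilityMeasure μ] {q : Y → K}
    (hq : Continuous q) (G : C(K, ℂ)) : Integrable (fun y => G (q y)) μ := by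
  refine Integrable.of_bound (C := ‖G‖) ?_ (ae_of_all _ fun y => G.norm_coe_le_norm _)
  exact (G.continuous.comp hq).measurable.aestronglyMeasurable

/-- The continuous functions whose time averages along `γ` equal their integrals form a subspace. -/
def averagedSubmodule (γ : ℝ → K) (hγ : Continuous γ) (μ : Measure Y) [IsProbabilityMeasure μ]
    (q : Y → K) (hq : Continuous q) : Submodule ℂ C(K, ℂ) where
  carrier := {G | HasTimeAverage (fun t => G (γ t)) (∫ y, G (q y) ∂μ)}
  zero_mem' := by simpa using hasTimeAverage_const 0
  add_mem' := by
    intro F G hF hG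
    have h := Tendsto.add hF hG
    change HasTimeAverage _ _
    simp only [ContinuousMap.add_apply]
    rw [integral_add (integrable_comp_continuousMap μ hq F) (integrable_comp_continuousMap μ hq G)]
    refine h.congr fun T => ?_
    have hF' : Continuous fun t => F (γ t) := F.continuous.comp hγ
    have hG' : Continuous fun t => G (γ t) := G.continuous.comp hγ
    rw [intervalIntegral.integral_add (hF'.intervalIntegrable _ _) (hG'.intervalIntegrable _ _)]
    ring
  smul_mem' := by
    intro z F hF
    have h := Tendsto.const_mul z hF
    change HasTimeAverage _ _
    simp only [ContinuousMap.smul_apply, smul_eq_mul]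
    rw [integral_const_mul]
    refine h.congr fun T => ?_
    rw [intervalIntegral.integral_const_mul]
    ring

/-- Time averages over `[0, T]` and integrals against a probability measure are both contractions
for the supremum norm, so an `ε/3` argument applies. -/
theorem isClosed_averagedSubmodule (γ : ℝ → K) (hγ : Continuous γ) (μ : Measure Y)
    [IsProbabilityMeasure μ] (q : Y → K) (hq : Continuous q) :
    IsClosed (averagedSubmodule γ hγ μ q hq : Set C(K, ℂ)) := by
  rw [← closure_subset_iff_isClosed]
  intro F hF
  change HasTimeAverage _ _
  rw [HasTimeAverage, Metric.tendsto_nhds]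
  intro ε hε
  obtain ⟨G, hG, hFG⟩ := Metric.mem_closure_iff.1 hF (ε / 3) (by positivity)
  have hG' : HasTimeAverage (fun t => G (γ t)) (∫ y, G (q y) ∂μ) := hG
  rw [HasTimeAverage, Metric.tendsto_nhds] at hG'
  have hle : ∀ x, ‖F x - G x‖ ≤ dist F G := fun x => by
    rw [← dist_eq_norm]; exact ContinuousMap.dist_apply_le_dist x
  filter_upwards [hG' (ε / 3) (by positivity), eventually_gt_atTop 0] with T hT hT0
  have h1 : dist ((T : ℂ)⁻¹ * ∫ t in (0 : ℝ)..T, F (γ t)) ((T : ℂ)⁻¹ * ∫ t in (0 : ℝ)..T, G (γ t))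
      ≤ dist F G := by
    have hF' : Continuous fun t => F (γ t) := F.continuous.comp hγ
    have hG' : Continuous fun t => G (γ t) := G.continuous.comp hγ
    rw [dist_eq_norm, ← mul_sub, ← intervalIntegral.integral_sub
      (hF'.intervalIntegrable _ _) (hG'.intervalIntegrable _ _),
      norm_mul, norm_inv, Complex.norm_real, Real.norm_of_nonneg hT0.le]
    have := intervalIntegral.norm_integral_le_of_norm_le_const (a := 0) (b := T) (C := dist F G)
      (f := fun t => F (γ t) - G (γ t)) (fun t _ => hle _)
    rw [sub_zero, abs_of_pos hT0] at this
    rw [inv_mul_le_iff₀ hT0, mul_comm]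
    exact this
  have h2 : dist (∫ y, G (q y) ∂μ) (∫ y, F (q y) ∂μ) ≤ dist F G := by
    rw [dist_comm, dist_eq_norm, ← integral_sub (integrable_comp_continuousMap μ hq F)
      (integrable_comp_continuousMap μ hq G)]
    refine (norm_integral_le_of_norm_le_const (C := dist F G) (ae_of_all _ fun y => hle _)).trans ?_
    simp
  have h3 := dist_triangle4 ((T : ℂ)⁻¹ * ∫ t in (0 : ℝ)..T, F (γ t))
    ((T : ℂ)⁻¹ * ∫ t in (0 : ℝ)..T, G (γ t)) (∫ y, G (q y) ∂μ) (∫ y, F (q y) ∂μ)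
  linarith

end Average

/-- The covering of the torus by `ℝ^ι`, with period `2π` in each coordinate. -/
def torusCover (ι : Type*) (x : ι → ℝ) : UnitAddTorus ι :=
  fun i => ((x i / (2 * Real.pi) : ℝ) : UnitAddCircle)

theorem mFourier_torusCover {ι : Type*} [Fintype ι] (n : ι → ℤ) (x : ι → ℝ) :
    UnitAddTorus.mFourier n (torusCover ι x) = ∏ i, Complex.exp (n i * x i * Complex.I) := by
  simp only [UnitAddTorus.mFourier, ContinuousMap.coe_mk, torusCover]
  refine Finset.prod_congr rfl fun i _ => ?_
  rw [fourier_coe_apply]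
  congr 1
  have : (Real.pi : ℂ) ≠ 0 := by exact_mod_cast Real.pi_ne_zero
  push_cast
  field_simp

theorem isOpenQuotientMap_torusCover (ι : Type*) : IsOpenQuotientMap (torusCover ι) := by
  have h : torusCover ι = Pi.map fun _ : ι => fun x : ℝ =>
      ((x / (2 * Real.pi) : ℝ) : UnitAddCircle) := rfl
  rw [h]
  refine IsOpenQuotientMap.piMap fun _ => ?_
  have h1 : IsOpenQuotientMap fun x : ℝ => x / (2 * Real.pi) := by
    simp only [div_eq_mul_inv]
    exact (Homeomorph.mulRight₀ (2 * Real.pi)⁻¹ (inv_ne_zero Real.two_pi_pos.ne')).isOpenQuotientMap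
  exact QuotientAddGroup.isOpenQuotientMap_mk.comp h1

theorem exists_int_of_torusCover_eq {ι : Type*} {x y : ι → ℝ} (h : torusCover ι x = torusCover ι y) :
    ∃ k : ι → ℤ, x = fun i => y i + k i * (2 * Real.pi) := by
  have h1 : ∀ i, ∃ k : ℤ, x i = y i + k * (2 * Real.pi) := by
    intro i
    have h2 : ((x i / (2 * Real.pi) : ℝ) : UnitAddCircle) = ((y i / (2 * Real.pi) : ℝ)) :=
      congrFun h i
    rw [QuotientAddGroup.eq_iff_sub_mem, AddSubgroup.mem_zmultiples_iff] at h2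
    obtain ⟨k, hk⟩ := h2
    refine ⟨k, ?_⟩
    have hπ := Real.pi_ne_zero
    simp only [zsmul_eq_mul, mul_one] at hk
    rw [hk]
    field_simp
    ring
  choose k hk using h1
  exact ⟨k, funext hk⟩

/-- Weyl's equidistribution theorem for linear flows on the torus. -/
theorem hasTimeAverage_linearFlow {ι : Type*} [Fintype ι] {ν : ι → ℝ}
    (hν : LinearIndependent ℤ ν) (c : ι → ℝ) {f : (ι → ℝ) → ℂ} (hf : Continuous f)
    (hper : ∀ (x : ι → ℝ) (k : ι → ℤ), f (fun i => x i + k i * (2 * Real.pi)) = f x) :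
    HasTimeAverage (fun t => f fun i => c i + ν i * t)
      (∫ x, f x ∂Measure.pi fun _ : ι => unifAngle) := by
  have hq := isOpenQuotientMap_torusCover ι
  let γ : ℝ → UnitAddTorus ι := fun t => torusCover ι fun i => c i + ν i * t
  have hγ : Continuous γ := hq.continuous.comp (by fun_prop)
  let S := averagedSubmodule γ hγ (Measure.pi fun _ : ι => unifAngle) (torusCover ι) hq.continuous
  -- A character has mean zero unless it is trivial. Along the flow it oscillates at frequency `∑ nᵢ
  -- νᵢ`, which is nonzero for `n ≠ 0` by independence.
  have hmono : ∀ n : ι → ℤ, UnitAddTorus.mFourier n ∈ S := by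
    intro n
    change HasTimeAverage _ _
    have h1 : ∫ x, UnitAddTorus.mFourier n (torusCover ι x) ∂(Measure.pi fun _ : ι => unifAngle)
        = if n = 0 then 1 else 0 := by
      simp only [mFourier_torusCover]
      rw [integral_fintype_prod_eq_prod (f := fun i (x : ℝ) => Complex.exp (n i * x * Complex.I))]
      simp only [integral_unifAngle_exp]
      split_ifs with hn
      · simp [hn]
      · obtain ⟨i, hi⟩ := Function.ne_iff.1 hn
        exact Finset.prod_eq_zero (Finset.mem_univ i) (if_neg hi)
    rw [h1]
    have h2 : (fun t => UnitAddTorus.mFourier n (γ t)) = fun t : ℝ =>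
        (∏ i, Complex.exp (n i * c i * Complex.I)) *
          Complex.exp (((∑ i, n i • ν i : ℝ) : ℂ) * t * Complex.I) := by
      ext t
      simp only [γ, mFourier_torusCover]
      rw [← Complex.exp_sum, ← Complex.exp_sum, ← Complex.exp_add]
      congr 1
      push_cast
      rw [Finset.sum_mul, Finset.sum_mul, ← Finset.sum_add_distrib]
      refine Finset.sum_congr rfl fun i _ => ?_
      simp only [zsmul_eq_mul]
      ring
    rw [h2]
    split_ifs with hn
    · subst hn
      simpa using hasTimeAverage_const 1
    · refine hasTimeAverage_exp (fun h0 => hn ?_) _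
      exact funext (Fintype.linearIndependent_iff.1 hν n h0)
  -- The characters span a dense subspace, and the averaged functions form a closed one.
  have htop : (⊤ : Submodule ℂ C(UnitAddTorus ι, ℂ)) ≤ S := by
    rw [← UnitAddTorus.span_mFourier_closure_eq_top]
    refine Submodule.topologicalClosure_minimal _ (Submodule.span_le.2 ?_)
      (isClosed_averagedSubmodule γ hγ _ _ hq.continuous)
    rintro _ ⟨n, rfl⟩
    exact hmono n
  -- A periodic continuous function on `ℝ^ι` descends along the quotient map to the compact torus.
  let p : C(ι → ℝ, UnitAddTorus ι) := ⟨torusCover ι, hq.continuous⟩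
  have hp : IsQuotientMap p := hq.isQuotientMap
  have hfac : Function.FactorsThrough (⟨f, hf⟩ : C(ι → ℝ, ℂ)) p := fun x y hxy => by
    obtain ⟨k, rfl⟩ := exists_int_of_torusCover_eq hxy
    exact hper y k
  let G : C(UnitAddTorus ι, ℂ) := hp.lift ⟨f, hf⟩ hfac
  have hG : ∀ x, G (torusCover ι x) = f x := fun x =>
    DFunLike.congr_fun (hp.lift_comp ⟨f, hf⟩ hfac) x
  have h : HasTimeAverage (fun t => G (γ t))
      (∫ y, G (torusCover ι y) ∂Measure.pi fun _ : ι => unifAngle) := htop (Submodule.mem_top (x := G))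
  simpa only [hG, γ] using h

/-! ### Marginals of product measures -/

/-- The coordinates are independent and identically distributed, so any selection of distinct ones
is again a product. -/
theorem measurePreserving_comp_injective {ι κ : Type*} [Fintype ι] [Fintype κ] {α : Type*}
    [MeasurableSpace α] (μ : Measure α) [IsProbabilityMeasure μ] {g : κ → ι}
    (hg : Function.Injective g) :
    MeasurePreserving (fun x : ι → α => x ∘ g) (Measure.pi fun _ => μ) (Measure.pi fun _ => μ) := by
  have h1 : ProbabilityTheory.iIndepFun (fun (i : ι) (x : ι → α) => x i)
      (Measure.pi fun _ : ι => μ) :=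
    ProbabilityTheory.iIndepFun_pi (X := fun _ => id) fun _ => aemeasurable_id
  have h2 := (ProbabilityTheory.iIndepFun_iff_map_fun_eq_pi_map
    (fun k => (measurable_pi_apply (g k)).aemeasurable)).1 (h1.precomp hg)
  refine ⟨measurable_pi_lambda _ fun k => measurable_pi_apply (g k), ?_⟩
  rw [show (fun x : ι → α => x ∘ g) = fun x k => x (g k) from rfl, h2]
  congr 1
  funext k
  exact (measurePreserving_eval (fun _ : ι => μ) (g k)).map_eq

theorem measurePreserving_comp_prod {ι κ l : Type*} [Fintype ι] [Fintype κ] [Fintype l]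
    {α : Type*} [MeasurableSpace α] (μ : Measure α) [IsProbabilityMeasure μ] {g : κ → ι} {h : l → ι}
    (hgh : Function.Injective (Sum.elim g h)) :
    MeasurePreserving (fun x : ι → α => (x ∘ g, x ∘ h)) (Measure.pi fun _ => μ)
      ((Measure.pi fun _ => μ).prod (Measure.pi fun _ => μ)) := by
  have h1 := measurePreserving_comp_injective μ hgh
  exact (measurePreserving_sumPiEquivProdPi (fun _ : κ ⊕ l => μ)).comp h1

/-! ### The distribution of `sin² ξ` -/

theorem lintegral_unifAngle (f : ℝ → ENNReal) :
    ∫⁻ x, f x ∂unifAngle =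
      (ENNReal.ofReal (2 * Real.pi))⁻¹ * ∫⁻ x in Set.Ioo (0 : ℝ) (2 * Real.pi), f x := by
  rw [unifAngle_eq, lintegral_smul_measure, smul_eq_mul, restrict_Ico_eq_restrict_Ioc,
    ← restrict_Ioo_eq_restrict_Ioc]

theorem sin_xiOf {k : ℕ} (hk : 0 < k) (θ : ℝ) :
    Real.sin (xiOf k θ) = |1 - angleMod θ / Real.pi| ^ (1 / (2 * (k : ℝ))) := by
  have h0 : (0 : ℝ) ≤ |1 - angleMod θ / Real.pi| ^ (1 / (2 * (k : ℝ))) := by positivity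
  have h1 : |1 - angleMod θ / Real.pi| ^ (1 / (2 * (k : ℝ))) ≤ 1 := by
    refine Real.rpow_le_one (abs_nonneg _) ?_ (by positivity)
    rw [abs_one_sub_angleMod_div_pi]
    exact (div_le_one Real.pi_pos).2 (Real.arccos_le_pi _)
  rw [xiOf, Real.sin_arcsin (by linarith) h1]

theorem cos_xiOf (k : ℕ) (θ : ℝ) :
    Real.cos (xiOf k θ) = Real.sqrt (1 - Real.sin (xiOf k θ) ^ 2) := by
  refine Real.cos_eq_sqrt_one_sub_sin_sq ?_ ?_
  · exact Real.neg_pi_div_two_le_arcsin _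
  · exact Real.arcsin_le_pi_div_two _

theorem angleMod_of_mem {θ : ℝ} (h : θ ∈ Set.Ico 0 (2 * Real.pi)) : angleMod θ = θ := by
  rw [angleMod, toIcoMod_eq_self]
  simpa using h

theorem sin_xiOf_of_eq {k : ℕ} (hk : 0 < k) {θ y : ℝ} (hθ : θ ∈ Set.Ico 0 (2 * Real.pi)) (hy : 0 ≤ y)
    (h : |1 - θ / Real.pi| = y ^ k) : Real.sin (xiOf k θ) = Real.sqrt y := by
  rw [sin_xiOf hk, angleMod_of_mem hθ, h, Real.sqrt_eq_rpow, ← Real.rpow_natCast, ← Real.rpow_mul hy]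
  congr 1
  field_simp

/-- The substitution `θ = π (1 ± y^k)` is chosen so that `|1 - θ/π| = y^k`, whence `sin² ξ_k = y`.
The two signs cover the two half periods. -/
theorem lintegral_image_affine_pow (k : ℕ) (hk : 0 < k) (s : ℝ) (hs : s = 1 ∨ s = -1)
    (f : ℝ → ENNReal) :
    ∫⁻ θ in (fun y : ℝ => Real.pi * (1 + s * y ^ k)) '' Set.Ioo (0 : ℝ) 1, f θ =
      ENNReal.ofReal Real.pi * k * ∫⁻ y in Set.Ioo (0 : ℝ) 1,
        ENNReal.ofReal (y ^ (k - 1)) * f (Real.pi * (1 + s * y ^ k)) := by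
  have hπ := Real.pi_pos
  have hs0 : s ≠ 0 := by rcases hs with rfl | rfl <;> norm_num
  rw [lintegral_image_eq_lintegral_abs_deriv_mul measurableSet_Ioo
    (f' := fun y => Real.pi * (s * (k * y ^ (k - 1))))]
  · rw [← lintegral_const_mul' _ _ (by finiteness)]
    refine setLIntegral_congr_fun measurableSet_Ioo fun y hy => ?_
    have hsabs : |s| = 1 := by rcases hs with rfl | rfl <;> norm_num
    have hy0 : 0 ≤ y ^ (k - 1) := pow_nonneg hy.1.le _
    rw [abs_mul, abs_mul, hsabs, one_mul, abs_of_pos hπ, abs_of_nonneg (by positivity),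
      ENNReal.ofReal_mul hπ.le, ENNReal.ofReal_mul (by positivity), ENNReal.ofReal_natCast]
    ring
  · intro y _
    exact ((((hasDerivAt_pow k y).const_mul s).const_add 1).const_mul Real.pi).hasDerivWithinAt
  · intro x hx y hy hxy
    have h1 : x ^ k = y ^ k := by
      have := mul_left_cancel₀ hπ.ne' hxy
      exact mul_left_cancel₀ hs0 (by linarith)
    exact (pow_left_inj₀ hx.1.le hy.1.le hk.ne').1 h1

theorem image_pow_Ioo (k : ℕ) (hk : 0 < k) :
    (fun y : ℝ => y ^ k) '' Set.Ioo (0 : ℝ) 1 = Set.Ioo 0 1 := by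
  ext x
  constructor
  · rintro ⟨y, ⟨h0, h1⟩, rfl⟩
    exact ⟨pow_pos h0 k, pow_lt_one₀ h0.le h1 hk.ne'⟩
  · rintro ⟨h0, h1⟩
    refine ⟨x ^ ((k : ℝ)⁻¹), ⟨by positivity, Real.rpow_lt_one h0.le h1 (by positivity)⟩, ?_⟩
    exact Real.rpow_inv_natCast_pow h0.le hk.ne'

theorem image_affine_pow_neg (k : ℕ) (hk : 0 < k) :
    (fun y : ℝ => Real.pi * (1 + (-1) * y ^ k)) '' Set.Ioo (0 : ℝ) 1 = Set.Ioo 0 Real.pi := by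
  have hπ := Real.pi_pos
  have : (fun y : ℝ => Real.pi * (1 + (-1) * y ^ k)) = (fun x => Real.pi * (1 + (-1) * x)) ∘
      fun y => y ^ k := rfl
  rw [this, Set.image_comp, image_pow_Ioo k hk]
  ext x
  constructor
  · rintro ⟨y, ⟨h0, h1⟩, rfl⟩
    constructor
    · have : 0 < 1 + -1 * y := by linarith
      positivity
    · nlinarith
  · rintro ⟨h0, h1⟩
    refine ⟨1 - x / Real.pi, ⟨?_, ?_⟩, ?_⟩
    · rw [sub_pos, div_lt_one hπ]; exact h1
    · have := div_pos h0 hπ; linarith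
    · field_simp; ring

theorem image_affine_pow_pos (k : ℕ) (hk : 0 < k) :
    (fun y : ℝ => Real.pi * (1 + 1 * y ^ k)) '' Set.Ioo (0 : ℝ) 1 =
      Set.Ioo Real.pi (2 * Real.pi) := by
  have hπ := Real.pi_pos
  have : (fun y : ℝ => Real.pi * (1 + 1 * y ^ k)) = (fun x => Real.pi * (1 + 1 * x)) ∘
      fun y => y ^ k := rfl
  rw [this, Set.image_comp, image_pow_Ioo k hk]
  ext x
  constructor
  · rintro ⟨y, ⟨h0, h1⟩, rfl⟩
    constructor <;> nlinarith
  · rintro ⟨h0, h1⟩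
    refine ⟨x / Real.pi - 1, ⟨?_, ?_⟩, ?_⟩
    · rw [sub_pos, one_lt_div hπ]; exact h0
    · rw [sub_lt_iff_lt_add, div_lt_iff₀ hπ]; linarith
    · field_simp; ring

/-- If `θ` is uniform, then `sin² ξ_k(θ)` has the density `k y^{k-1}` on `(0, 1)`. -/
theorem lintegral_xiOf (k : ℕ) (hk : 0 < k) (f : ℝ → ℝ → ENNReal) :
    ∫⁻ θ, f (Real.sin (xiOf k θ)) (Real.cos (xiOf k θ)) ∂unifAngle =
      k * ∫⁻ y in Set.Ioo (0 : ℝ) 1,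
        ENNReal.ofReal (y ^ (k - 1)) * f (Real.sqrt y) (Real.sqrt (1 - y)) := by
  have hπ := Real.pi_pos
  have key : ∀ s : ℝ, s = 1 ∨ s = -1 →
      ∫⁻ θ in (fun y : ℝ => Real.pi * (1 + s * y ^ k)) '' Set.Ioo (0 : ℝ) 1,
        f (Real.sin (xiOf k θ)) (Real.cos (xiOf k θ)) =
      ENNReal.ofReal Real.pi * k * ∫⁻ y in Set.Ioo (0 : ℝ) 1,
        ENNReal.ofReal (y ^ (k - 1)) * f (Real.sqrt y) (Real.sqrt (1 - y)) := by
    intro s hs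
    rw [lintegral_image_affine_pow k hk s hs
      (fun θ => f (Real.sin (xiOf k θ)) (Real.cos (xiOf k θ)))]
    congr 1
    refine setLIntegral_congr_fun measurableSet_Ioo fun y hy => ?_
    have h1 : y ^ k < 1 := pow_lt_one₀ hy.1.le hy.2 hk.ne'
    have h0 : 0 < y ^ k := pow_pos hy.1 k
    have h2 : Real.sin (xiOf k (Real.pi * (1 + s * y ^ k))) = Real.sqrt y := by
      refine sin_xiOf_of_eq hk ?_ hy.1.le ?_
      · rcases hs with rfl | rfl <;> constructor <;> nlinarith
      · rw [mul_div_cancel_left₀ _ hπ.ne']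
        rcases hs with rfl | rfl
        · rw [show (1 : ℝ) - (1 + 1 * y ^ k) = -(y ^ k) by ring, abs_neg, abs_of_pos h0]
        · rw [show (1 : ℝ) - (1 + -1 * y ^ k) = y ^ k by ring, abs_of_pos h0]
    simp only [cos_xiOf, h2, Real.sq_sqrt hy.1.le]
  have hsplit : ∫⁻ θ in Set.Ioo (0 : ℝ) (2 * Real.pi),
      f (Real.sin (xiOf k θ)) (Real.cos (xiOf k θ)) =
      (∫⁻ θ in Set.Ioo (0 : ℝ) Real.pi, f (Real.sin (xiOf k θ)) (Real.cos (xiOf k θ))) +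
      ∫⁻ θ in Set.Ioo Real.pi (2 * Real.pi), f (Real.sin (xiOf k θ)) (Real.cos (xiOf k θ)) := by
    have hU : Set.Ioo (0 : ℝ) (2 * Real.pi) =
        Set.Ioo 0 Real.pi ∪ Set.Ico Real.pi (2 * Real.pi) :=
      (Set.Ioo_union_Ico_eq_Ioo hπ (by linarith)).symm
    rw [hU, lintegral_union measurableSet_Ico, restrict_Ico_eq_restrict_Ioc,
      ← restrict_Ioo_eq_restrict_Ioc]
    exact Set.disjoint_left.2 fun x hx hx' => absurd hx.2 (not_lt.2 hx'.1)
  -- Each half period contributes `π k` times the same integral, so division by `2π` leaves the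
  -- factor `k`.
  rw [lintegral_unifAngle, hsplit, ← image_affine_pow_neg k hk, ← image_affine_pow_pos k hk,
    key _ (Or.inr rfl), key _ (Or.inl rfl), ← two_mul, ← mul_assoc, ← mul_assoc, ← mul_assoc]
  congr 1
  rw [mul_assoc (ENNReal.ofReal (2 * Real.pi))⁻¹, ENNReal.ofReal_mul (by norm_num : (0:ℝ) ≤ 2)]
  simp only [ENNReal.ofReal_ofNat]
  refine (congrArg (· * (k : ENNReal)) (ENNReal.inv_mul_cancel (a := 2 * ENNReal.ofReal Real.pi) ?_ ?_)).trans
    (one_mul _)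
  · simp [hπ]
  · finiteness

/-! ### Polar coordinates -/

/-- The radial variable is the squared modulus `x = r²`: then `r dr = dx / 2`, and the `2π` of the
normalized angle leaves the constant `π`. -/
theorem lintegral_complex_polar {G : ℂ → ENNReal} (hG : Measurable G) :
    ∫⁻ w, G w = ENNReal.ofReal Real.pi * ∫⁻ x in Set.Ioi (0 : ℝ), ∫⁻ α, 
      G (Real.sqrt x * Complex.exp (-(Complex.I * (α : ℝ)))) ∂unifAngle := by
  have hπ := Real.pi_pos
  -- The map `w ↦ -w̄` turns `e^{iφ}` with `φ ∈ (-π, π)` into `e^{-i(φ + π)}` with `φ + π ∈ (0,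
  -- 2π)`, the convention of the phases in the last row.
  have hmp : MeasurePreserving (fun w : ℂ => -(starRingEnd ℂ w)) :=
    (Measure.measurePreserving_neg (volume : Measure ℂ)).comp
      Complex.conjLIE.measurePreserving
  have hm1 : Measurable fun p : ℝ × ℝ =>
      G (p.1 * Complex.exp (-(Complex.I * (p.2 : ℝ)))) := by
    refine hG.comp (Continuous.measurable ?_)
    fun_prop
  have h1 : ∫⁻ w, G w = ∫⁻ r in Set.Ioi (0 : ℝ), ∫⁻ φ in Set.Ioo (0 : ℝ) (2 * Real.pi),
      ENNReal.ofReal r * G (r * Complex.exp (-(Complex.I * (φ : ℝ)))) := by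
    rw [← hmp.lintegral_comp hG, ← Complex.lintegral_comp_polarCoord_symm]
    rw [show polarCoord.target = Set.Ioi (0 : ℝ) ×ˢ Set.Ioo (-Real.pi) Real.pi from rfl,
      Measure.volume_eq_prod, ← Measure.prod_restrict, lintegral_prod]
    · refine lintegral_congr fun r => ?_
      have hsh := (measurePreserving_add_right (volume : Measure ℝ) Real.pi).setLIntegral_comp_emb
        (measurableEmbedding_addRight Real.pi)
        (fun φ => ENNReal.ofReal r * G (r * Complex.exp (-(Complex.I * (φ : ℝ)))))
        (Set.Ioo (-Real.pi) Real.pi)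
      rw [Set.image_add_const_Ioo, show -Real.pi + Real.pi = 0 by ring,
        show Real.pi + Real.pi = 2 * Real.pi by ring] at hsh
      rw [← hsh]
      refine lintegral_congr fun φ => ?_
      rw [smul_eq_mul, Complex.polarCoord_symm_apply]
      congr 2
      have e1 : Complex.exp (-(Complex.I * ((φ + Real.pi : ℝ) : ℂ))) =
          -Complex.exp (-(Complex.I * φ)) := by
        rw [show -(Complex.I * ((φ + Real.pi : ℝ) : ℂ)) =
          -(Complex.I * φ) - Real.pi * Complex.I by push_cast; ring, Complex.exp_sub,
          Complex.exp_pi_mul_I]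
        rw [div_neg, div_one]
      rw [e1, show -(Complex.I * (φ : ℂ)) = ((-φ : ℝ) : ℂ) * Complex.I by push_cast; ring,
        Complex.exp_mul_I, ← Complex.ofReal_cos, ← Complex.ofReal_sin, Real.cos_neg, Real.sin_neg]
      simp only [map_mul, map_add, Complex.conj_ofReal, Complex.conj_I]
      push_cast
      ring
    · refine Measurable.aemeasurable ?_
      rw [show (fun p : ℝ × ℝ => ENNReal.ofReal p.1 • G (-(starRingEnd ℂ) (Complex.polarCoord.symm p))) =
        fun p => ENNReal.ofReal p.1 * G (-(starRingEnd ℂ)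
          (p.1 * (Real.cos p.2 + Real.sin p.2 * Complex.I))) from
        funext fun p => by rw [smul_eq_mul, Complex.polarCoord_symm_apply]]
      refine Measurable.mul (by fun_prop) (hG.comp ?_)
      refine Continuous.measurable ?_
      fun_prop
  have himg : (fun r : ℝ => r ^ 2) '' Set.Ioi 0 = Set.Ioi 0 := by
    ext x
    constructor
    · rintro ⟨r, hr, rfl⟩
      exact pow_pos (show (0 : ℝ) < r from hr) 2
    · intro hx
      exact ⟨Real.sqrt x, Real.sqrt_pos.2 hx, Real.sq_sqrt (le_of_lt hx)⟩
  have h2 : ∀ f : ℝ → ENNReal, ∫⁻ x in Set.Ioi (0 : ℝ), f (Real.sqrt x) =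
      2 * ∫⁻ r in Set.Ioi (0 : ℝ), ENNReal.ofReal r * f r := by
    intro f
    conv_lhs => rw [← himg]
    rw [lintegral_image_eq_lintegral_abs_deriv_mul measurableSet_Ioi (f' := fun r => 2 * r),
      ← lintegral_const_mul' _ _ (by finiteness)]
    · refine setLIntegral_congr_fun measurableSet_Ioi fun r hr => ?_
      have hr' : (0 : ℝ) < r := hr
      rw [abs_of_pos (by positivity), Real.sqrt_sq hr'.le,
        ENNReal.ofReal_mul (by norm_num : (0:ℝ) ≤ 2), ENNReal.ofReal_ofNat, mul_assoc]
    · intro r _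
      simpa using (hasDerivAt_pow 2 r).hasDerivWithinAt
    · intro x hx y hy hxy
      exact (pow_left_inj₀ (le_of_lt hx) (le_of_lt hy) two_ne_zero).1 hxy
  rw [h1, h2 fun r => ∫⁻ α, G (r * Complex.exp (-(Complex.I * (α : ℝ)))) ∂unifAngle,
    ← mul_assoc, ← lintegral_const_mul' _ _ (by finiteness)]
  refine lintegral_congr fun r => ?_
  rw [lintegral_const_mul' _ _ (by finiteness), lintegral_unifAngle, mul_left_comm]
  congr 1
  rw [← mul_assoc, mul_comm (ENNReal.ofReal Real.pi), ENNReal.ofReal_mul (by norm_num : (0:ℝ) ≤ 2),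
    ENNReal.ofReal_ofNat, ENNReal.mul_inv_cancel, one_mul]
  · simp [hπ]
  · finiteness

/-- These are the coordinates `x = a + b`, `y = a / x` with Jacobian `x`. A translation in `b`,
Tonelli's theorem and a scaling in `a` replace a planar change of variables. -/
theorem lintegral_Ioi_Ioi_eq {g : ℝ × ℝ → ENNReal} (hg : Measurable g) :
    ∫⁻ a in Set.Ioi (0 : ℝ), ∫⁻ b in Set.Ioi (0 : ℝ), g (a, b) =
      ∫⁻ x in Set.Ioi (0 : ℝ), ENNReal.ofReal x *
        ∫⁻ y in Set.Ioo (0 : ℝ) 1, g (x * y, x * (1 - y)) := by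
  have hscale : ∀ x : ℝ, 0 < x → ∀ h : ℝ → ENNReal,
      ∫⁻ a in Set.Ioo 0 x, h a = ENNReal.ofReal x * ∫⁻ y in Set.Ioo (0 : ℝ) 1, h (x * y) := by
    intro x hx h
    have himg : (fun y : ℝ => x * y) '' Set.Ioo 0 1 = Set.Ioo 0 x := by
      rw [Set.image_mul_left_Ioo hx]; simp
    rw [← himg, lintegral_image_eq_lintegral_abs_deriv_mul measurableSet_Ioo (f' := fun _ => x),
      abs_of_pos hx, lintegral_const_mul' _ _ (by finiteness)]
    · intro y _
      simpa using ((hasDerivAt_id y).const_mul x).hasDerivWithinAt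
    · intro a _ b _ hab
      exact mul_left_cancel₀ hx.ne' hab
  calc ∫⁻ a in Set.Ioi (0 : ℝ), ∫⁻ b in Set.Ioi (0 : ℝ), g (a, b)
      = ∫⁻ a, ∫⁻ x, {p : ℝ × ℝ | 0 < p.1 ∧ p.1 < p.2}.indicator
          (fun p => g (p.1, p.2 - p.1)) (a, x) := by
        rw [← lintegral_indicator measurableSet_Ioi]
        refine lintegral_congr fun a => ?_
        by_cases ha : 0 < a
        · rw [Set.indicator_of_mem (Set.mem_Ioi.2 ha), ← lintegral_indicator measurableSet_Ioi,
            ← lintegral_sub_right_eq_self _ a]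
          refine lintegral_congr fun x => ?_
          by_cases hx : a < x
          · rw [Set.indicator_of_mem (by simpa using hx), Set.indicator_of_mem (by exact ⟨ha, hx⟩)]
          · rw [Set.indicator_of_notMem (by simpa using hx),
              Set.indicator_of_notMem (fun h => hx h.2)]
        · rw [Set.indicator_of_notMem (by simpa using ha)]
          symm
          rw [lintegral_eq_zero_iff']
          · refine ae_of_all _ fun x => ?_
            exact Set.indicator_of_notMem (fun h => ha h.1) _
          · have : (fun x => {p : ℝ × ℝ | 0 < p.1 ∧ p.1 < p.2}.indicator
                (fun p => g (p.1, p.2 - p.1)) (a, x)) = fun _ => 0 :=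
              funext fun x => Set.indicator_of_notMem (fun h => ha h.1) _
            rw [this]
            exact aemeasurable_const
    _ = ∫⁻ x, ∫⁻ a, {p : ℝ × ℝ | 0 < p.1 ∧ p.1 < p.2}.indicator
          (fun p => g (p.1, p.2 - p.1)) (a, x) := by
        refine lintegral_lintegral_swap (Measurable.aemeasurable ?_)
        refine Measurable.indicator (hg.comp (by fun_prop)) ?_
        exact ((isOpen_lt continuous_const continuous_fst).inter
          (isOpen_lt continuous_fst continuous_snd)).measurableSet
    _ = _ := by
        rw [← lintegral_indicator measurableSet_Ioi]
        refine lintegral_congr fun x => ?_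
        by_cases hx : 0 < x
        · rw [Set.indicator_of_mem (Set.mem_Ioi.2 hx)]
          have := hscale x hx fun a => g (a, x - a)
          simp only [show ∀ y : ℝ, x - x * y = x * (1 - y) from fun y => by ring] at this
          rw [← this, ← lintegral_indicator measurableSet_Ioo]
          refine lintegral_congr fun a => ?_
          by_cases ha : 0 < a ∧ a < x
          · rw [Set.indicator_of_mem (by exact ha), Set.indicator_of_mem (by exact ha)]
          · rw [Set.indicator_of_notMem (by exact ha), Set.indicator_of_notMem (by exact ha)]
        · rw [Set.indicator_of_notMem (by simpa using hx)]
          have : (fun a => {p : ℝ × ℝ | 0 < p.1 ∧ p.1 < p.2}.indicator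
                (fun p => g (p.1, p.2 - p.1)) (a, x)) = fun _ => 0 :=
              funext fun a => Set.indicator_of_notMem (fun h => hx (h.1.trans h.2)) _
          rw [this, lintegral_zero]

/-! ### The law of the last row -/

theorem continuous_snoc {X : Type*} [TopologicalSpace X] {k : ℕ} {f : X → Fin k → ℂ} {g : X → ℂ}
    (hf : Continuous f) (hg : Continuous g) :
    Continuous fun x => (Fin.snoc (α := fun _ => ℂ) (f x) (g x) : Fin (k + 1) → ℂ) := by
  refine continuous_pi fun i => ?_
  refine Fin.lastCases ?_ (fun i => ?_) i
  · simpa only [Fin.snoc_last] using hg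
  · simp only [Fin.snoc_castSucc]
    exact (continuous_apply i).comp hf

theorem continuous_lastRow (k : ℕ) : Continuous (lastRow k) := by
  induction k with
  | zero =>
    have : lastRow 0 = fun x _ => Complex.exp (-(Complex.I * x (Sum.inr 0))) := rfl
    rw [this]
    fun_prop
  | succ k ih =>
    have : lastRow (k + 1) = fun x => Fin.snoc (α := fun _ => ℂ)
      (fun i => Real.sin (xiOf (k + 1) (x (Sum.inl (Fin.last k)))) *
        lastRow k (x ∘ Sum.map Fin.castSucc Fin.castSucc) i)
      (Real.cos (xiOf (k + 1) (x (Sum.inl (Fin.last k)))) *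
        Complex.exp (-(Complex.I * x (Sum.inr (Fin.last (k + 1)))))) := rfl
    rw [this]
    have hx := continuous_xiOf (k + 1)
    have h1 : Continuous fun x : Fin (k + 1) ⊕ Fin (k + 2) → ℝ =>
        lastRow k (x ∘ Sum.map Fin.castSucc Fin.castSucc) := ih.comp (by fun_prop)
    have h1' := fun i => (continuous_apply i).comp h1
    refine continuous_snoc (continuous_pi fun i => ?_) ?_
    · exact (Complex.continuous_ofReal.comp (Real.continuous_sin.comp
        (hx.comp (continuous_apply _)))).mul (h1' i)
    · exact (Complex.continuous_ofReal.comp (Real.continuous_cos.comp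
        (hx.comp (continuous_apply _)))).mul (by fun_prop)

theorem sum_norm_sq_lastRow (k : ℕ) (x : Fin k ⊕ Fin (k + 1) → ℝ) :
    ∑ i, ‖lastRow k x i‖ ^ 2 = 1 := by
  have hexp : ∀ α : ℝ, ‖Complex.exp (-(Complex.I * α))‖ = 1 := fun α => by
    rw [show -(Complex.I * (α : ℂ)) = ((-α : ℝ) : ℂ) * Complex.I by push_cast; ring,
      Complex.norm_exp_ofReal_mul_I]
  induction k with
  | zero => simp [lastRow, hexp]
  | succ k ih =>
    rw [Fin.sum_univ_castSucc]
    simp only [lastRow, Fin.snoc_castSucc, Fin.snoc_last, norm_mul, mul_pow, hexp,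
      Complex.norm_real, Real.norm_eq_abs, sq_abs]
    rw [← Finset.mul_sum, ih]
    simp

/-- The law of the last row for uniform angles. -/
def rowMeasure (k : ℕ) : Measure (Fin (k + 1) → ℂ) :=
  (Measure.pi fun _ => unifAngle).map (lastRow k)

instance (k : ℕ) : IsProbabilityMeasure (rowMeasure k) :=
  Measure.isProbabilityMeasure_map (continuous_lastRow k).measurable.aemeasurable

theorem ae_sum_norm_sq_rowMeasure (k : ℕ) : ∀ᵐ u ∂rowMeasure k, ∑ i, ‖u i‖ ^ 2 = 1 := by
  rw [rowMeasure, ae_map_iff (continuous_lastRow k).measurable.aemeasurable]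
  · exact ae_of_all _ fun x => sum_norm_sq_lastRow k x
  · exact (isClosed_eq (by fun_prop) continuous_const).measurableSet

theorem lintegral_rowMeasure_zero {F : (Fin 1 → ℂ) → ENNReal} (hF : Measurable F) :
    ∫⁻ u, F u ∂rowMeasure 0 =
      ∫⁻ α, F (fun _ => Complex.exp (-(Complex.I * (α : ℝ)))) ∂unifAngle := by
  rw [rowMeasure, lintegral_map hF (continuous_lastRow 0).measurable]
  have := (measurePreserving_eval (fun _ : Fin 0 ⊕ Fin 1 => unifAngle) (Sum.inr 0)).lintegral_comp
    (f := fun α => F (fun _ => Complex.exp (-(Complex.I * (α : ℝ)))))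
    (hF.comp (Continuous.measurable (by fun_prop)))
  exact this

/-- The recursion for `lastRow` introduces one new angle and one new phase, which are independent of
the earlier coordinates. -/
theorem lintegral_rowMeasure_succ (k : ℕ) {F : (Fin (k + 2) → ℂ) → ENNReal} (hF : Measurable F) :
    ∫⁻ u, F u ∂rowMeasure (k + 1) =
      ∫⁻ u, ∫⁻ θ, ∫⁻ α, F (Fin.snoc (α := fun _ => ℂ)
        (fun i => Real.sin (xiOf (k + 1) θ) * u i)
        (Real.cos (xiOf (k + 1) θ) * Complex.exp (-(Complex.I * (α : ℝ)))))
        ∂unifAngle ∂unifAngle ∂rowMeasure k := by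
  let Φ : (Fin (k + 1) → ℂ) × ℝ × ℝ → (Fin (k + 2) → ℂ) := fun p =>
    Fin.snoc (α := fun _ => ℂ) (fun i => Real.sin (xiOf (k + 1) p.2.1) * p.1 i)
        (Real.cos (xiOf (k + 1) p.2.1) * Complex.exp (-(Complex.I * (p.2.2 : ℝ))))
  have hΦ : Continuous Φ := by
    have hx := continuous_xiOf (k + 1)
    refine continuous_snoc (continuous_pi fun i => ?_) ?_
    · exact (Complex.continuous_ofReal.comp (Real.continuous_sin.comp
        (hx.comp (by fun_prop)))).mul (by fun_prop)
    · exact (Complex.continuous_ofReal.comp (Real.continuous_cos.comp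
        (hx.comp (by fun_prop)))).mul (by fun_prop)
  have hFΦ : Measurable fun p => F (Φ p) := hF.comp hΦ.measurable
  let h : Fin 2 → Fin (k + 1) ⊕ Fin (k + 2) :=
    ![Sum.inl (Fin.last k), Sum.inr (Fin.last (k + 1))]
  have hinj : Function.Injective
      (Sum.elim (Sum.map Fin.castSucc Fin.castSucc : Fin k ⊕ Fin (k + 1) → _) h) := by
    refine Function.Injective.sumElim ?_ ?_ ?_
    · exact Function.Injective.sumMap (Fin.castSucc_injective _) (Fin.castSucc_injective _)
    · intro a b hab
      fin_cases a <;> fin_cases b <;> simp_all [h]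
    · rintro (a | a) b <;> fin_cases b <;> simp [h, Fin.castSucc_ne_last]
  have h1 := measurePreserving_comp_prod unifAngle hinj
  have h2 : MeasurePreserving (MeasurableEquiv.finTwoArrow : (Fin 2 → ℝ) ≃ᵐ ℝ × ℝ)
      (Measure.pi fun _ => unifAngle) (unifAngle.prod unifAngle) :=
    measurePreserving_finTwoArrow unifAngle
  have h3 : MeasurePreserving (lastRow k) (Measure.pi fun _ => unifAngle) (rowMeasure k) :=
    ⟨(continuous_lastRow k).measurable, rfl⟩
  have h4 := (h3.prod h2).comp h1
  have h5 : lastRow (k + 1) = Φ ∘ (Prod.map (lastRow k) MeasurableEquiv.finTwoArrow ∘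
      fun x : Fin (k + 1) ⊕ Fin (k + 2) → ℝ => (x ∘ Sum.map Fin.castSucc Fin.castSucc, x ∘ h)) := by
    funext x
    simp [lastRow, Φ, h]
  have h6 : ∫⁻ u, F u ∂rowMeasure (k + 1) =
      ∫⁻ p, F (Φ p) ∂(rowMeasure k).prod (unifAngle.prod unifAngle) := by
    rw [← h4.lintegral_comp hFΦ, rowMeasure,
      lintegral_map hF (continuous_lastRow _).measurable, h5]
    rfl
  rw [h6, lintegral_prod _ hFΦ.aemeasurable]
  refine lintegral_congr fun u => ?_
  rw [lintegral_prod]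
  exact (hFΦ.comp measurable_prodMk_left).aemeasurable

theorem lintegral_snoc {k : ℕ} {F : (Fin (k + 1) → ℂ) → ENNReal} (hF : Measurable F) :
    ∫⁻ z, F z = ∫⁻ z : Fin k → ℂ, ∫⁻ w : ℂ, F (Fin.snoc (α := fun _ => ℂ) z w) := by
  have h := (volume_preserving_piFinSuccAbove (fun _ : Fin (k + 1) => ℂ) (Fin.last k)).symm
  have hm : Measurable fun p =>
      F ((MeasurableEquiv.piFinSuccAbove (fun _ : Fin (k + 1) => ℂ) (Fin.last k)).symm p) :=
    hF.comp h.measurable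
  rw [← h.lintegral_comp hF, Measure.volume_eq_prod, lintegral_prod_symm _ hm.aemeasurable]
  refine lintegral_congr fun z => lintegral_congr fun w => ?_
  congr 1
  exact Fin.insertNth_last' w z

/-- Lebesgue measure on `ℂ^{k+1}` in spherical coordinates: the direction is distributed as the
last row for uniform angles. -/
theorem exists_lintegral_spherical (k : ℕ) : ∃ c : ENNReal, c ≠ 0 ∧ c ≠ ⊤ ∧
    ∀ F : (Fin (k + 1) → ℂ) → ENNReal, Measurable F →
      ∫⁻ z, F z = c * ∫⁻ x in Set.Ioi (0 : ℝ), ENNReal.ofReal (x ^ k) *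
        ∫⁻ u, F (fun i => Real.sqrt x * u i) ∂rowMeasure k := by
  induction k with
  | zero =>
    refine ⟨ENNReal.ofReal Real.pi, by simp [Real.pi_pos], by finiteness, fun F hF => ?_⟩
    have h1 := (volume_preserving_funUnique (Fin 1) ℂ).symm.lintegral_comp hF
    refine h1.symm.trans ?_
    rw [lintegral_complex_polar (G := fun w => F ((MeasurableEquiv.funUnique (Fin 1) ℂ).symm w))
      (hF.comp (MeasurableEquiv.measurable _))]
    congr 1
    refine lintegral_congr fun x => ?_
    have hFx : Measurable fun u : Fin 1 → ℂ => F fun i => Real.sqrt x * u i :=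
      hF.comp (by fun_prop)
    rw [pow_zero, ENNReal.ofReal_one, one_mul]
    refine Eq.trans ?_ (lintegral_rowMeasure_zero hFx).symm
    rfl
  | succ k ih =>
    obtain ⟨c, hc0, hct, hc⟩ := ih
    have hk0 : ((k + 1 : ℕ) : ENNReal) ≠ 0 := by simp
    have hkt : ((k + 1 : ℕ) : ENNReal) ≠ ⊤ := ENNReal.natCast_ne_top _
    -- The factor `π` comes from polar coordinates in the new variable, and `1 / (k + 1)` cancels
    -- the normalization of the density `(k + 1) y^k` of `sin² ξ_{k+1}`.
    refine ⟨c * ENNReal.ofReal Real.pi * ((k + 1 : ℕ) : ENNReal)⁻¹, ?_, ?_, fun F hF => ?_⟩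
    · refine mul_ne_zero (mul_ne_zero hc0 (by simp [Real.pi_pos])) ?_
      exact ENNReal.inv_ne_zero.2 hkt
    · have := ENNReal.inv_ne_top.2 hk0
      finiteness
    let sn : (Fin (k + 1) → ℂ) → ℝ → ℝ → ℝ → (Fin (k + 2) → ℂ) := fun u a b α =>
      Fin.snoc (α := fun _ => ℂ) (fun i => Real.sqrt a * u i)
        (Real.sqrt b * Complex.exp (-(Complex.I * (α : ℝ))))
    have hsn : Continuous fun p : (((Fin (k + 1) → ℂ) × ℝ) × ℝ) × ℝ =>
        sn p.1.1.1 p.1.1.2 p.1.2 p.2 := by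
      refine continuous_snoc ?_ ?_ <;> fun_prop
    have hFsn : Measurable fun p : (((Fin (k + 1) → ℂ) × ℝ) × ℝ) × ℝ =>
        F (sn p.1.1.1 p.1.1.2 p.1.2 p.2) := hF.comp hsn.measurable
    have hI1 : Measurable fun p : ((Fin (k + 1) → ℂ) × ℝ) × ℝ =>
        ∫⁻ α, F (sn p.1.1 p.1.2 p.2 α) ∂unifAngle := hFsn.lintegral_prod_right'
    let Ψ : ℝ × ℝ → ENNReal := fun p => ∫⁻ u, ∫⁻ α, F (sn u p.1 p.2 α) ∂unifAngle ∂rowMeasure k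
    have hΨ : Measurable Ψ := by
      have : Measurable fun p : (ℝ × ℝ) × (Fin (k + 1) → ℂ) =>
          ∫⁻ α, F (sn p.2 p.1.1 p.1.2 α) ∂unifAngle := by
        have hr : Measurable fun p : (ℝ × ℝ) × (Fin (k + 1) → ℂ) => ((p.2, p.1.1), p.1.2) := by
          fun_prop
        exact hI1.comp hr
      exact this.lintegral_prod_right'
    -- Here `a` is the squared norm of the first `k + 1` coordinates and `b` the squared modulus of
    -- the last one.
    have step1 : ∫⁻ z, F z = c * ENNReal.ofReal Real.pi * ∫⁻ a in Set.Ioi (0 : ℝ),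
        ∫⁻ b in Set.Ioi (0 : ℝ), ENNReal.ofReal (a ^ k) * Ψ (a, b) := by
      rw [lintegral_snoc hF]
      have e1 : ∀ z : Fin (k + 1) → ℂ, ∫⁻ w : ℂ, F (Fin.snoc (α := fun _ => ℂ) z w) =
          ENNReal.ofReal Real.pi * ∫⁻ b in Set.Ioi (0 : ℝ), ∫⁻ α, F (Fin.snoc (α := fun _ => ℂ) z
            (Real.sqrt b * Complex.exp (-(Complex.I * (α : ℝ))))) ∂unifAngle := fun z =>
        lintegral_complex_polar (G := fun w => F (Fin.snoc (α := fun _ => ℂ) z w))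
          (hF.comp (continuous_snoc continuous_const continuous_id).measurable)
      simp only [e1]
      have hm : Measurable fun z : Fin (k + 1) → ℂ => ∫⁻ b in Set.Ioi (0 : ℝ), ∫⁻ α,
          F (Fin.snoc (α := fun _ => ℂ) z (Real.sqrt b * Complex.exp (-(Complex.I * (α : ℝ)))))
            ∂unifAngle := by
        refine Measurable.lintegral_prod_right' (f := fun p : (Fin (k + 1) → ℂ) × ℝ =>
          ∫⁻ α, F (Fin.snoc (α := fun _ => ℂ) p.1
            (Real.sqrt p.2 * Complex.exp (-(Complex.I * (α : ℝ))))) ∂unifAngle) ?_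
        refine Measurable.lintegral_prod_right' (f := fun p : ((Fin (k + 1) → ℂ) × ℝ) × ℝ =>
          F (Fin.snoc (α := fun _ => ℂ) p.1.1
            (Real.sqrt p.1.2 * Complex.exp (-(Complex.I * (p.2 : ℝ)))))) ?_
        exact hF.comp (continuous_snoc (by fun_prop) (by fun_prop)).measurable
      rw [lintegral_const_mul' _ _ (by finiteness), hc _ hm, mul_left_comm, ← mul_assoc]
      congr 1
      refine lintegral_congr fun a => ?_
      rw [lintegral_const_mul' _ _ (by finiteness)]
      congr 1
      refine lintegral_lintegral_swap (Measurable.aemeasurable ?_)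
      have hr : Measurable fun p : (Fin (k + 1) → ℂ) × ℝ => ((p.1, a), p.2) := by fun_prop
      exact hI1.comp hr
    -- With `a = x y` and `b = x (1 - y)`, the weight `a^k` and the Jacobian give `x^(k+1) y^k`: the
    -- radial weight one dimension higher, times the unnormalized law of `sin² ξ_{k+1}`.
    rw [step1, lintegral_Ioi_Ioi_eq (g := fun p => ENNReal.ofReal (p.1 ^ k) * Ψ p)
      ((by fun_prop : Measurable fun p : ℝ × ℝ => ENNReal.ofReal (p.1 ^ k)).mul hΨ),
      mul_assoc (c * ENNReal.ofReal Real.pi)]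
    congr 1
    rw [← lintegral_const_mul' _ _ (ENNReal.inv_ne_top.2 hk0)]
    refine setLIntegral_congr_fun measurableSet_Ioi fun x hx => ?_
    have hx0 : (0 : ℝ) < x := hx
    have hFx : Measurable fun v : Fin (k + 2) → ℂ => F fun i => Real.sqrt x * v i :=
      hF.comp (by fun_prop)
    dsimp only
    rw [lintegral_rowMeasure_succ k hFx]
    have e2 : ∀ u : Fin (k + 1) → ℂ, ∫⁻ θ, ∫⁻ α, F (fun i => Real.sqrt x *
          (Fin.snoc (α := fun _ => ℂ) (fun i => (Real.sin (xiOf (k + 1) θ) : ℂ) * u i)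
          (Real.cos (xiOf (k + 1) θ) * Complex.exp (-(Complex.I * (α : ℝ)))) :
            Fin (k + 2) → ℂ) i) ∂unifAngle ∂unifAngle =
        (k + 1 : ℕ) * ∫⁻ y in Set.Ioo (0 : ℝ) 1, ENNReal.ofReal (y ^ k) *
          ∫⁻ α, F (sn u (x * y) (x * (1 - y)) α) ∂unifAngle := by
      intro u
      rw [lintegral_xiOf (k + 1) (by omega) fun s t => ∫⁻ α, F (fun i => Real.sqrt x *
          (Fin.snoc (α := fun _ => ℂ) (fun i => (s : ℂ) * u i)
          (t * Complex.exp (-(Complex.I * (α : ℝ)))) : Fin (k + 2) → ℂ) i) ∂unifAngle]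
      congr 1
      refine lintegral_congr fun y => ?_
      rw [Nat.add_sub_cancel]
      congr 1
      refine lintegral_congr fun α => ?_
      congr 1
      funext i
      refine Fin.lastCases ?_ (fun i => ?_) i
      · simp only [sn, Fin.snoc_last, Real.sqrt_mul hx0.le, Complex.ofReal_mul]
        ring
      · simp only [sn, Fin.snoc_castSucc, Real.sqrt_mul hx0.le, Complex.ofReal_mul]
        ring
    simp only [e2]
    rw [lintegral_const_mul' _ _ hkt, mul_left_comm, ← mul_assoc ((k + 1 : ℕ) : ENNReal)⁻¹,
      ENNReal.inv_mul_cancel hk0 hkt, one_mul, lintegral_lintegral_swap]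
    · rw [pow_succ, mul_comm (x ^ k) x, ENNReal.ofReal_mul hx0.le, mul_assoc,
        ← lintegral_const_mul' (ENNReal.ofReal (x ^ k)) _ (by finiteness)]
      congr 1
      refine setLIntegral_congr_fun measurableSet_Ioo fun y hy => ?_
      rw [mul_pow, ENNReal.ofReal_mul (by positivity), mul_assoc,
        lintegral_const_mul' _ _ (by finiteness)]
    · refine Measurable.aemeasurable ?_
      refine Measurable.mul (by fun_prop) ?_
      have hr : Measurable fun p : (Fin (k + 1) → ℂ) × ℝ => ((p.1, x * p.2), x * (1 - p.2)) := by
        fun_prop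
      exact hI1.comp hr

/-! ### Unitary invariance of the law of the last row. -/

theorem sum_norm_sq_vecMul {d : ℕ} {g : Matrix (Fin d) (Fin d) ℂ} (hg : g ∈ unitaryGroup (Fin d) ℂ)
    (z : Fin d → ℂ) : ∑ i, ‖(z ᵥ* g) i‖ ^ 2 = ∑ i, ‖z i‖ ^ 2 := by
  have h : ∀ w : Fin d → ℂ, ((∑ i, ‖w i‖ ^ 2 : ℝ) : ℂ) = w ⬝ᵥ star w := by
    intro w
    push_cast
    refine Finset.sum_congr rfl fun i _ => ?_
    simp [Complex.mul_conj']
  have h2 : (z ᵥ* g) ⬝ᵥ star (z ᵥ* g) = z ⬝ᵥ star z := by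
    rw [star_vecMul, dotProduct_mulVec, vecMul_vecMul, ← star_eq_conjTranspose,
      mem_unitaryGroup_iff.1 hg, vecMul_one]
  rw [← h, ← h] at h2
  exact_mod_cast h2

theorem continuous_vecMul_const {d : ℕ} (g : Matrix (Fin d) (Fin d) ℂ) :
    Continuous fun z : Fin d → ℂ => z ᵥ* g :=
  continuous_id.matrix_vecMul continuous_const

/-- An invertible linear map scales Lebesgue measure by some constant. Its value is not computed
here: comparing total masses in `measurePreserving_vecMul_rowMeasure` gives `1`. -/
theorem exists_map_vecMul_volume {d : ℕ} {g : Matrix (Fin d) (Fin d) ℂ}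
    (hg : g ∈ unitaryGroup (Fin d) ℂ) :
    ∃ C : ENNReal, (volume : Measure (Fin d → ℂ)).map (fun z => z ᵥ* g) = C • volume := by
  have hg1 : g * star g = 1 := mem_unitaryGroup_iff.1 hg
  have hg2 : star g * g = 1 := mem_unitaryGroup_iff'.1 hg
  let e : (Fin d → ℂ) ≃ₗ[ℝ] (Fin d → ℂ) :=
    { toFun := fun z => z ᵥ* g
      map_add' := fun x y => add_vecMul _ _ _
      map_smul' := fun r x => by simpa using smul_vecMul r x g
      invFun := fun z => z ᵥ* star g
      left_inv := fun z => by dsimp only; rw [vecMul_vecMul, hg1, vecMul_one]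
      right_inv := fun z => by dsimp only; rw [vecMul_vecMul, hg2, vecMul_one] }
  exact ⟨_, Measure.map_linearMap_addHaar_eq_smul_addHaar volume (f := (e : (Fin d → ℂ) →ₗ[ℝ] _))
    (LinearEquiv.isUnit_det' e).ne_zero⟩

/-- The law of the last row is invariant under unitaries. -/
theorem measurePreserving_vecMul_rowMeasure (k : ℕ) {g : Matrix (Fin (k + 1)) (Fin (k + 1)) ℂ}
    (hg : g ∈ unitaryGroup (Fin (k + 1)) ℂ) :
    MeasurePreserving (fun u => u ᵥ* g) (rowMeasure k) (rowMeasure k) := by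
  have hgm : Measurable fun z : Fin (k + 1) → ℂ => z ᵥ* g := (continuous_vecMul_const g).measurable
  obtain ⟨c, hc0, hct, hc⟩ := exists_lintegral_spherical k
  obtain ⟨C, hC⟩ := exists_map_vecMul_volume hg
  let N : (Fin (k + 1) → ℂ) → ℝ := fun z => ∑ i, ‖z i‖ ^ 2
  have hN : Measurable N := Continuous.measurable (by fun_prop)
  let B : ENNReal := ∫⁻ x in Set.Ioi (0 : ℝ),
    ENNReal.ofReal (x ^ k) * (Set.Iio (1 : ℝ)).indicator 1 x
  -- Averaging a function of the direction `z / |z|` over the Euclidean unit ball recovers its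
  -- integral against `rowMeasure`, up to the constant `c * B`.
  have key : ∀ f : (Fin (k + 1) → ℂ) → ENNReal, Measurable f →
      ∫⁻ z, f (fun i => ((Real.sqrt (N z))⁻¹ : ℝ) * z i) * (Set.Iio (1 : ℝ)).indicator 1 (N z) =
        c * B * ∫⁻ u, f u ∂rowMeasure k := by
    intro f hf
    rw [hc, mul_assoc, ← lintegral_mul_const]
    · congr 1
      refine setLIntegral_congr_fun measurableSet_Ioi fun x hx => ?_
      have hx0 : (0 : ℝ) < x := hx
      dsimp only
      rw [mul_assoc]
      congr 1
      rw [← lintegral_const_mul _ hf]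
      refine lintegral_congr_ae ?_
      filter_upwards [ae_sum_norm_sq_rowMeasure k] with u hu
      have hNx : N (fun i => Real.sqrt x * u i) = x := by
        simp only [N, norm_mul, mul_pow, Complex.norm_real, Real.norm_eq_abs, sq_abs,
          Real.sq_sqrt hx0.le]
        rw [← Finset.mul_sum, hu, mul_one]
      rw [hNx, mul_comm]
      congr 2
      funext i
      rw [← mul_assoc, ← Complex.ofReal_mul, inv_mul_cancel₀ (Real.sqrt_pos.2 hx0).ne']
      simp
    · exact Measurable.mul (by fun_prop) (measurable_one.indicator measurableSet_Iio)
    · refine Measurable.mul (hf.comp ?_) ((measurable_one.indicator measurableSet_Iio).comp hN)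
      fun_prop
  -- Testing with `f = 1` identifies the constant as the volume of the unit ball, which is positive
  -- and finite and can therefore be cancelled.
  have hcB : c * B = volume (N ⁻¹' Set.Iio 1) := by
    have h1 := key (fun _ => 1) measurable_const
    rw [lintegral_const, measure_univ, mul_one, mul_one] at h1
    rw [← h1, ← lintegral_indicator_one (hN measurableSet_Iio)]
    refine lintegral_congr fun z => ?_
    rw [one_mul]
    rfl
  have hcB0 : c * B ≠ 0 := by
    rw [hcB]
    refine (IsOpen.measure_pos volume (isOpen_Iio.preimage (by fun_prop)) ⟨0, ?_⟩).ne'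
    simp [N]
  have hcBt : c * B ≠ ⊤ := by
    rw [hcB]
    refine ((measure_mono fun z hz => ?_).trans_lt
      (measure_closedBall_lt_top (x := (0 : Fin (k + 1) → ℂ)) (r := 1))).ne
    rw [mem_closedBall_zero_iff, pi_norm_le_iff_of_nonneg zero_le_one]
    intro i
    have h1 : ‖z i‖ ^ 2 ≤ N z :=
      Finset.single_le_sum (f := fun i => ‖z i‖ ^ 2) (fun i _ => by positivity) (Finset.mem_univ i)
    have h2 : N z < 1 := hz
    exact (sq_le_one_iff₀ (norm_nonneg _)).1 (h1.trans h2.le)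
  have key2 : ∀ f : (Fin (k + 1) → ℂ) → ENNReal, Measurable f →
      ∫⁻ u, f (u ᵥ* g) ∂rowMeasure k = C * ∫⁻ u, f u ∂rowMeasure k := by
    intro f hf
    have h1 := key (fun u => f (u ᵥ* g)) (hf.comp hgm)
    have h2 := key f hf
    -- The change of variables `z ↦ z ᵥ* g` costs the factor `C`. It preserves the norm and commutes
    -- with normalization to a direction.
    have h3 : ∫⁻ z, f (fun i => ((Real.sqrt (N (z ᵥ* g)))⁻¹ : ℝ) * (z ᵥ* g) i) *
        (Set.Iio (1 : ℝ)).indicator 1 (N (z ᵥ* g)) =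
        C * ∫⁻ z, f (fun i => ((Real.sqrt (N z))⁻¹ : ℝ) * z i) *
          (Set.Iio (1 : ℝ)).indicator 1 (N z) := by
      rw [← lintegral_map (f := fun z => f (fun i => ((Real.sqrt (N z))⁻¹ : ℝ) * z i) *
          (Set.Iio (1 : ℝ)).indicator 1 (N z)) ?_ hgm, hC, lintegral_smul_measure, smul_eq_mul]
      refine Measurable.mul (hf.comp ?_) ((measurable_one.indicator measurableSet_Iio).comp hN)
      fun_prop
    have h4 : ∀ z : Fin (k + 1) → ℂ, N (z ᵥ* g) = N z := fun z => sum_norm_sq_vecMul hg z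
    have h5 : ∀ (r : ℂ) (z : Fin (k + 1) → ℂ), (fun i => r * (z ᵥ* g) i) =
        (fun i => r * z i) ᵥ* g := fun r z => (smul_vecMul r z g).symm
    simp only [h4, h5] at h3
    rw [h1, h2, mul_left_comm C] at h3
    exact (ENNReal.mul_right_inj hcB0 hcBt).1 h3
  -- The row law is a probability measure, so `f = 1` forces the factor.
  have hC1 : C = 1 := by
    have := key2 (fun _ => 1) measurable_const
    simpa using this.symm
  refine ⟨hgm, ?_⟩
  ext s hs
  rw [Measure.map_apply hgm hs]
  have := key2 (s.indicator 1) (measurable_one.indicator hs)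
  rw [hC1, one_mul, lintegral_indicator_one hs] at this
  rw [← this, ← lintegral_indicator_one (hgm hs)]
  rfl

/-! ### Haar measures on compact groups -/

section CompactGroup

variable {G : Type*} [Group G] [TopologicalSpace G] [IsTopologicalGroup G] [CompactSpace G]
  [MeasurableSpace G] [BorelSpace G]

/-- A right translate of the Haar measure is again a left-invariant probability measure, so
uniqueness applies. -/
theorem isMulRightInvariant_haarMeasure_top [T2Space G] :
    (Measure.haarMeasure (⊤ : TopologicalSpace.PositiveCompacts G)).IsMulRightInvariant := by
  have hp : IsProbabilityMeasure (Measure.haarMeasure (⊤ : TopologicalSpace.PositiveCompacts G)) :=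
    ⟨Measure.haarMeasure_self⟩
  refine ⟨fun g => ?_⟩
  have : IsProbabilityMeasure ((Measure.haarMeasure
      (⊤ : TopologicalSpace.PositiveCompacts G)).map (· * g)) :=
    Measure.isProbabilityMeasure_map (measurable_mul_const g).aemeasurable
  have hinv : Measure.IsMulLeftInvariant ((Measure.haarMeasure
      (⊤ : TopologicalSpace.PositiveCompacts G)).map (· * g)) := inferInstance
  exact Measure.isHaarMeasure_eq_of_isProbabilityMeasure _ _

end CompactGroup

instance instIsProbabilityMeasureHaarU (d : ℕ) : IsProbabilityMeasure (haarU d) :=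
  ⟨Measure.haarMeasure_self⟩

instance instIsProbabilityMeasureHaarSU (d : ℕ) : IsProbabilityMeasure (haarSU d) :=
  ⟨Measure.haarMeasure_self⟩

instance instIsHaarMeasureHaarU (d : ℕ) : (haarU d).IsHaarMeasure :=
  inferInstanceAs (Measure.haarMeasure _).IsHaarMeasure

instance instIsHaarMeasureHaarSU (d : ℕ) : (haarSU d).IsHaarMeasure :=
  inferInstanceAs (Measure.haarMeasure _).IsHaarMeasure

instance instSecondCountableTopologyMatrix {d : ℕ} :
    SecondCountableTopology (Matrix (Fin d) (Fin d) ℂ) :=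
  inferInstanceAs (SecondCountableTopology (Fin d → Fin d → ℂ))

instance instSecondCountableTopologyU {d : ℕ} :
    SecondCountableTopology (unitaryGroup (Fin d) ℂ) :=
  TopologicalSpace.Subtype.secondCountableTopology _

instance instSecondCountableTopologySU {d : ℕ} :
    SecondCountableTopology (specialUnitaryGroup (Fin d) ℂ) :=
  TopologicalSpace.Subtype.secondCountableTopology _

instance instIsMulRightInvariantHaarU (d : ℕ) : (haarU d).IsMulRightInvariant :=
  isMulRightInvariant_haarMeasure_top

instance instIsMulRightInvariantHaarSU (d : ℕ) : (haarSU d).IsMulRightInvariant :=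
  isMulRightInvariant_haarMeasure_top

/-! ### Stabilizer of the last row -/

/-- The embedding `SU(d) → SU(d + 1)`. -/
def extendSU {d : ℕ} (h : specialUnitaryGroup (Fin d) ℂ) : specialUnitaryGroup (Fin (d + 1)) ℂ :=
  ⟨extendLast h.1, extendLast_mem h.2⟩

theorem extendSU_mul {d : ℕ} (g h : specialUnitaryGroup (Fin d) ℂ) :
    extendSU (g * h) = extendSU g * extendSU h :=
  Subtype.ext ((extendLastHom d).map_mul g.1 h.1)

theorem continuous_extendSU {d : ℕ} : Continuous (extendSU (d := d)) := by
  refine Continuous.subtype_mk ?_ _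
  unfold extendLast blockEmb
  fun_prop

theorem extendLast_injective {d : ℕ} : Function.Injective (extendLast (d := d)) := by
  intro M N h
  ext i j
  rw [← extendLast_castSucc_castSucc M, h, extendLast_castSucc_castSucc]

/-- Orthogonality of the other rows to the last one makes the last column a unit vector too, so the
matrix is block diagonal. -/
theorem exists_extendSU_of_lastRow {d : ℕ} (g : specialUnitaryGroup (Fin (d + 1)) ℂ)
    (hg : ∀ b, g.1 (Fin.last d) b = if Fin.last d = b then 1 else 0) : ∃ h, extendSU h = g := by
  obtain ⟨hu, hdet⟩ := mem_specialUnitaryGroup_iff.1 g.2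
  have hcol : ∀ a : Fin d, g.1 a.castSucc (Fin.last d) = 0 := by
    intro a
    have h1 := congrFun (congrFun (mem_unitaryGroup_iff.1 hu) a.castSucc) (Fin.last d)
    rw [star_eq_conjTranspose, Matrix.mul_apply] at h1
    simpa [hg, Fin.castSucc_ne_last] using h1
  let h : Matrix (Fin d) (Fin d) ℂ := Matrix.of fun i j => g.1 i.castSucc j.castSucc
  have he : extendLast h = g.1 := by
    ext a b
    refine Fin.lastCases ?_ (fun i => ?_) a <;> refine Fin.lastCases ?_ (fun j => ?_) b
    · simp [hg]
    · simp [hg, (Fin.castSucc_ne_last j).symm]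
    · simp [hcol]
    · simp [h]
  have hmem : h ∈ specialUnitaryGroup (Fin d) ℂ := by
    rw [mem_specialUnitaryGroup_iff]
    constructor
    · rw [mem_unitaryGroup_iff', star_eq_conjTranspose]
      apply extendLast_injective
      have h1 : extendLast (hᴴ * h) = (extendLast h)ᴴ * extendLast h := by
        rw [extendLast, extendLast, blockEmb_conjTranspose]
        exact blockEmb_mul (coordIncl_isometry (by omega)) _ _
      have h2 : extendLast (1 : Matrix (Fin d) (Fin d) ℂ) = 1 := blockEmb_one _
      rw [h1, he, h2]
      exact mem_unitaryGroup_iff'.1 hu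
    · rw [← hdet, ← he]
      exact (det_blockEmb (coordIncl_isometry (by omega)) h).symm
  exact ⟨⟨h, hmem⟩, Subtype.ext he⟩

/-- The last row. -/
def rowSU {d : ℕ} (g : specialUnitaryGroup (Fin (d + 1)) ℂ) : Fin (d + 1) → ℂ := g.1 (Fin.last d)

theorem continuous_rowSU {d : ℕ} : Continuous (rowSU (d := d)) :=
  (continuous_apply (Fin.last d)).comp continuous_subtype_val

theorem rowSU_mul {d : ℕ} (g h : specialUnitaryGroup (Fin (d + 1)) ℂ) :
    rowSU (g * h) = rowSU g ᵥ* h.1 := rfl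

/-- `g' * g⁻¹` has the last row of the identity and hence lies in the embedded `SU(d)`. So the last
row separates the cosets. -/
theorem exists_extendSU_mul_of_rowSU_eq {d : ℕ} {g g' : specialUnitaryGroup (Fin (d + 1)) ℂ}
    (h : rowSU g = rowSU g') : ∃ k, g' = extendSU k * g := by
  have h1 : rowSU (g' * g⁻¹) = rowSU (1 : specialUnitaryGroup (Fin (d + 1)) ℂ) := by
    rw [rowSU_mul, ← h, ← rowSU_mul, mul_inv_cancel]
  obtain ⟨k, hk⟩ := exists_extendSU_of_lastRow (g' * g⁻¹) fun b => by
    have := congrFun h1 b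
    simpa [rowSU, one_apply] using this
  exact ⟨k, by rw [hk, inv_mul_cancel_right]⟩

/-! ### From the last row to the Haar measure -/

theorem integrable_of_continuous_compact {K Y : Type*} [TopologicalSpace K] [CompactSpace K]
    [MeasurableSpace K] [OpensMeasurableSpace K] [MeasurableSpace Y] (μ : Measure Y)
    [IsFiniteMeasure μ] {E : Type*} [NormedAddCommGroup E] [SecondCountableTopology E]
    [MeasurableSpace E] [BorelSpace E]
    {f : K → E} (hf : Continuous f) {q : Y → K} (hq : Measurable q) :
    Integrable (fun y => f (q y)) μ := by
  obtain ⟨C, hC⟩ := (isCompact_range hf).isBounded.exists_norm_le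
  exact Integrable.of_bound (hf.measurable.comp hq).aestronglyMeasurable C
    (ae_of_all _ fun y => hC _ ⟨_, rfl⟩)

theorem continuous_integral_extendSU {d : ℕ} {f : specialUnitaryGroup (Fin (d + 1)) ℂ → ℝ}
    (hf : Continuous f) :
    Continuous fun g : specialUnitaryGroup (Fin (d + 1)) ℂ => ∫ h, f (extendSU h * g) ∂haarSU d := by
  obtain ⟨C, hC⟩ := (isCompact_range hf).isBounded.exists_norm_le
  refine continuous_of_dominated (bound := fun _ => C) (fun g => ?_) (fun g => ?_) ?_ ?_
  · exact (hf.comp (continuous_extendSU.mul continuous_const)).measurable.aestronglyMeasurable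
  · exact ae_of_all _ fun h => hC _ ⟨_, rfl⟩
  · exact integrable_const _
  · exact ae_of_all _ fun h => hf.comp (continuous_const.mul continuous_id)

/-- `F` is constant on the fibres of the row map. That map is closed, being continuous from a
compact space to a Hausdorff space, hence a quotient map onto its closed image. So the factor is
continuous, and Tietze's theorem extends it to all row vectors. -/
theorem exists_continuous_comp_rowSU {d : ℕ} {F : specialUnitaryGroup (Fin (d + 1)) ℂ → ℝ}
    (hF : Continuous F) (hinv : ∀ k g, F (extendSU k * g) = F g) :
    ∃ Φ : C(Fin (d + 1) → ℂ, ℝ), ∀ g, Φ (rowSU g) = F g := by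
  let R : Set (Fin (d + 1) → ℂ) := Set.range (rowSU (d := d))
  have hR : IsClosed R := (isCompact_range continuous_rowSU).isClosed
  let p : C(specialUnitaryGroup (Fin (d + 1)) ℂ, R) :=
    ⟨Set.rangeFactorization rowSU, continuous_rowSU.subtype_mk _⟩
  have hp : IsQuotientMap p :=
    p.continuous.isClosedMap.isQuotientMap p.continuous Set.rangeFactorization_surjective
  have hfac : Function.FactorsThrough (⟨F, hF⟩ : C(specialUnitaryGroup (Fin (d + 1)) ℂ, ℝ)) p := by
    intro g g' h
    obtain ⟨k, rfl⟩ := exists_extendSU_mul_of_rowSU_eq (congrArg Subtype.val h)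
    exact (hinv k g).symm
  obtain ⟨Φ, hΦ⟩ := ContinuousMap.exists_restrict_eq hR (hp.lift ⟨F, hF⟩ hfac)
  refine ⟨Φ, fun g => ?_⟩
  have h1 := DFunLike.congr_fun hΦ (p g)
  have h2 := DFunLike.congr_fun (hp.lift_comp ⟨F, hF⟩ hfac) g
  exact h1.trans h2

/-- If the law of the last row of the random matrix `E ∈ SU(d + 1)` is invariant, then the product
of an independent Haar matrix of `SU(d)` with `E` is Haar distributed. -/
theorem integral_extendSU_mul {d : ℕ} {Ω : Type*} [MeasurableSpace Ω] {ν : Measure Ω}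
    [IsProbabilityMeasure ν] {E : Ω → specialUnitaryGroup (Fin (d + 1)) ℂ} (hE : Measurable E)
    (hrow : ∀ g : specialUnitaryGroup (Fin (d + 1)) ℂ, MeasurePreserving (fun u => u ᵥ* g.1)
      (ν.map fun x => rowSU (E x)) (ν.map fun x => rowSU (E x)))
    {f : specialUnitaryGroup (Fin (d + 1)) ℂ → ℝ} (hf : Continuous f) :
    ∫ x, ∫ h, f (extendSU h * E x) ∂haarSU d ∂ν = ∫ g, f g ∂haarSU (d + 1) := by
  -- Averaging over the Haar matrix of `SU(d)` leaves a function of the coset, hence of the last row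
  -- alone.
  let F : specialUnitaryGroup (Fin (d + 1)) ℂ → ℝ := fun g => ∫ h, f (extendSU h * g) ∂haarSU d
  have hF : Continuous F := continuous_integral_extendSU hf
  have hinv : ∀ k g, F (extendSU k * g) = F g := by
    intro k g
    simp only [F]
    rw [← integral_mul_right_eq_self (fun h => f (extendSU h * g)) k]
    simp only [extendSU_mul, mul_assoc]
  obtain ⟨Φ, hΦ⟩ := exists_continuous_comp_rowSU hF hinv
  have hEr : Measurable fun x => rowSU (E x) := continuous_rowSU.measurable.comp hE
  -- Right multiplication by `g` only moves the last row by a unitary, under which its law is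
  -- invariant.
  have h1 : ∀ g, ∫ x, F (E x * g) ∂ν = ∫ x, F (E x) ∂ν := by
    intro g
    have e1 : ∫ x, F (E x * g) ∂ν = ∫ u, Φ (u ᵥ* g.1) ∂(ν.map fun x => rowSU (E x)) := by
      have hc : Continuous fun u => Φ (u ᵥ* g.1) := Φ.continuous.comp (continuous_vecMul_const g.1)
      rw [integral_map hEr.aemeasurable hc.aestronglyMeasurable]
      simp only [← rowSU_mul, hΦ]
    have e2 : ∫ x, F (E x) ∂ν = ∫ u, Φ u ∂(ν.map fun x => rowSU (E x)) := by
      rw [integral_map hEr.aemeasurable Φ.continuous.aestronglyMeasurable]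
      simp only [hΦ]
    rw [e1, e2]
    conv_rhs => rw [← (hrow g).map_eq]
    rw [integral_map (hrow g).measurable.aemeasurable Φ.continuous.aestronglyMeasurable]
  -- The free parameter `g` may now be averaged over Haar. After exchanging integrals, left
  -- invariance absorbs first `E x` and then `extendSU h`.
  calc ∫ x, F (E x) ∂ν = ∫ g, ∫ x, F (E x * g) ∂ν ∂haarSU (d + 1) := by
        simp only [h1, integral_const, probReal_univ, one_smul]
    _ = ∫ x, ∫ g, F (E x * g) ∂haarSU (d + 1) ∂ν := by
        refine integral_integral_swap ?_
        exact integrable_of_continuous_compact _ hF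
          (q := fun p : specialUnitaryGroup (Fin (d + 1)) ℂ × Ω => E p.2 * p.1)
          ((hE.comp measurable_snd).mul measurable_fst)
    _ = ∫ g, F g ∂haarSU (d + 1) := by
        have : ∀ x, ∫ g, F (E x * g) ∂haarSU (d + 1) = ∫ g, F g ∂haarSU (d + 1) := fun x =>
          integral_mul_left_eq_self F (E x)
        simp only [this, integral_const, probReal_univ, one_smul]
    _ = ∫ h, ∫ g, f (extendSU h * g) ∂haarSU (d + 1) ∂haarSU d := by
        refine integral_integral_swap ?_
        exact integrable_of_continuous_compact _ hf
          (q := fun p : specialUnitaryGroup (Fin (d + 1)) ℂ × specialUnitaryGroup (Fin d) ℂ =>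
            extendSU p.2 * p.1)
          ((continuous_extendSU.measurable.comp measurable_snd).mul measurable_fst)
    _ = ∫ g, f g ∂haarSU (d + 1) := by
        have : ∀ h : specialUnitaryGroup (Fin d) ℂ, ∫ g, f (extendSU h * g) ∂haarSU (d + 1) =
            ∫ g, f g ∂haarSU (d + 1) := fun h => integral_mul_left_eq_self f (extendSU h)
        simp only [this, integral_const, probReal_univ, one_smul]

/-! ### `SU(d)` and `U(d)` -/

/-- The phase is a `d`-th root of the determinant. -/
theorem exists_smul_specialUnitary {d : ℕ} (hd : 0 < d) (W : unitaryGroup (Fin d) ℂ) :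
    ∃ (z : ℂ) (h : specialUnitaryGroup (Fin d) ℂ), ‖z‖ = 1 ∧ W.1 = z • h.1 := by
  obtain ⟨z, hz⟩ := IsAlgClosed.exists_pow_nat_eq W.1.det hd
  have hdet : ‖W.1.det‖ = 1 := by
    have h1 := congrArg Matrix.det (mem_unitaryGroup_iff.1 W.2)
    rw [det_mul, star_eq_conjTranspose, det_conjTranspose, det_one, RCLike.star_def,
      Complex.mul_conj'] at h1
    have h2 : ‖W.1.det‖ ^ 2 = 1 := by exact_mod_cast h1
    exact (pow_eq_one_iff_of_nonneg (norm_nonneg _) two_ne_zero).1 h2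
  have hz1 : ‖z‖ = 1 := by
    rw [← hz, norm_pow] at hdet
    exact (pow_eq_one_iff_of_nonneg (norm_nonneg z) hd.ne').1 hdet
  have hz0 : z ≠ 0 := fun h => by simp [h] at hz1
  refine ⟨z, ⟨z⁻¹ • W.1, ?_⟩, hz1, by simp [smul_smul, hz0]⟩
  rw [mem_specialUnitaryGroup_iff]
  constructor
  · rw [mem_unitaryGroup_iff, star_smul, smul_mul_smul_comm, mem_unitaryGroup_iff.1 W.2,
      RCLike.star_def, Complex.mul_conj']
    simp [hz1]
  · rw [det_smul, Fintype.card_fin, inv_pow, hz, inv_mul_cancel₀]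
    intro h0
    simp [h0] at hdet

/-- Averages of phase-invariant functions over `SU(d)` and `U(d)` agree. -/
theorem integral_haarSU_eq_haarU {d : ℕ} (hd : 0 < d) {F : Matrix (Fin d) (Fin d) ℂ → ℂ}
    (hF : Continuous F) (hphase : ∀ (z : ℂ) (M : Matrix (Fin d) (Fin d) ℂ), ‖z‖ = 1 → F (z • M) = F M) :
    ∫ g : specialUnitaryGroup (Fin d) ℂ, F g.1 ∂haarSU d =
      ∫ W : unitaryGroup (Fin d) ℂ, F W.1 ∂haarU d := by
  let j : specialUnitaryGroup (Fin d) ℂ → unitaryGroup (Fin d) ℂ :=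
    fun g => ⟨g.1, (mem_specialUnitaryGroup_iff.1 g.2).1⟩
  have hj : Continuous j := continuous_subtype_val.subtype_mk _
  have hFU : Continuous fun W : unitaryGroup (Fin d) ℂ => F W.1 := hF.comp continuous_subtype_val
  symm
  calc ∫ W : unitaryGroup (Fin d) ℂ, F W.1 ∂haarU d
      = ∫ g, ∫ W : unitaryGroup (Fin d) ℂ, F (W * j g).1 ∂haarU d ∂haarSU d := by
        have : ∀ g, ∫ W : unitaryGroup (Fin d) ℂ, F (W * j g).1 ∂haarU d =
            ∫ W : unitaryGroup (Fin d) ℂ, F W.1 ∂haarU d := fun g =>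
          integral_mul_right_eq_self (fun W : unitaryGroup (Fin d) ℂ => F W.1) (j g)
        simp only [this, integral_const, probReal_univ, one_smul]
    -- The Haar unitary has been multiplied by an independent Haar matrix of `SU(d)`. For fixed `W =
    -- z h`, the phase `z` drops out of `F` and left invariance absorbs `h`.
    _ = ∫ W : unitaryGroup (Fin d) ℂ, ∫ g, F (W * j g).1 ∂haarSU d ∂haarU d := by
        refine integral_integral_swap ?_
        exact integrable_of_continuous_compact _ hFU
          (q := fun p : specialUnitaryGroup (Fin d) ℂ × unitaryGroup (Fin d) ℂ => p.2 * j p.1)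
          (measurable_snd.mul (hj.measurable.comp measurable_fst))
    _ = ∫ g : specialUnitaryGroup (Fin d) ℂ, F g.1 ∂haarSU d := by
        have : ∀ W : unitaryGroup (Fin d) ℂ, ∫ g, F (W * j g).1 ∂haarSU d =
            ∫ g : specialUnitaryGroup (Fin d) ℂ, F g.1 ∂haarSU d := by
          intro W
          obtain ⟨z, h, hz, hW⟩ := exists_smul_specialUnitary hd W
          rw [← integral_mul_left_eq_self
            (fun g : specialUnitaryGroup (Fin d) ℂ => F g.1) h]
          refine integral_congr_ae (ae_of_all _ fun g => ?_)
          have : (W * j g).1 = z • (h * g).1 := by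
            change W.1 * g.1 = z • (h.1 * g.1)
            rw [hW, smul_mul]
          simp only [this, hphase _ _ hz]
        simp only [this, integral_const, probReal_univ, one_smul]

/-! ### The Euler-angle parametrization carries the uniform measure to the Haar measure -/

/-- The phases of the chain `R_{k+1} ⋯ R_1` read off from the phases of its last row. -/
def chainPhase {n : ℕ} (y : Fin (n + 2) → ℝ) (r : ℕ) : ℝ :=
  if r = 0 then y 0 else extendSeq (k := n + 1) y (r + 1)

theorem chainPhase_succ {n : ℕ} (y : Fin (n + 2) → ℝ) (r : Fin n) :
    chainPhase y (r + 1) = y r.succ.succ := by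
  simp only [chainPhase, Nat.add_eq_zero_iff, one_ne_zero, and_false, if_false]
  exact extendSeq_val (k := n + 1) y r.succ.succ

theorem rotChain_mem {d k : ℕ} (h : k + 1 < d) (ξ φ : ℕ → ℝ) (η : ℝ) :
    rotChain d ξ φ η k ∈ specialUnitaryGroup (Fin d) ℂ := by
  induction k with
  | zero => exact rot_mem h _ _ _
  | succ k ih => exact mul_mem (rot_mem h _ _ _) (ih (by omega))

/-- The factor `E_{d-1}` as a function of the angles of its last row. -/
def lastFactor (n : ℕ) (y : Fin (n + 1) ⊕ Fin (n + 2) → ℝ) : specialUnitaryGroup (Fin (n + 2)) ℂ :=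
  ⟨rotChain (n + 2) (extendSeq (k := n) fun r => xiOf (r + 1) (y (Sum.inl r)))
    (chainPhase fun i => y (Sum.inr i)) (y (Sum.inr 1)) n, rotChain_mem (by omega) _ _ _⟩

theorem continuous_rot {X : Type*} [TopologicalSpace X] (d r : ℕ) {ξ φ η : X → ℝ}
    (hξ : Continuous ξ) (hφ : Continuous φ) (hη : Continuous η) :
    Continuous fun x => rot d r (ξ x) (φ x) (η x) := by
  refine continuous_matrix fun a b => ?_
  simp only [rot, of_apply]
  split_ifs <;> fun_prop

theorem continuous_lastFactor (n : ℕ) : Continuous (lastFactor n) := by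
  refine Continuous.subtype_mk ?_ _
  have hξ : ∀ r, Continuous fun y : Fin (n + 1) ⊕ Fin (n + 2) → ℝ =>
      extendSeq (k := n) (fun r => xiOf (r + 1) (y (Sum.inl r))) r := fun r =>
    (continuous_xiOf _).comp (continuous_apply _)
  have hφ : ∀ r, Continuous fun y : Fin (n + 1) ⊕ Fin (n + 2) → ℝ =>
      chainPhase (fun i => y (Sum.inr i)) r := by
    intro r
    unfold chainPhase
    split_ifs
    · fun_prop
    · unfold extendSeq; fun_prop
  have : ∀ k, Continuous fun y : Fin (n + 1) ⊕ Fin (n + 2) → ℝ =>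
      rotChain (n + 2) (extendSeq (k := n) fun r => xiOf (r + 1) (y (Sum.inl r)))
        (chainPhase fun i => y (Sum.inr i)) (y (Sum.inr 1)) k := by
    intro k
    induction k with
    | zero => exact continuous_rot _ _ (hξ 0) (hφ 0) (by fun_prop)
    | succ k ih => exact (continuous_rot _ _ (hξ _) continuous_const (hφ _)).matrix_mul ih
  exact this n

theorem rowSU_lastFactor (n : ℕ) (y : Fin (n + 1) ⊕ Fin (n + 2) → ℝ) :
    rowSU (lastFactor n y) = lastRow (n + 1) y := by
  funext i
  refine rotChain_lastRow _ _ _ n (by omega) y (fun r => ?_) ?_ rfl (fun r => ?_) i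
  · exact extendSeq_val (k := n) (fun r => xiOf (r + 1) (y (Sum.inl r))) r
  · simp [chainPhase]
  · exact (chainPhase_succ (fun i => y (Sum.inr i)) r).symm

/-- The indices of the angles of the last factor. -/
def lastIndex (n : ℕ) : Fin (n + 1) ⊕ Fin (n + 2) → EulerIndex n :=
  Sum.elim (fun r => Sum.inl ⟨Fin.last n, r⟩)
    (Fin.cases (Sum.inr (Sum.inl ⟨Fin.last n, 0⟩))
      (Fin.cases (Sum.inr (Sum.inr (Fin.last n))) fun r => Sum.inr (Sum.inl ⟨Fin.last n, r.succ⟩)))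

@[simp] theorem lastIndex_inl (n : ℕ) (r : Fin (n + 1)) :
    lastIndex n (Sum.inl r) = Sum.inl ⟨Fin.last n, r⟩ := rfl

@[simp] theorem lastIndex_inr_zero (n : ℕ) :
    lastIndex n (Sum.inr 0) = Sum.inr (Sum.inl ⟨Fin.last n, 0⟩) := rfl

@[simp] theorem lastIndex_inr_one (n : ℕ) :
    lastIndex n (Sum.inr 1) = Sum.inr (Sum.inr (Fin.last n)) := rfl

@[simp] theorem lastIndex_inr_succ_succ (n : ℕ) (r : Fin n) :
    lastIndex n (Sum.inr r.succ.succ) = Sum.inr (Sum.inl ⟨Fin.last n, r.succ⟩) := rfl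

theorem fin_eq_zero_or_one_or_succ_succ {n : ℕ} (i : Fin (n + 2)) :
    i = 0 ∨ i = 1 ∨ ∃ r : Fin n, i = r.succ.succ := by
  refine Fin.cases (Or.inl rfl) (fun i => ?_) i
  exact Fin.cases (Or.inr (Or.inl rfl)) (fun r => Or.inr (Or.inr ⟨r, rfl⟩)) i

theorem lastIndex_injective (n : ℕ) : Function.Injective (lastIndex n) := by
  rintro (r | i) (s | j) h
  · simpa using h
  · rcases fin_eq_zero_or_one_or_succ_succ j with rfl | rfl | ⟨j, rfl⟩ <;> simp at h
  · rcases fin_eq_zero_or_one_or_succ_succ i with rfl | rfl | ⟨i, rfl⟩ <;> simp at h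
  · rcases fin_eq_zero_or_one_or_succ_succ i with rfl | rfl | ⟨i, rfl⟩ <;>
      rcases fin_eq_zero_or_one_or_succ_succ j with rfl | rfl | ⟨j, rfl⟩ <;>
      simp at h ⊢
    · exact absurd h (Fin.succ_ne_zero j).symm
    · exact h

theorem hurwitzE_last (n : ℕ) (x : EulerIndex n → ℝ) :
    hurwitzE n (fun p => xiOf ((p.2 : ℕ) + 1) (x (Sum.inl p)))
      (fun p => x (Sum.inr (Sum.inl p))) (fun j => x (Sum.inr (Sum.inr j))) (Fin.last n) =
    (lastFactor n (x ∘ lastIndex n)).1 := by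
  refine hurwitzE_eq_rotChain n _ _ _ (Fin.last n) _ _ (fun r => ?_) (fun r => ?_)
  · exact extendSeq_val (k := n) (fun r => xiOf ((r : ℕ) + 1) (x (Sum.inl ⟨Fin.last n, r⟩))) r
  · have : ∀ r : Fin (n + 1), chainPhase (fun i => (x ∘ lastIndex n) (Sum.inr i)) r =
        x (Sum.inr (Sum.inl ⟨Fin.last n, r⟩)) := by
      intro r
      refine Fin.cases ?_ (fun r => ?_) r
      · simp [chainPhase, lastIndex]
      · rw [Fin.val_succ, chainPhase_succ]
        simp [lastIndex]
    exact this r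

/-- The parametrization with values in the group. -/
def hurwitzSU (n : ℕ) (x : EulerIndex n → ℝ) : specialUnitaryGroup (Fin (n + 2)) ℂ :=
  ⟨hurwitzTorus n x, hurwitzTorus_mem n x⟩

theorem continuous_hurwitzSU (n : ℕ) : Continuous (hurwitzSU n) :=
  (continuous_hurwitzTorus n).subtype_mk _

/-- The indices of the angles of all factors but the last one. -/
def initIndex (n : ℕ) : EulerIndex n → EulerIndex (n + 1) :=
  Sum.map (fun p => ⟨p.1.castSucc, p.2⟩) (Sum.map (fun p => ⟨p.1.castSucc, p.2⟩) Fin.castSucc)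

theorem castSucc_pair_injective (n : ℕ) : Function.Injective
    (fun p : AnglePair n => (⟨p.1.castSucc, p.2⟩ : AnglePair (n + 1))) := by
  rintro ⟨j, r⟩ ⟨j', r'⟩ h
  have h1 : j = j' := Fin.castSucc_injective _ (congrArg Sigma.fst h)
  subst h1
  have h2 : r = r' := eq_of_heq (Sigma.mk.inj h).2
  rw [h2]

theorem initIndex_lastIndex_injective (n : ℕ) :
    Function.Injective (Sum.elim (initIndex n) (lastIndex (n + 1))) := by
  have hne : ∀ (p : AnglePair n) (r : Fin (n + 2)),
      (⟨p.1.castSucc, p.2⟩ : AnglePair (n + 1)) ≠ ⟨Fin.last (n + 1), r⟩ := fun p r h =>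
    Fin.castSucc_ne_last p.1 (congrArg Sigma.fst h)
  refine Function.Injective.sumElim ?_ (lastIndex_injective _) ?_
  · exact (castSucc_pair_injective n).sumMap
      ((castSucc_pair_injective n).sumMap (Fin.castSucc_injective _))
  · rintro (p | p | j) (r | i)
    · exact fun h => hne p r (Sum.inl_injective h)
    · rcases fin_eq_zero_or_one_or_succ_succ i with rfl | rfl | ⟨i, rfl⟩ <;> simp [initIndex]
    · simp [initIndex]
    · rcases fin_eq_zero_or_one_or_succ_succ i with rfl | rfl | ⟨i, rfl⟩
      · exact fun h => hne p _ (Sum.inl_injective (Sum.inr_injective h))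
      · simp [initIndex]
      · exact fun h => hne p _ (Sum.inl_injective (Sum.inr_injective h))
    · simp [initIndex]
    · rcases fin_eq_zero_or_one_or_succ_succ i with rfl | rfl | ⟨i, rfl⟩ <;>
        simp [initIndex]

theorem hurwitzSU_zero (x : EulerIndex 0 → ℝ) :
    hurwitzSU 0 x = lastFactor 0 (x ∘ lastIndex 0) := by
  refine Subtype.ext ?_
  rw [← hurwitzE_last]
  exact hurwitzV_zero _ _ _

theorem hurwitzSU_succ (n : ℕ) (x : EulerIndex (n + 1) → ℝ) :
    hurwitzSU (n + 1) x =
      extendSU (hurwitzSU n (x ∘ initIndex n)) * lastFactor (n + 1) (x ∘ lastIndex (n + 1)) := by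
  refine Subtype.ext ?_
  change hurwitzTorus (n + 1) x = extendLast (hurwitzTorus n (x ∘ initIndex n)) * _
  rw [← hurwitzE_last, hurwitzTorus, hurwitzV_succ]
  rfl

theorem integral_lastFactor (n : ℕ) {f : specialUnitaryGroup (Fin (n + 2)) ℂ → ℝ}
    (hf : Continuous f) :
    ∫ y, ∫ h, f (extendSU h * lastFactor n y) ∂haarSU (n + 1) ∂Measure.pi (fun _ => unifAngle) =
      ∫ g, f g ∂haarSU (n + 2) := by
  refine integral_extendSU_mul (continuous_lastFactor n).measurable (fun g => ?_) hf
  have : (Measure.pi fun _ => unifAngle).map (fun y => rowSU (lastFactor n y)) =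
      rowMeasure (n + 1) := by
    simp only [rowSU_lastFactor]
    rfl
  rw [this]
  exact measurePreserving_vecMul_rowMeasure (n + 1) (mem_specialUnitaryGroup_iff.1 g.2).1

/-- Induction on the dimension: the angles of `V'` and those of `E_{d-1}` are disjoint families of
coordinates, hence independent. The inner integral over the former is a Haar average by hypothesis,
and `integral_lastFactor` handles the rest. -/
theorem integral_hurwitzSU (n : ℕ) {f : specialUnitaryGroup (Fin (n + 2)) ℂ → ℝ}
    (hf : Continuous f) :
    ∫ x, f (hurwitzSU n x) ∂torusMeasure n = ∫ g, f g ∂haarSU (n + 2) := by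
  induction n with
  | zero =>
    have hmp := measurePreserving_comp_injective unifAngle (lastIndex_injective 0)
    rw [← integral_lastFactor 0 hf]
    -- The group `SU(1)` is trivial, so for `d = 2` the only factor is already Haar.
    have h1 : ∀ h : specialUnitaryGroup (Fin 1) ℂ, extendSU h = 1 := by
      intro h
      have : h = 1 := by
        refine Subtype.ext ?_
        ext i j
        have h2 := (mem_specialUnitaryGroup_iff.1 h.2).2
        rw [det_fin_one] at h2
        rw [Subsingleton.elim i 0, Subsingleton.elim j 0, h2]
        rfl
      rw [this]
      exact Subtype.ext (blockEmb_one _)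
    simp only [h1, one_mul, integral_const, probReal_univ, one_smul, hurwitzSU_zero]
    have hfl : Continuous fun y => f (lastFactor 0 y) := hf.comp (continuous_lastFactor 0)
    rw [← hmp.map_eq, integral_map hmp.measurable.aemeasurable hfl.measurable.aestronglyMeasurable]
    rfl
  | succ n ih =>
    have hmp := measurePreserving_comp_prod unifAngle (initIndex_lastIndex_injective n)
    have hcont : Continuous fun p : (EulerIndex n → ℝ) × (Fin (n + 2) ⊕ Fin (n + 3) → ℝ) =>
        f (extendSU (hurwitzSU n p.1) * lastFactor (n + 1) p.2) :=
      hf.comp ((continuous_extendSU.comp ((continuous_hurwitzSU n).comp continuous_fst)).mul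
        ((continuous_lastFactor (n + 1)).comp continuous_snd))
    have e1 : ∫ x, f (hurwitzSU (n + 1) x) ∂torusMeasure (n + 1) =
        ∫ p, f (extendSU (hurwitzSU n p.1) * lastFactor (n + 1) p.2)
          ∂(torusMeasure n).prod (Measure.pi fun _ => unifAngle) := by
      simp only [hurwitzSU_succ]
      change _ = ∫ p, _ ∂(Measure.pi fun _ => unifAngle).prod (Measure.pi fun _ => unifAngle)
      rw [← hmp.map_eq, integral_map hmp.measurable.aemeasurable
        hcont.measurable.aestronglyMeasurable]
      rfl
    rw [e1, integral_prod_symm, ← integral_lastFactor (n + 1) hf]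
    · refine integral_congr_ae (ae_of_all _ fun y => ?_)
      exact ih (f := fun h => f (extendSU h * lastFactor (n + 1) y))
        (hf.comp (continuous_extendSU.mul continuous_const))
    · refine integrable_of_continuous_compact _ hf (q := fun p :
        (EulerIndex n → ℝ) × (Fin (n + 2) ⊕ Fin (n + 3) → ℝ) =>
        extendSU (hurwitzSU n p.1) * lastFactor (n + 1) p.2) ?_
      exact ((continuous_extendSU.comp ((continuous_hurwitzSU n).comp continuous_fst)).mul
        ((continuous_lastFactor (n + 1)).comp continuous_snd)).measurable

theorem map_hurwitzSU (n : ℕ) : (torusMeasure n).map (hurwitzSU n) = haarSU (n + 2) := by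
  have hm := (continuous_hurwitzSU n).measurable
  have : IsProbabilityMeasure ((torusMeasure n).map (hurwitzSU n)) :=
    Measure.isProbabilityMeasure_map hm.aemeasurable
  refine ext_of_forall_integral_eq_of_IsFiniteMeasure fun f => ?_
  rw [integral_map hm.aemeasurable f.continuous.measurable.aestronglyMeasurable]
  exact integral_hurwitzSU n f.continuous

theorem measurePreserving_hurwitzTorus (n : ℕ) :
    MeasurePreserving (hurwitzTorus n) (torusMeasure n) ((haarSU (n + 2)).map
      (fun V : specialUnitaryGroup (Fin (n + 2)) ℂ => (V : Matrix (Fin (n + 2)) (Fin (n + 2)) ℂ))) := by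
  refine ⟨(continuous_hurwitzTorus n).measurable, ?_⟩
  rw [← map_hurwitzSU, Measure.map_map measurable_subtype_coe (continuous_hurwitzSU n).measurable]
  rfl

/-- The image of the closed cube is compact and has full Haar measure. Its complement is open and
null, hence empty, since Haar measure charges nonempty open sets. Periodicity brings the angles back
to the half-open cube. -/
theorem image_hurwitzTorus (n : ℕ) :
    hurwitzTorus n '' (Set.univ.pi fun _ => Set.Ico (0 : ℝ) (2 * Real.pi)) =
      (specialUnitaryGroup (Fin (n + 2)) ℂ : Set (Matrix (Fin (n + 2)) (Fin (n + 2)) ℂ)) := by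
  refine Set.Subset.antisymm ?_ fun g hg => ?_
  · rintro _ ⟨x, -, rfl⟩
    exact hurwitzTorus_mem n x
  have hred : ∀ x : EulerIndex n → ℝ, ∃ y ∈ Set.univ.pi fun _ => Set.Ico (0 : ℝ) (2 * Real.pi),
      hurwitzTorus n y = hurwitzTorus n x := by
    intro x
    refine ⟨fun i => angleMod (x i), fun i _ => angleMod_mem _, ?_⟩
    rw [← hurwitzTorus_add_int n (fun i => angleMod (x i))
      fun i => toIcoDiv Real.two_pi_pos 0 (x i)]
    congr 1
    funext i
    have := toIcoMod_add_toIcoDiv_zsmul Real.two_pi_pos 0 (x i)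
    rwa [zsmul_eq_mul] at this
  let K : Set (EulerIndex n → ℝ) := Set.univ.pi fun _ => Set.Icc (0 : ℝ) (2 * Real.pi)
  have hK : IsCompact K := isCompact_univ_pi fun _ => isCompact_Icc
  have hC : IsClosed (hurwitzSU n '' K) := (hK.image (continuous_hurwitzSU n)).isClosed
  have hsub : Set.range (hurwitzSU n) ⊆ hurwitzSU n '' K := by
    rintro _ ⟨x, rfl⟩
    obtain ⟨y, hy, hyx⟩ := hred x
    exact ⟨y, fun i hi => Set.Ico_subset_Icc_self (hy i hi), Subtype.ext hyx⟩
  have hzero : haarSU (n + 2) (hurwitzSU n '' K)ᶜ = 0 := by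
    rw [← map_hurwitzSU, Measure.map_apply (continuous_hurwitzSU n).measurable
      hC.measurableSet.compl]
    have : hurwitzSU n ⁻¹' (hurwitzSU n '' K)ᶜ = ∅ := by
      ext x
      simpa using hsub ⟨x, rfl⟩
    rw [this, measure_empty]
  have hempty : (hurwitzSU n '' K)ᶜ = ∅ := (hC.isOpen_compl.measure_eq_zero_iff _).1 hzero
  have hmem : (⟨g, hg⟩ : specialUnitaryGroup (Fin (n + 2)) ℂ) ∈ hurwitzSU n '' K := by
    rw [Set.compl_empty_iff.1 hempty]; trivial
  obtain ⟨x, -, hx⟩ := hmem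
  obtain ⟨y, hy, hyx⟩ := hred x
  exact ⟨y, hy, hyx.trans (congrArg Subtype.val hx)⟩

/-! ### Integrability of the derivatives of the angle functions -/

theorem locallyIntegrable_of_intervalIntegrable {E : Type*} [NormedAddCommGroup E] {f : ℝ → E}
    (hf : ∀ a b, IntervalIntegrable f volume a b) : LocallyIntegrable f volume := by
  refine locallyIntegrable_iff.2 fun k hk => ?_
  obtain ⟨R, hR⟩ := hk.isBounded.subset_closedBall 0
  rw [Real.closedBall_eq_Icc] at hR
  rcases le_or_gt (0 - R) (0 + R) with h | h
  · exact (((intervalIntegrable_iff_integrableOn_Icc_of_le h).1 (hf _ _))).mono_set hR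
  · rw [Set.Icc_eq_empty h.not_ge] at hR
    exact integrableOn_empty.mono_set hR

/-- Monotone functions have integrable derivatives, and `g ∘ cos` is monotone on each half period.
No bound on the derivative is needed. -/
theorem intervalIntegrable_deriv_comp_cos {g : ℝ → ℝ} (hg : Monotone g) (a b : ℝ) :
    IntervalIntegrable (deriv fun θ => g (Real.cos θ)) volume a b := by
  have hper : Function.Periodic (deriv fun θ => g (Real.cos θ)) (2 * Real.pi) := by
    intro θ
    rw [← deriv_comp_add_const]
    simp only [Real.cos_add_two_pi]
  refine hper.intervalIntegrable Real.two_pi_pos.ne' (t := -Real.pi) ?_ a b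
  rw [show -Real.pi + 2 * Real.pi = Real.pi by ring]
  have hπ := Real.pi_pos.le
  refine IntervalIntegrable.trans (b := 0) ?_ ?_
  · refine MonotoneOn.intervalIntegrable_deriv ?_
    rw [uIcc_of_le (by linarith)]
    intro x hx y hy hxy
    refine hg ?_
    rw [← Real.cos_neg x, ← Real.cos_neg y]
    exact Real.antitoneOn_cos ⟨by linarith [hy.2], by linarith [hy.1]⟩
      ⟨by linarith [hx.2], by linarith [hx.1]⟩ (by linarith)
  · have h : MonotoneOn (fun θ => -g (Real.cos θ)) (uIcc 0 Real.pi) := by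
      rw [uIcc_of_le hπ]
      intro x hx y hy hxy
      exact neg_le_neg (hg (Real.antitoneOn_cos hx hy hxy))
    have h' := h.intervalIntegrable_deriv.neg
    refine h'.congr fun x _ => ?_
    simp

/-- Both `sin ξ_r` and `-cos ξ_r` are nondecreasing functions of `cos θ`. -/
theorem intervalIntegrable_deriv_sin_xiOf (r : ℕ) (a b : ℝ) :
    IntervalIntegrable (deriv fun θ => Real.sin (xiOf r θ)) volume a b ∧
      IntervalIntegrable (deriv fun θ => Real.cos (xiOf r θ)) volume a b := by
  have hp : (0 : ℝ) ≤ 1 / (2 * (r : ℝ)) := by positivity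
  let g : ℝ → ℝ := fun c => (Real.arccos (-c) / Real.pi) ^ (1 / (2 * (r : ℝ)))
  have hg0 : ∀ c, 0 ≤ g c := fun c =>
    Real.rpow_nonneg (div_nonneg (Real.arccos_nonneg _) Real.pi_pos.le) _
  have hg1 : ∀ c, g c ≤ 1 := fun c =>
    Real.rpow_le_one (div_nonneg (Real.arccos_nonneg _) Real.pi_pos.le)
      ((div_le_one Real.pi_pos).2 (Real.arccos_le_pi _)) hp
  have hg : Monotone g := fun x y hxy =>
    Real.rpow_le_rpow (div_nonneg (Real.arccos_nonneg _) Real.pi_pos.le)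
      (div_le_div_of_nonneg_right (Real.arccos_le_arccos (neg_le_neg hxy)) Real.pi_pos.le) hp
  have hs : ∀ θ, Real.sin (xiOf r θ) = g (Real.cos θ) := fun θ => by
    rw [xiOf_eq, Real.sin_arcsin (by linarith [hg0 (Real.cos θ)]) (hg1 (Real.cos θ))]
  refine ⟨?_, ?_⟩
  · simp only [hs]
    exact intervalIntegrable_deriv_comp_cos hg a b
  · have hm : Monotone fun c => -Real.sqrt (1 - g c ^ 2) := fun x y hxy =>
      neg_le_neg (Real.sqrt_le_sqrt (by nlinarith [hg hxy, hg0 x]))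
    refine (intervalIntegrable_deriv_comp_cos hm a b).neg.congr fun x _ => ?_
    simp [cos_xiOf, hs]

theorem locallyIntegrable_deriv_comp_affine {h : ℝ → ℝ}
    (hh : ∀ a b, IntervalIntegrable (deriv h) volume a b) {w : ℝ} (hw : w ≠ 0) (c : ℝ) :
    LocallyIntegrable (deriv fun t => h (t * w + c)) volume := by
  refine locallyIntegrable_of_intervalIntegrable fun a b => ?_
  have h1 : (deriv fun t => h (t * w + c)) = fun t => w * deriv h (t * w + c) := by
    funext t
    have h2 := deriv_comp_mul_left w (fun u => h (u + c)) t
    simp only [mul_comm w, smul_eq_mul] at h2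
    rw [h2, deriv_comp_add_const, mul_comm]
  rw [h1]
  refine IntervalIntegrable.const_mul ?_ w
  have h3 := (hh (a * w + c) (b * w + c)).comp_add_right c
  simp only [add_sub_cancel_right] at h3
  have h4 := h3.comp_mul_right (c := w)
  simpa [hw] using h4

/-! ### The algebra of regular functions -/

section Regular

variable {m : ℕ} (ω : Fin m → ℝ) (S : Set (Fin m → ℝ))

/-- Continuous, smooth off `S`, and absolutely continuous along the line `t ↦ t ω`. -/
structure IsRegular (f : (Fin m → ℝ) → ℂ) : Prop where
  continuous : Continuous f
  contDiffOn : ContDiffOn ℝ ((⊤ : ℕ∞) : WithTop ℕ∞) f Sᶜ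
  locallyIntegrable : LocallyIntegrable (deriv fun t : ℝ => f (t • ω)) volume

variable {ω S}

theorem IsRegular.differentiableAt {f : (Fin m → ℝ) → ℂ} (hS : IsClosed S) (hf : IsRegular ω S f)
    {θ : Fin m → ℝ} (hθ : θ ∉ S) : DifferentiableAt ℝ f θ :=
  (hf.contDiffOn.contDiffAt (hS.isOpen_compl.mem_nhds hθ)).differentiableAt (by simp)

theorem IsRegular.differentiableAt_line {f : (Fin m → ℝ) → ℂ} (hS : IsClosed S)
    (hf : IsRegular ω S f) {t : ℝ} (ht : t • ω ∉ S) :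
    DifferentiableAt ℝ (fun t : ℝ => f (t • ω)) t :=
  DifferentiableAt.comp (g := f) (f := fun t : ℝ => t • ω) t (hf.differentiableAt hS ht)
    (by fun_prop)

theorem ae_line_notMem (hc : {t : ℝ | t • ω ∈ S}.Countable) : ∀ᵐ t : ℝ, t • ω ∉ S := by
  have := hc.measure_zero volume
  rwa [measure_eq_zero_iff_ae_notMem] at this

variable (ω S) in
/-- The regular functions form an algebra. -/
def regularAlgebra (hS : IsClosed S) (hc : {t : ℝ | t • ω ∈ S}.Countable) :
    Subalgebra ℂ ((Fin m → ℝ) → ℂ) where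
  carrier := {f | IsRegular ω S f}
  mul_mem' := by
    intro f g hf hg
    refine ⟨hf.1.mul hg.1, hf.2.mul hg.2, ?_⟩
    have hl : Continuous fun t : ℝ => t • ω := by fun_prop
    -- The product rule holds almost everywhere, because the line meets `S` only countably often.
    -- Multiplication by continuous functions preserves local integrability.
    refine ((hf.3.mul_continuous (hg.1.comp hl)).add (hg.3.continuous_mul (hf.1.comp hl))).congr ?_
    filter_upwards [ae_line_notMem hc] with t ht
    exact (deriv_fun_mul (hf.differentiableAt_line hS ht) (hg.differentiableAt_line hS ht)).symm
  add_mem' := by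
    intro f g hf hg
    refine ⟨hf.1.add hg.1, hf.2.add hg.2, (hf.3.add hg.3).congr ?_⟩
    filter_upwards [ae_line_notMem hc] with t ht
    exact (deriv_fun_add (hf.differentiableAt_line hS ht) (hg.differentiableAt_line hS ht)).symm
  algebraMap_mem' := by
    intro z
    refine ⟨continuous_const, contDiffOn_const, ?_⟩
    have : (deriv fun t : ℝ => (algebraMap ℂ ((Fin m → ℝ) → ℂ) z) (t • ω)) = fun _ => 0 := by
      funext t
      simp
    rw [this]
    exact locallyIntegrable_const 0

theorem isRegular_of_contDiff {f : (Fin m → ℝ) → ℂ} (hf : ContDiff ℝ ((⊤ : ℕ∞) : WithTop ℕ∞) f) :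
    IsRegular ω S f := by
  refine ⟨hf.continuous, hf.contDiffOn, Continuous.locallyIntegrable ?_⟩
  have h : ContDiff ℝ ((⊤ : ℕ∞) : WithTop ℕ∞) fun t : ℝ => f (t • ω) :=
    hf.comp (by fun_prop)
  exact h.continuous_deriv (by simp)

theorem isRegular_ofReal_comp (hc : {t : ℝ | t • ω ∈ S}.Countable)
    {h : ℝ → ℝ} (hh : Continuous h) (hi : ∀ a b, IntervalIntegrable (deriv h) volume a b)
    {j : Fin m} (hj : ω j ≠ 0) (c : ℝ)
    (hd : ∀ θ ∉ S, ContDiffAt ℝ ((⊤ : ℕ∞) : WithTop ℕ∞) h (θ j + c)) :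
    IsRegular ω S fun θ => (h (θ j + c) : ℂ) := by
  have hcd : ∀ θ ∉ S, ContDiffAt ℝ ((⊤ : ℕ∞) : WithTop ℕ∞) (fun θ : Fin m → ℝ => h (θ j + c)) θ :=
    fun θ hθ => ContDiffAt.comp (g := h) (f := fun θ : Fin m → ℝ => θ j + c) θ (hd θ hθ)
      (by fun_prop)
  refine ⟨by fun_prop, fun θ hθ => ContDiffAt.contDiffWithinAt ?_, ?_⟩
  · exact Complex.ofRealCLM.contDiff.contDiffAt.comp (g := Complex.ofRealCLM)
      (f := fun θ : Fin m → ℝ => h (θ j + c)) θ (hcd θ hθ)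
  · have h1 := locallyIntegrable_deriv_comp_affine hi hj c
    have h2 : LocallyIntegrable (fun t => ((deriv (fun t => h (t * ω j + c)) t : ℝ) : ℂ)) volume := by
      refine locallyIntegrable_iff.2 fun k hk => ?_
      exact (locallyIntegrable_iff.1 h1 k hk).ofReal
    refine h2.congr ?_
    filter_upwards [ae_line_notMem hc] with t ht
    have h3 : DifferentiableAt ℝ (fun t => h (t * ω j + c)) t :=
      DifferentiableAt.comp (g := h) (f := fun t : ℝ => t * ω j + c) t
        ((hd _ ht).differentiableAt (by simp)) (by fun_prop)
    exact (h3.hasDerivAt.ofReal_comp.deriv).symm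

end Regular

/-! ### Entrywise derivatives of matrix-valued paths -/

/-- Entrywise differentiability of a path of matrices. -/
def HasMatrixDerivAt {ι κ : Type*} (F : ℝ → Matrix ι κ ℂ) (F' : Matrix ι κ ℂ) (t : ℝ) : Prop :=
  ∀ a b, HasDerivAt (fun τ => F τ a b) (F' a b) t

namespace HasMatrixDerivAt

variable {ι κ l : Type*} {F : ℝ → Matrix ι κ ℂ} {F' : Matrix ι κ ℂ} {t : ℝ}

theorem mul [Fintype κ] {G : ℝ → Matrix κ l ℂ} {G' : Matrix κ l ℂ}
    (hF : HasMatrixDerivAt F F' t) (hG : HasMatrixDerivAt G G' t) :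
    HasMatrixDerivAt (fun τ => F τ * G τ) (F' * G t + F t * G') t := by
  intro a b
  have h := HasDerivAt.fun_sum (u := Finset.univ) fun c _ => (hF a c).mul (hG c b)
  simpa [Matrix.mul_apply, Finset.sum_add_distrib] using h

theorem const (M : Matrix ι κ ℂ) : HasMatrixDerivAt (fun _ => M) 0 t :=
  fun a b => hasDerivAt_const t (M a b)

theorem conjTranspose (hF : HasMatrixDerivAt F F' t) :
    HasMatrixDerivAt (fun τ => (F τ)ᴴ) F'ᴴ t :=
  fun a b => (hF b a).star

theorem unique {F'' : Matrix ι κ ℂ} (hF : HasMatrixDerivAt F F' t)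
    (hF' : HasMatrixDerivAt F F'' t) : F' = F'' :=
  Matrix.ext fun a b => (hF a b).unique (hF' a b)

end HasMatrixDerivAt

/-! ### The Floquet factor `exp(-iQt)` -/

section FloquetFactor

variable {d : ℕ} (W : Matrix (Fin d) (Fin d) ℂ) (q : Fin d → ℝ)

/-- The diagonal matrix `exp(-i diag(q) t)`. -/
def diagEvolution (t : ℝ) : Matrix (Fin d) (Fin d) ℂ :=
  diagonal fun α => Complex.exp (-(Complex.I * (q α * t : ℝ)))

/-- The one-parameter group generated by `W diag(q) W†`. -/
def floquetFactor (t : ℝ) : Matrix (Fin d) (Fin d) ℂ := W * diagEvolution q t * Wᴴ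

theorem conj_exp_neg_I_mul_ofReal (x : ℝ) :
    (starRingEnd ℂ) (Complex.exp (-(Complex.I * (x : ℝ)))) = Complex.exp (Complex.I * x) := by
  rw [← Complex.exp_conj]
  simp

theorem diagEvolution_mem (t : ℝ) : diagEvolution q t ∈ unitaryGroup (Fin d) ℂ := by
  rw [mem_unitaryGroup_iff, star_eq_conjTranspose, diagEvolution, diagonal_conjTranspose,
    diagonal_mul_diagonal, ← diagonal_one]
  congr 1
  funext α
  rw [Pi.star_apply, RCLike.star_def, conj_exp_neg_I_mul_ofReal, ← Complex.exp_add]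
  simp

theorem det_diagEvolution (hq : ∑ α, q α = 0) (t : ℝ) : (diagEvolution q t).det = 1 := by
  rw [diagEvolution, det_diagonal, ← Complex.exp_sum, Finset.sum_neg_distrib, ← Finset.mul_sum,
    ← Complex.ofReal_sum, ← Finset.sum_mul, hq]
  simp

theorem hasMatrixDerivAt_diagEvolution (t : ℝ) :
    HasMatrixDerivAt (diagEvolution q)
      (-Complex.I • (diagonal (fun α => (q α : ℂ)) * diagEvolution q t)) t := by
  intro a b
  by_cases h : a = b
  · subst h
    have h1 : HasDerivAt (fun τ : ℝ => -(Complex.I * (q a * τ : ℝ))) (-(Complex.I * (q a : ℂ))) t := by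
      have := (((hasDerivAt_id t).const_mul (q a)).ofReal_comp.const_mul Complex.I).fun_neg
      simpa using this
    have h2 := h1.cexp
    simp only [diagEvolution, diagonal_apply_eq, diagonal_mul_diagonal, Matrix.smul_apply, smul_eq_mul]
    convert h2 using 1
    ring
  · simp only [diagEvolution, diagonal_apply_ne _ h, diagonal_mul_diagonal, Matrix.smul_apply, smul_zero]
    exact hasDerivAt_const t (0 : ℂ)

variable {W}

theorem conjTranspose_mul_self (hW : W ∈ unitaryGroup (Fin d) ℂ) : Wᴴ * W = 1 :=
  mem_unitaryGroup_iff'.1 hW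

theorem mul_conjTranspose_self (hW : W ∈ unitaryGroup (Fin d) ℂ) : W * Wᴴ = 1 :=
  mem_unitaryGroup_iff.1 hW

theorem floquetFactor_mem (hW : W ∈ unitaryGroup (Fin d) ℂ) (hq : ∑ α, q α = 0) (t : ℝ) :
    floquetFactor W q t ∈ specialUnitaryGroup (Fin d) ℂ := by
  refine mem_specialUnitaryGroup_iff.2 ⟨mul_mem (mul_mem hW (diagEvolution_mem q t))
    (Unitary.star_mem hW), ?_⟩
  rw [floquetFactor, det_mul, det_mul, det_diagEvolution q hq, mul_one, ← det_mul,
    mul_conjTranspose_self hW, det_one]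

theorem floquetFactor_zero (hW : W ∈ unitaryGroup (Fin d) ℂ) : floquetFactor W q 0 = 1 := by
  have : diagEvolution q 0 = 1 := by
    rw [diagEvolution, ← diagonal_one]
    simp
  rw [floquetFactor, this, mul_one, mul_conjTranspose_self hW]

theorem hasMatrixDerivAt_floquetFactor (hW : W ∈ unitaryGroup (Fin d) ℂ) (t : ℝ) :
    HasMatrixDerivAt (floquetFactor W q) (-Complex.I •
      (W * diagonal (fun α => (q α : ℂ)) * Wᴴ * floquetFactor W q t)) t := by
  have h := ((HasMatrixDerivAt.const W).mul (hasMatrixDerivAt_diagEvolution q t)).mul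
    (HasMatrixDerivAt.const Wᴴ)
  have e : W * diagonal (fun α => (q α : ℂ)) * Wᴴ * floquetFactor W q t =
      W * diagonal (fun α => (q α : ℂ)) * diagEvolution q t * Wᴴ := by
    rw [floquetFactor, Matrix.mul_assoc _ Wᴴ, ← Matrix.mul_assoc Wᴴ, ← Matrix.mul_assoc Wᴴ,
      conjTranspose_mul_self hW, one_mul]
    simp only [Matrix.mul_assoc]
  rw [e, show floquetFactor W q = fun τ => W * diagEvolution q τ * Wᴴ from rfl]
  simpa [Matrix.mul_assoc] using h

theorem exp_smul_conj_diagonal (hW : W ∈ unitaryGroup (Fin d) ℂ) (t : ℝ) :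
    NormedSpace.exp ((-(Complex.I * (t : ℂ))) • (W * diagonal (fun α => (q α : ℂ)) * Wᴴ)) =
      floquetFactor W q t := by
  have hinv : W⁻¹ = Wᴴ := Matrix.inv_eq_right_inv (mul_conjTranspose_self hW)
  have hu : IsUnit W := IsUnit.of_mul_eq_one _ (mul_conjTranspose_self hW)
  rw [← hinv, ← Matrix.smul_mul, ← Matrix.mul_smul, Matrix.exp_conj W _ hu, ← diagonal_smul,
    Matrix.exp_diagonal, floquetFactor, hinv, diagEvolution]
  congr 3
  funext α
  rw [Pi.coe_exp, ← Complex.exp_eq_exp_ℂ]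
  simp only [Pi.smul_apply, smul_eq_mul]
  congr 1
  push_cast
  ring

theorem floquetFactor_mulVec_col (hW : W ∈ unitaryGroup (Fin d) ℂ) (t : ℝ) (α : Fin d) :
    floquetFactor W q t *ᵥ W.col α = Complex.exp (-(Complex.I * (q α * t : ℝ))) • W.col α := by
  rw [← Matrix.mulVec_single_one, Matrix.mulVec_mulVec, floquetFactor, Matrix.mul_assoc,
    conjTranspose_mul_self hW, mul_one, ← Matrix.mulVec_mulVec, diagEvolution]
  rw [show diagonal (fun α => Complex.exp (-(Complex.I * (q α * t : ℝ)))) *ᵥ Pi.single α 1 =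
    Complex.exp (-(Complex.I * (q α * t : ℝ))) • Pi.single α (1 : ℂ) by
      rw [diagonal_mulVec_single, ← Pi.single_smul, smul_eq_mul], Matrix.mulVec_smul]

theorem conj_diagonal_mulVec_col (hW : W ∈ unitaryGroup (Fin d) ℂ) (α : Fin d) :
    (W * diagonal (fun α => (q α : ℂ)) * Wᴴ) *ᵥ W.col α = (q α : ℂ) • W.col α := by
  rw [← Matrix.mulVec_single_one, Matrix.mulVec_mulVec, Matrix.mul_assoc,
    conjTranspose_mul_self hW, mul_one, ← Matrix.mulVec_mulVec]
  rw [show diagonal (fun α => (q α : ℂ)) *ᵥ Pi.single α 1 = (q α : ℂ) • Pi.single α (1 : ℂ) by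
      rw [diagonal_mulVec_single, ← Pi.single_smul, smul_eq_mul], Matrix.mulVec_smul]

theorem isHermitian_conj_diagonal (W : Matrix (Fin d) (Fin d) ℂ) :
    (W * diagonal (fun α => (q α : ℂ)) * Wᴴ).IsHermitian := by
  unfold Matrix.IsHermitian
  rw [conjTranspose_mul, conjTranspose_mul, conjTranspose_conjTranspose, diagonal_conjTranspose,
    Matrix.mul_assoc]
  congr 3
  funext α
  simp

end FloquetFactor

/-! ### Regular Floquet decompositions -/

section Regular

variable {m d : ℕ} {ω : Fin m → ℝ} {S : Set (Fin m → ℝ)}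

/-- The pieces need not be connected: one piece `Sᶜ` suffices, and the others are empty. -/
theorem piecewiseSmooth_of_contDiffOn (hS : IsClosed S) (hS0 : volume S = 0)
    {F : (Fin m → ℝ) → Matrix (Fin d) (Fin d) ℂ}
    (hF : ∀ a b, ContDiffOn ℝ ((⊤ : ℕ∞) : WithTop ℕ∞) (fun θ => F θ a b) Sᶜ) :
    PiecewiseSmooth F := by
  refine ⟨fun i => if i = 0 then Sᶜ else ∅, fun i => ?_, fun i j hij => ?_, ?_, fun i a b => ?_⟩
  · dsimp only
    split_ifs
    exacts [hS.isOpen_compl, isOpen_empty]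
  · rcases eq_or_ne i 0 with hi | hi
    · simp [Function.onFun, hi ▸ hij.symm]
    · simp [Function.onFun, hi]
  · refine measure_mono_null (fun θ hθ => ?_) hS0
    by_contra h
    exact hθ (mem_iUnion.2 ⟨0, by simpa using h⟩)
  · dsimp only
    split_ifs
    exacts [hF a b, contDiffOn_empty]

variable {P : (Fin m → ℝ) → Matrix (Fin d) (Fin d) ℂ}

/-- The derivative of a matrix-valued function in the direction `ω`. -/
def flowDeriv (ω : Fin m → ℝ) (P : (Fin m → ℝ) → Matrix (Fin d) (Fin d) ℂ) (θ : Fin m → ℝ) :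
    Matrix (Fin d) (Fin d) ℂ :=
  Matrix.of fun a b => lineDeriv ℝ (fun x => P x a b) θ ω

theorem hasMatrixDerivAt_flow (hS : IsClosed S) (hc : {t : ℝ | t • ω ∈ S}.Countable)
    (hP : EntriesIn (regularAlgebra ω S hS hc) P)
    (θ : Fin m → ℝ) {t : ℝ} (ht : θ + t • ω ∉ S) :
    HasMatrixDerivAt (fun τ => P (θ + τ • ω)) (flowDeriv ω P (θ + t • ω)) t := by
  intro a b
  have hd := IsRegular.differentiableAt hS (hP a b) ht
  have h1 : HasDerivAt (fun τ : ℝ => θ + τ • ω) ω t := by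
    simpa using ((hasDerivAt_id t).smul_const ω).const_add θ
  have h2 := hd.hasFDerivAt.comp_hasDerivAt t h1
  simpa [flowDeriv, hd.lineDeriv_eq_fderiv, Function.comp_def] using h2

/-- This is the derivative of `P Pᴴ = 1` along the flow. It makes the term `i (∂P) Pᴴ` of the parent
Hamiltonian Hermitian. -/
theorem flowDeriv_mul_conjTranspose (hS : IsClosed S) (hc : {t : ℝ | t • ω ∈ S}.Countable)
    (hP : EntriesIn (regularAlgebra ω S hS hc) P)
    (hu : ∀ θ, P θ ∈ unitaryGroup (Fin d) ℂ) {θ : Fin m → ℝ}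
    (hθ : θ ∉ S) : flowDeriv ω P θ * (P θ)ᴴ + P θ * (flowDeriv ω P θ)ᴴ = 0 := by
  have h := hasMatrixDerivAt_flow hS hc hP θ (t := 0) (by simpa using hθ)
  have h1 := h.mul h.conjTranspose
  simp only [mul_conjTranspose_self (hu _), zero_smul, add_zero] at h1
  exact h1.unique (HasMatrixDerivAt.const 1)

theorem contDiffOn_flowDeriv (hS : IsClosed S) (hc : {t : ℝ | t • ω ∈ S}.Countable)
    (hP : EntriesIn (regularAlgebra ω S hS hc) P)
    (a b : Fin d) :
    ContDiffOn ℝ ((⊤ : ℕ∞) : WithTop ℕ∞) (fun θ => flowDeriv ω P θ a b) Sᶜ := by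
  have h1 := ((hP a b).contDiffOn.fderiv_of_isOpen hS.isOpen_compl
    (m := ((⊤ : ℕ∞) : WithTop ℕ∞)) (by simp)).clm_apply (contDiffOn_const (c := ω))
  refine h1.congr fun θ hθ => ?_
  exact (IsRegular.differentiableAt hS (hP a b) hθ).lineDeriv_eq_fderiv

theorem parentHamiltonian_of_notMem {Q : Matrix (Fin d) (Fin d) ℂ} {θ : Fin m → ℝ} (hθ : θ ∉ S) :
    parentHamiltonian ω S P Q θ =
      Complex.I • (flowDeriv ω P θ * (P θ)ᴴ) + P θ * Q * (P θ)ᴴ := by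
  rw [parentHamiltonian, if_neg hθ, flowDeriv]

theorem isHermitian_parentHamiltonian (hS : IsClosed S) (hc : {t : ℝ | t • ω ∈ S}.Countable)
    (hP : EntriesIn (regularAlgebra ω S hS hc) P)
    (hu : ∀ θ, P θ ∈ unitaryGroup (Fin d) ℂ)
    {Q : Matrix (Fin d) (Fin d) ℂ} (hQ : Q.IsHermitian) (θ : Fin m → ℝ) :
    (parentHamiltonian ω S P Q θ).IsHermitian := by
  by_cases hθ : θ ∈ S
  · rw [parentHamiltonian, if_pos hθ]
    exact isHermitian_zero
  · rw [parentHamiltonian_of_notMem hθ]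
    refine IsHermitian.add ?_ (isHermitian_mul_mul_conjTranspose _ hQ)
    have h := flowDeriv_mul_conjTranspose hS hc hP hu hθ
    unfold Matrix.IsHermitian
    rw [conjTranspose_smul, conjTranspose_mul, conjTranspose_conjTranspose,
      eq_neg_of_add_eq_zero_right h]
    simp

theorem contDiffOn_parentHamiltonian (hS : IsClosed S) (hc : {t : ℝ | t • ω ∈ S}.Countable)
    (hP : EntriesIn (regularAlgebra ω S hS hc) P)
    (Q : Matrix (Fin d) (Fin d) ℂ) (a b : Fin d) :
    ContDiffOn ℝ ((⊤ : ℕ∞) : WithTop ℕ∞) (fun θ => parentHamiltonian ω S P Q θ a b) Sᶜ := by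
  have hD := contDiffOn_flowDeriv hS hc hP
  have hP1 := fun a b => (hP a b).contDiffOn
  have hP2 : ∀ a b, ContDiffOn ℝ ((⊤ : ℕ∞) : WithTop ℕ∞) (fun θ => (P θ)ᴴ a b) Sᶜ := fun a b =>
    Complex.conjCLE.contDiff.comp_contDiffOn (hP1 b a)
  have hmul : ∀ {F G : (Fin m → ℝ) → Matrix (Fin d) (Fin d) ℂ},
      (∀ a b, ContDiffOn ℝ ((⊤ : ℕ∞) : WithTop ℕ∞) (fun θ => F θ a b) Sᶜ) →
      (∀ a b, ContDiffOn ℝ ((⊤ : ℕ∞) : WithTop ℕ∞) (fun θ => G θ a b) Sᶜ) →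
      ∀ a b, ContDiffOn ℝ ((⊤ : ℕ∞) : WithTop ℕ∞) (fun θ => (F θ * G θ) a b) Sᶜ := by
    intro F G hF hG a b
    simp only [Matrix.mul_apply]
    exact ContDiffOn.sum fun c _ => (hF a c).mul (hG c b)
  have h1 := ((hmul hD hP2 a b).const_smul Complex.I).add
    (hmul (hmul hP1 fun a b => contDiffOn_const (c := Q a b)) hP2 a b)
  refine h1.congr fun θ hθ => ?_
  rw [parentHamiltonian_of_notMem hθ]
  rfl

/-- Off the countably many singular times the entries are locally integrable derivatives of `P`
along the line times continuous functions, plus a continuous term. -/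
theorem locallyIntegrable_parentHamiltonian (hS : IsClosed S) (hc : {t : ℝ | t • ω ∈ S}.Countable)
    (hP : EntriesIn (regularAlgebra ω S hS hc) P)
    (Q : Matrix (Fin d) (Fin d) ℂ) (a b : Fin d) :
    LocallyIntegrable (fun t : ℝ => parentHamiltonian ω S P Q (t • ω) a b) volume := by
  have hl : Continuous fun t : ℝ => t • ω := by fun_prop
  have hPc : ∀ a b, Continuous fun t : ℝ => P (t • ω) a b := fun a b => (hP a b).continuous.comp hl
  have h1 : LocallyIntegrable (fun t : ℝ => ∑ c, deriv (fun τ : ℝ => P (τ • ω) a c) t *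
      star (P (t • ω) b c)) volume :=
    locallyIntegrable_finsetSum _ fun c _ =>
      (hP a c).locallyIntegrable.mul_continuous (hPc b c).star
  have h2 : Continuous fun t : ℝ => (P (t • ω) * Q * (P (t • ω))ᴴ) a b := by
    simp only [Matrix.mul_apply, conjTranspose_apply]
    exact continuous_finsetSum _ fun j _ =>
      (continuous_finsetSum _ fun i _ => (hPc a i).mul continuous_const).mul (hPc b j).star
  refine ((h1.smul Complex.I).add h2.locallyIntegrable).congr ?_
  filter_upwards [ae_line_notMem hc] with t ht
  have h3 := hasMatrixDerivAt_flow hS hc hP 0 (t := t) (by simpa using ht)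
  simp only [zero_add] at h3
  rw [parentHamiltonian_of_notMem ht]
  simp [Matrix.mul_apply, fun a b => (h3 a b).deriv]

theorem flowDeriv_periodic (hper : TorusPeriodic P) : TorusPeriodic (flowDeriv ω P) := by
  intro θ k
  ext a b
  simp only [flowDeriv, of_apply, lineDeriv]
  congr 1
  funext t
  rw [← hper (θ + t • ω) k]
  have : (fun j => θ j + k j * (2 * Real.pi)) + t • ω =
      fun j => (θ + t • ω) j + k j * (2 * Real.pi) := by
    funext j
    simp only [Pi.add_apply]
    ring
  rw [this]

theorem parentHamiltonian_periodic (hper : TorusPeriodic P) (Q : Matrix (Fin d) (Fin d) ℂ)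
    (hSper : TorusPeriodic fun θ => θ ∈ S) : TorusPeriodic (parentHamiltonian ω S P Q) := by
  intro θ k
  have h1 : (fun j => θ j + k j * (2 * Real.pi)) ∈ S ↔ θ ∈ S := (hSper θ k).to_iff
  by_cases hθ : θ ∈ S
  · rw [parentHamiltonian, parentHamiltonian, if_pos hθ, if_pos (h1.2 hθ)]
  · rw [parentHamiltonian_of_notMem hθ, parentHamiltonian_of_notMem (fun h => hθ (h1.1 h)),
      flowDeriv_periodic hper θ k, hper θ k]

end Regular

/-! ### Ergodicity from equidistribution up to a phase -/

section Ergodic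

variable {d : ℕ}

/-- Time averages of continuous phase-invariant functions of `U` are Haar averages. -/
def EquidistributesModPhase (U : ℝ → Matrix (Fin d) (Fin d) ℂ) : Prop :=
  ∀ F : Matrix (Fin d) (Fin d) ℂ → ℂ, Continuous F →
    (∀ (z : ℂ) (M : Matrix (Fin d) (Fin d) ℂ), ‖z‖ = 1 → F (z • M) = F M) →
    HasTimeAverage (fun t => F (U t)) (∫ W : unitaryGroup (Fin d) ℂ, F W.1 ∂haarU d)

theorem continuous_channel : Continuous (channel (d := d)) := by
  refine continuous_matrix fun a b => ?_
  simp only [channel, kroneckerMap_apply, map_apply]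
  exact (Complex.continuous_conj.comp (continuous_id.matrix_elem _ _)).mul
    (continuous_id.matrix_elem _ _)

theorem conj_mul_self_of_norm_eq_one {z : ℂ} (hz : ‖z‖ = 1) : (starRingEnd ℂ) z * z = 1 := by
  rw [Complex.conj_mul', hz]
  simp

theorem channel_smul {z : ℂ} (hz : ‖z‖ = 1) (M : Matrix (Fin d) (Fin d) ℂ) :
    channel (z • M) = channel M := by
  ext a b
  simp only [channel, kroneckerMap_apply, map_apply, Matrix.smul_apply, smul_eq_mul, map_mul]
  linear_combination (starRingEnd ℂ) (M a.1 b.1) * M a.2 b.2 * conj_mul_self_of_norm_eq_one hz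

theorem smul_mul_mul_conjTranspose_smul {z : ℂ} (hz : ‖z‖ = 1) (M A : Matrix (Fin d) (Fin d) ℂ) :
    (z • M) * A * (z • M)ᴴ = M * A * Mᴴ := by
  rw [conjTranspose_smul, Matrix.smul_mul, Matrix.smul_mul, Matrix.mul_smul, smul_smul,
    RCLike.star_def, mul_comm z, conj_mul_self_of_norm_eq_one hz, one_smul]

theorem continuous_conj_apply (A : Matrix (Fin d) (Fin d) ℂ) :
    Continuous fun M : Matrix (Fin d) (Fin d) ℂ => M * A * Mᴴ :=
  (continuous_id.matrix_mul continuous_const).matrix_mul continuous_id.matrix_conjTranspose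

theorem continuous_tensorPow {ι : Type*} (k : ℕ) (a b : Fin k → ι) :
    Continuous fun M : Matrix ι ι ℂ => tensorPow k M a b := by
  simp only [tensorPow, of_apply]
  exact continuous_finsetProd _ fun i _ => continuous_id.matrix_elem _ _

/-- Two maps `G` and `G'` are allowed because, for states, the orbit starts at `ψ` while the uniform
ensemble is generated from a reference state `φ`. -/
theorem EquidistributesModPhase.temporalEnsembleHasLaw {U : ℝ → Matrix (Fin d) (Fin d) ℂ}
    (hU : EquidistributesModPhase U) {κ : Type*} [Fintype κ]
    {G G' : Matrix (Fin d) (Fin d) ℂ → Matrix κ κ ℂ}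
    (hG : Continuous G) (hG' : Continuous G')
    (hphase : ∀ (z : ℂ) (M : Matrix (Fin d) (Fin d) ℂ), ‖z‖ = 1 → G (z • M) = G M)
    (hGG' : ∀ f : Matrix κ κ ℂ → ℂ, Continuous f →
      ∫ W : unitaryGroup (Fin d) ℂ, f (G W.1) ∂haarU d =
        ∫ W : unitaryGroup (Fin d) ℂ, f (G' W.1) ∂haarU d) :
    TemporalEnsembleHasLaw (fun t => G (U t))
      ((haarU d).map fun V : unitaryGroup (Fin d) ℂ => G' (V : Matrix (Fin d) (Fin d) ℂ)) := by
  intro f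
  have h := hU (fun M => (f (G M) : ℂ)) (by fun_prop) fun z M hz => by rw [hphase z M hz]
  rw [hGG' (fun A => (f A : ℂ)) (by fun_prop)] at h
  have hm : Continuous fun V : unitaryGroup (Fin d) ℂ => G' (V : Matrix (Fin d) (Fin d) ℂ) :=
    hG'.comp continuous_subtype_val
  rw [integral_map hm.measurable.aemeasurable f.continuous.measurable.aestronglyMeasurable]
  unfold HasTimeAverage at h
  rw [integral_complex_ofReal] at h
  refine Tendsto.congr (fun T => ?_) ((Complex.continuous_re.tendsto _).comp h)
  simp only [Function.comp_apply]
  rw [intervalIntegral.integral_ofReal, ← Complex.ofReal_inv, ← Complex.ofReal_mul,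
    Complex.ofReal_re]

theorem EquidistributesModPhase.isCUE {U : ℝ → Matrix (Fin d) (Fin d) ℂ}
    (hU : EquidistributesModPhase U) : IsCUE U :=
  hU.temporalEnsembleHasLaw continuous_channel continuous_channel
    (fun _ M hz => channel_smul hz M) fun _ _ => rfl

theorem EquidistributesModPhase.isUE {U : ℝ → Matrix (Fin d) (Fin d) ℂ}
    (hU : EquidistributesModPhase U) (k : ℕ) : IsUE k U := fun a b =>
  hU (fun M => tensorPow k (channel M) a b) ((continuous_tensorPow k a b).comp continuous_channel)
    fun z M hz => by rw [channel_smul hz]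

/-- The unitary group acts transitively on unit vectors. -/
theorem exists_unitary_mulVec {ψ φ : Fin d → ℂ} (hψ : star ψ ⬝ᵥ ψ = 1) (hφ : star φ ⬝ᵥ φ = 1) :
    ∃ g ∈ unitaryGroup (Fin d) ℂ, ψ = g *ᵥ φ := by
  have key : ∀ χ : Fin d → ℂ, star χ ⬝ᵥ χ = 1 → ∀ i0 : Fin d,
      ∃ g ∈ unitaryGroup (Fin d) ℂ, g *ᵥ Pi.single i0 1 = χ := by
    intro χ hχ i0
    have hn : ‖(WithLp.toLp 2 χ : EuclideanSpace ℂ (Fin d))‖ = 1 := by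
      have h1 := EuclideanSpace.inner_eq_star_dotProduct (𝕜 := ℂ)
        (WithLp.toLp 2 χ : EuclideanSpace ℂ (Fin d)) (WithLp.toLp 2 χ)
      rw [dotProduct_comm] at h1
      have h2 : inner ℂ (WithLp.toLp 2 χ : EuclideanSpace ℂ (Fin d)) (WithLp.toLp 2 χ) = 1 :=
        h1.trans hχ
      rw [inner_self_eq_norm_sq_to_K] at h2
      have h3 : ‖(WithLp.toLp 2 χ : EuclideanSpace ℂ (Fin d))‖ ^ 2 = 1 :=
        RCLike.ofReal_injective (K := ℂ) (by push_cast; exact h2)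
      exact (pow_eq_one_iff_of_nonneg (norm_nonneg _) two_ne_zero).1 h3
    -- A single unit vector is completed to an orthonormal basis. The basis matrix is the required
    -- unitary.
    have ho : Orthonormal ℂ (Set.domRestrict {i0}
        (fun _ : Fin d => (WithLp.toLp 2 χ : EuclideanSpace ℂ (Fin d)))) := by
      refine ⟨fun _ => hn, fun i j hij => absurd (Subsingleton.elim i j) hij⟩
    obtain ⟨b, hb⟩ := ho.exists_orthonormalBasis_extension_of_card_eq (by simp)
    refine ⟨(EuclideanSpace.basisFun (Fin d) ℂ).toBasis.toMatrix b,
      (EuclideanSpace.basisFun (Fin d) ℂ).toMatrix_orthonormalBasis_mem_unitary b, ?_⟩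
    rw [Matrix.mulVec_single_one]
    funext i
    simp [Module.Basis.toMatrix_apply, hb i0 rfl]
  have hd : ∃ i0 : Fin d, True := by
    by_contra h
    have : IsEmpty (Fin d) := ⟨fun i => h ⟨i, trivial⟩⟩
    simp [dotProduct] at hψ
  obtain ⟨i0, -⟩ := hd
  obtain ⟨g, hg, rfl⟩ := key ψ hψ i0
  obtain ⟨h, hh, rfl⟩ := key φ hφ i0
  refine ⟨g * hᴴ, mul_mem hg (Unitary.star_mem hh), ?_⟩
  rw [Matrix.mulVec_mulVec, Matrix.mul_assoc, conjTranspose_mul_self hh, mul_one]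

theorem proj_mulVec (g : Matrix (Fin d) (Fin d) ℂ) (φ : Fin d → ℂ) :
    proj (g *ᵥ φ) = g * proj φ * gᴴ := by
  rw [proj, proj, Matrix.star_mulVec, Matrix.mul_vecMulVec, Matrix.vecMulVec_mul]

/-- With `ψ = g φ`, right invariance of the Haar measure absorbs `g`. -/
theorem integral_conj_proj_eq {ψ φ : Fin d → ℂ} (hψ : star ψ ⬝ᵥ ψ = 1) (hφ : star φ ⬝ᵥ φ = 1)
    (f : Matrix (Fin d) (Fin d) ℂ → ℂ) :
    ∫ W : unitaryGroup (Fin d) ℂ, f (W.1 * proj ψ * W.1ᴴ) ∂haarU d =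
      ∫ W : unitaryGroup (Fin d) ℂ, f (W.1 * proj φ * W.1ᴴ) ∂haarU d := by
  obtain ⟨g, hg, rfl⟩ := exists_unitary_mulVec hψ hφ
  rw [← integral_mul_right_eq_self (μ := haarU d)
    (fun W : unitaryGroup (Fin d) ℂ => f (W.1 * proj φ * W.1ᴴ)) ⟨g, hg⟩]
  congr 1
  funext W
  rw [proj_mulVec]
  simp only [Submonoid.coe_mul, conjTranspose_mul, Matrix.mul_assoc]

theorem EquidistributesModPhase.isCHSE {U : ℝ → Matrix (Fin d) (Fin d) ℂ}
    (hU : EquidistributesModPhase U) : IsCHSE U := fun ψ φ hψ hφ =>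
  hU.temporalEnsembleHasLaw (continuous_conj_apply (proj ψ)) (continuous_conj_apply (proj φ))
    (fun _ M hz => smul_mul_mul_conjTranspose_smul hz M _)
    fun f _ => integral_conj_proj_eq hψ hφ f

theorem EquidistributesModPhase.isHSE {U : ℝ → Matrix (Fin d) (Fin d) ℂ}
    (hU : EquidistributesModPhase U) (k : ℕ) : IsHSE k U := by
  intro ψ φ hψ hφ a b
  have h := hU (fun M => tensorPow k (M * proj ψ * Mᴴ) a b)
    ((continuous_tensorPow k a b).comp (continuous_conj_apply _))
    fun z M hz => by rw [smul_mul_mul_conjTranspose_smul hz]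
  rwa [integral_conj_proj_eq hψ hφ fun A => tensorPow k A a b] at h

end Ergodic

/-! ### Ergodic drives from regular Floquet decompositions -/

section Drive

variable {m d : ℕ} {ω : Fin m → ℝ} {S : Set (Fin m → ℝ)}
  {P : (Fin m → ℝ) → Matrix (Fin d) (Fin d) ℂ} {W : Matrix (Fin d) (Fin d) ℂ} {q : Fin d → ℝ}
  {U : ℝ → Matrix (Fin d) (Fin d) ℂ}

/-- The product rule gives `(∂P - i P Q) exp(-iQt)`, and substituting `exp(-iQt) = Pᴴ U` turns this
into `-i H U`. -/
theorem hasMatrixDerivAt_evolution (hS : IsClosed S) (hc : {t : ℝ | t • ω ∈ S}.Countable)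
    (hP : EntriesIn (regularAlgebra ω S hS hc) P) (hPu : ∀ θ, P θ ∈ unitaryGroup (Fin d) ℂ)
    (hW : W ∈ unitaryGroup (Fin d) ℂ) (hU : ∀ t : ℝ, U t = P (t • ω) * floquetFactor W q t)
    {t : ℝ} (ht : t • ω ∉ S) :
    HasMatrixDerivAt U (-Complex.I • (parentHamiltonian ω S P
      (W * diagonal (fun α => (q α : ℂ)) * Wᴴ) (t • ω) * U t)) t := by
  have h1 := hasMatrixDerivAt_flow hS hc hP 0 (t := t) (by simpa using ht)
  simp only [zero_add] at h1
  have h2 := h1.mul (hasMatrixDerivAt_floquetFactor q hW t)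
  rw [← funext hU] at h2
  have e : ∀ A : Matrix (Fin d) (Fin d) ℂ, A * (P (t • ω))ᴴ * U t = A * floquetFactor W q t := by
    intro A
    rw [hU, Matrix.mul_assoc, ← Matrix.mul_assoc _ (P (t • ω)), conjTranspose_mul_self (hPu _),
      one_mul]
  convert h2 using 1
  rw [parentHamiltonian_of_notMem ht, Matrix.add_mul, e, Matrix.smul_mul, e, smul_add, smul_smul]
  simp [Matrix.mul_assoc]

theorem isErgodicDrive_of_regular (hω : LinearIndependent ℤ ω) (hS : IsClosed S)
    (hS0 : volume S = 0) (hc : {t : ℝ | t • ω ∈ S}.Countable)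
    (hSper : TorusPeriodic fun θ => θ ∈ S) (hP : EntriesIn (regularAlgebra ω S hS hc) P)
    (hPper : TorusPeriodic P) (hPsu : ∀ θ, P θ ∈ specialUnitaryGroup (Fin d) ℂ) (hP0 : P 0 = 1)
    (hW : W ∈ unitaryGroup (Fin d) ℂ) (hq : ∑ α, q α = 0)
    (hU : ∀ t : ℝ, U t = P (t • ω) * floquetFactor W q t) (hE : EquidistributesModPhase U) :
    IsErgodicDrive ω S (parentHamiltonian ω S P (W * diagonal (fun α => (q α : ℂ)) * Wᴴ)) U P
      (W * diagonal (fun α => (q α : ℂ)) * Wᴴ) q := by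
  have hPu : ∀ θ, P θ ∈ unitaryGroup (Fin d) ℂ := fun θ =>
    (mem_specialUnitaryGroup_iff.1 (hPsu θ)).1
  have hUsu : ∀ t, U t ∈ specialUnitaryGroup (Fin d) ℂ := fun t => by
    rw [hU]
    exact mul_mem (hPsu _) (floquetFactor_mem q hW hq t)
  have hPc : Continuous P := continuous_matrix fun a b => (hP a b).continuous
  have hUc : Continuous U := by
    rw [funext hU]
    refine (hPc.comp (by fun_prop)).matrix_mul (continuous_matrix fun a b => ?_)
    exact continuous_iff_continuousAt.2 fun t =>
      (hasMatrixDerivAt_floquetFactor q hW t a b).continuousAt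
  have hU' := fun t ht => hasMatrixDerivAt_evolution hS hc hP hPu hW hU (t := t) ht
  have hHi := locallyIntegrable_parentHamiltonian hS hc hP
    (W * diagonal (fun α => (q α : ℂ)) * Wᴴ)
  refine ⟨hω, parentHamiltonian_periodic hPper _ hSper,
    piecewiseSmooth_of_contDiffOn hS hS0 (contDiffOn_parentHamiltonian hS hc hP _),
    isHermitian_parentHamiltonian hS hc hP hPu (isHermitian_conj_diagonal q W), hUsu,
    ⟨hHi, hUc, fun t a b => ?_⟩, fun t ht => ⟨fun a b => (hU' t ht a b).differentiableAt, ?_⟩,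
    ⟨hPper, hPc, piecewiseSmooth_of_contDiffOn hS hS0 fun a b => (hP a b).contDiffOn, hPu, hP0,
      isHermitian_conj_diagonal q W, fun t => by rw [hU, exp_smul_conj_diagonal q hW]⟩,
    ⟨W, hW, fun α => ⟨conj_diagonal_mulVec_col q hW α, fun t => ?_⟩⟩,
    hE.isCUE, hE.isUE, hE.isCHSE, hE.isHSE⟩
  · have hi : LocallyIntegrable (fun s => (parentHamiltonian ω S P
        (W * diagonal (fun α => (q α : ℂ)) * Wᴴ) (s • ω) * U s) a b) volume := by
      simp only [Matrix.mul_apply]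
      exact locallyIntegrable_finsetSum _ fun c _ =>
        (hHi a c).mul_continuous (hUc.matrix_elem c b)
    -- `U` is continuous and differentiable off a countable set, with locally integrable derivative.
    -- This suffices for the fundamental theorem of calculus, although `H` is unrestricted in size
    -- near the singular times.
    have h := integral_eq_of_hasDerivAt_off_countable (a := 0) (b := t)
      (fun τ => U τ a b) (fun τ => -Complex.I * (parentHamiltonian ω S P
        (W * diagonal (fun α => (q α : ℂ)) * Wᴴ) (τ • ω) * U τ) a b) hc
      (hUc.matrix_elem a b).continuousOn (fun x hx => hU' x hx.2 a b)
      ((intervalIntegrable_iff.2 ((hi.integrableOn_isCompact isCompact_uIcc).mono_set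
        uIoc_subset_uIcc)).const_mul _)
    rw [intervalIntegral.integral_const_mul] at h
    have h0 : U 0 = 1 := by rw [hU, zero_smul, hP0, floquetFactor_zero q hW, one_mul]
    rw [h0] at h
    linear_combination -h
  · have : (Matrix.of fun a b => deriv (fun τ => U τ a b) t) = -Complex.I • (parentHamiltonian ω S P
        (W * diagonal (fun α => (q α : ℂ)) * Wᴴ) (t • ω) * U t) :=
      Matrix.ext fun a b => (hU' t ht a b).deriv
    rw [this, Matrix.smul_mul, smul_smul, Matrix.mul_assoc (parentHamiltonian _ _ _ _ _),
      mul_conjTranspose_self (mem_specialUnitaryGroup_iff.1 (hUsu t)).1]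
    simp
  · rw [hU, ← Matrix.mulVec_mulVec, floquetFactor_mulVec_col q hW, Matrix.mulVec_smul]

end Drive

/-! ### The tones as affine functions of the Euler angles -/

theorem assignAngles_add_mul (n : ℕ) (y z : ToneIndex n → ℝ) (s r t : ℝ) :
    assignAngles n (fun i => y i * t + z i) (s * t + r) =
      fun i => assignAngles n z r i + assignAngles n y s i * t := by
  funext i
  rcases i with p | p | j
  · simp only [assignAngles, Sum.elim_inl]
    ring
  · simp only [assignAngles, Sum.elim_inl, Sum.elim_inr]
    split_ifs <;> ring
  · refine Fin.lastCases ?_ (fun j => ?_) j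
    · simp only [assignAngles, Sum.elim_inr, Fin.snoc_last]
      ring
    · simp only [assignAngles, Sum.elim_inr, Fin.snoc_castSucc]
      ring

theorem assignAngles_zero (n : ℕ) : assignAngles n (fun _ => 0) 0 = 0 := by
  -- At `t = -1` with all data zero, the affine formula reads `A = A - A`.
  have h := assignAngles_add_mul n (fun _ => 0) (fun _ => 0) 0 0 (-1)
  simp only [mul_neg, mul_one, neg_zero, add_zero] at h
  funext i
  have := congrFun h i
  simp only [Pi.zero_apply] at this ⊢
  linarith

/-- The integer multiples of `2π` by which the Euler angles change when the tones change by integer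
multiples of `2π`. -/
def assignShift (n : ℕ) (k : ToneIndex n → ℤ) : EulerIndex n → ℤ :=
  Sum.elim (fun p => k (Sum.inl p)) <| Sum.elim (fun p => k (Sum.inr (Sum.inl p)))
    (Fin.snoc (α := fun _ => ℤ) (fun j : Fin n => k (Sum.inr (Sum.inr j))) 0)

theorem assignAngles_add_int (n : ℕ) (y : ToneIndex n → ℝ) (k : ToneIndex n → ℤ) (s : ℝ) :
    assignAngles n (fun i => y i + k i * (2 * Real.pi)) s =
      fun i => assignAngles n y s i + assignShift n k i * (2 * Real.pi) := by
  funext i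
  rcases i with p | p | j
  · rfl
  · simp only [assignAngles, assignShift, Sum.elim_inl, Sum.elim_inr]
    ring
  · refine Fin.lastCases ?_ (fun j => ?_) j
    · simp [assignAngles, assignShift]
    · simp [assignAngles, assignShift]

theorem sum_quasienergy (n : ℕ) (q : Fin (n + 1) → ℝ) : ∑ α, quasienergy n q α = 0 := by
  rw [Fin.sum_univ_succ]
  simp [quasienergy]

/-- The extracted phases `e^{± i q_1 t}` supply exactly the `q_1` that `Q̃` lacks: `-q_1` in the
first entry and `q_1` in the second. -/
theorem leadPhase_mul_diagEvolution (n : ℕ) (q : Fin (n + 1) → ℝ) (t : ℝ) :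
    diagonal (leadPhase (n + 2) (q 0 * t)) * diagEvolution (reducedQuasienergy n q) t =
      diagEvolution (quasienergy n q) t := by
  rw [diagEvolution, diagEvolution, diagonal_mul_diagonal]
  congr 1
  funext α
  refine Fin.cases ?_ (fun β => Fin.cases ?_ (fun γ => ?_) β) α
  · simp only [leadPhase, reducedQuasienergy, quasienergy, Fin.cons_zero, Fin.val_zero, if_true,
      Fin.sum_univ_succ q]
    rw [← Complex.exp_add]
    congr 1
    push_cast
    ring
  · simp [leadPhase, reducedQuasienergy, quasienergy]
  · simp [leadPhase, reducedQuasienergy, quasienergy]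

/-! ### The singular hyperplanes -/

section Singular

variable (n : ℕ) {m : ℕ} (e : ToneIndex n ≃ Fin m)

/-- As zero sets of sines, the infinitely many hyperplanes are grouped into a finite union of
visibly closed and periodic sets. -/
theorem driveS_eq : driveS n e =
    ⋃ p : AnglePair n, {θ : Fin m → ℝ | Real.sin (θ (e (Sum.inl p))) = 0} := by
  ext θ
  simp only [mem_iUnion]
  refine exists_congr fun p => ?_
  change _ ↔ Real.sin _ = 0
  rw [Real.sin_eq_zero_iff]
  exact exists_congr fun k => eq_comm

theorem isClosed_driveS : IsClosed (driveS n e) := by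
  rw [driveS_eq]
  exact isClosed_iUnion_of_finite fun p => isClosed_eq (by fun_prop) continuous_const

theorem volume_driveS : volume (driveS n e) = 0 := by
  have : driveS n e = ⋃ p : AnglePair n, ⋃ k : ℤ, {θ : Fin m → ℝ | θ (e (Sum.inl p)) = k * Real.pi} := by
    ext θ
    simp [driveS]
  rw [this]
  exact measure_iUnion_null fun p => measure_iUnion_null fun k => Measure.pi_hyperplane _ _ _

theorem torusPeriodic_driveS : TorusPeriodic fun θ : Fin m → ℝ => θ ∈ driveS n e := by
  intro θ k
  simp only [driveS_eq, mem_iUnion, mem_ofPred_eq, Real.sin_add_int_mul_two_pi]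

variable {ω : Fin m → ℝ}

theorem countable_line_driveS (hω : ∀ j, ω j ≠ 0) : {t : ℝ | t • ω ∈ driveS n e}.Countable := by
  refine (Set.countable_range fun x : AnglePair n × ℤ =>
    x.2 * Real.pi / ω (e (Sum.inl x.1))).mono ?_
  rintro t ⟨p, k, h⟩
  refine ⟨(p, k), ?_⟩
  rw [div_eq_iff (hω _), ← h]
  rfl

variable {n e}

theorem ne_of_notMem_driveS {θ : Fin m → ℝ} (hθ : θ ∉ driveS n e) {c : ℝ}
    (hc : ∃ k : ℤ, c = k * Real.pi) (p : AnglePair n) (k : ℤ) :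
    θ (e (Sum.inl p)) + c ≠ k * Real.pi := by
  obtain ⟨l, rfl⟩ := hc
  intro h
  refine hθ ⟨p, k - l, ?_⟩
  push_cast
  linarith

/-! ### The drive with shifted tones -/

/-- The micromotion operator when the tones are shifted by `c`. -/
def shiftedP (n : ℕ) {m : ℕ} (e : ToneIndex n ≃ Fin m) (c : ToneIndex n → ℝ) (θ : Fin m → ℝ) :
    Matrix (Fin (n + 2)) (Fin (n + 2)) ℂ :=
  hurwitzTorus n (assignAngles n (fun i => θ (e i) + c i) 0) *
    (hurwitzTorus n (assignAngles n c 0))ᴴ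

/-- The evolution operator when the tones are shifted by `c`. -/
def shiftedU (n : ℕ) {m : ℕ} (e : ToneIndex n ≃ Fin m) (c : ToneIndex n → ℝ)
    (q : Fin (n + 1) → ℝ) (ω : Fin m → ℝ) (t : ℝ) : Matrix (Fin (n + 2)) (Fin (n + 2)) ℂ :=
  hurwitzTorus n (assignAngles n (fun i => ω (e i) * t + c i) (q 0 * t)) *
    diagEvolution (reducedQuasienergy n q) t * (hurwitzTorus n (assignAngles n c 0))ᴴ

/-- Shifts of the `θ` tones by multiples of `π` preserve the singular hyperplanes. This covers both
the general drive (no shift) and the qubit drive (shift `π`). -/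
theorem entriesIn_shiftedP (hω : ∀ j, ω j ≠ 0) {c : ToneIndex n → ℝ}
    (hc : ∀ p, ∃ k : ℤ, c (Sum.inl p) = k * Real.pi) :
    EntriesIn (regularAlgebra ω (driveS n e) (isClosed_driveS n e) (countable_line_driveS n e hω))
      (shiftedP n e c) := by
  refine EntriesIn.mul ?_ (EntriesIn.const _)
  have hexp : ∀ {g : (Fin m → ℝ) → ℝ}, ContDiff ℝ ((⊤ : ℕ∞) : WithTop ℕ∞) g →
      (fun θ => Complex.exp (Complex.I * g θ)) ∈ regularAlgebra ω (driveS n e) (isClosed_driveS n e)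
        (countable_line_driveS n e hω) ∧
      (fun θ => Complex.exp (-(Complex.I * g θ))) ∈ regularAlgebra ω (driveS n e)
        (isClosed_driveS n e) (countable_line_driveS n e hω) := by
    intro g hg
    have hg' : ContDiff ℝ ((⊤ : ℕ∞) : WithTop ℕ∞) fun θ => (g θ : ℂ) :=
      Complex.ofRealCLM.contDiff.comp hg
    exact ⟨isRegular_of_contDiff (contDiff_const.mul hg').cexp,
      isRegular_of_contDiff (contDiff_const.mul hg').neg.cexp⟩
  have hφ : ∀ p : AnglePair n, ContDiff ℝ ((⊤ : ℕ∞) : WithTop ℕ∞) fun θ : Fin m → ℝ =>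
      assignAngles n (fun i => θ (e i) + c i) 0 (Sum.inr (Sum.inl p)) := by
    intro p
    simp only [assignAngles, Sum.elim_inl, Sum.elim_inr]
    fun_prop
  have hη : ∀ j : Fin (n + 1), ContDiff ℝ ((⊤ : ℕ∞) : WithTop ℕ∞) fun θ : Fin m → ℝ =>
      assignAngles n (fun i => θ (e i) + c i) 0 (Sum.inr (Sum.inr j)) := by
    intro j
    refine Fin.lastCases ?_ (fun j => ?_) j
    · simp only [assignAngles, Sum.elim_inr, Fin.snoc_last]
      fun_prop
    · simp only [assignAngles, Sum.elim_inr, Fin.snoc_castSucc]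
      fun_prop
  refine entriesIn_hurwitzV n (fun p => ?_) (fun p => ?_) (fun p => (hexp (hφ p)).1)
    (fun p => (hexp (hφ p)).2) (fun j => (hexp (hη j)).1) fun j => (hexp (hη j)).2
  · exact isRegular_ofReal_comp (countable_line_driveS n e hω)
      (h := fun u => Real.cos (xiOf ((p.2 : ℕ) + 1) u)) (Real.continuous_cos.comp (continuous_xiOf _))
      (fun a b => (intervalIntegrable_deriv_sin_xiOf _ a b).2) (hω _) _ fun θ hθ =>
      (contDiffAt_xiOf (Nat.succ_pos _) (ne_of_notMem_driveS hθ (hc p) p)).cos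
  · exact isRegular_ofReal_comp (countable_line_driveS n e hω)
      (h := fun u => Real.sin (xiOf ((p.2 : ℕ) + 1) u)) (Real.continuous_sin.comp (continuous_xiOf _))
      (fun a b => (intervalIntegrable_deriv_sin_xiOf _ a b).1) (hω _) _ fun θ hθ =>
      (contDiffAt_xiOf (Nat.succ_pos _) (ne_of_notMem_driveS hθ (hc p) p)).sin

theorem torusPeriodic_shiftedP (c : ToneIndex n → ℝ) : TorusPeriodic (shiftedP n e c) := by
  intro θ k
  have h := assignAngles_add_int n (fun i => θ (e i) + c i) (fun i => k (e i)) 0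
  simp only [shiftedP]
  rw [show (fun i => θ (e i) + k (e i) * (2 * Real.pi) + c i) =
    fun i => θ (e i) + c i + k (e i) * (2 * Real.pi) by funext i; ring, h, hurwitzTorus_add_int]

/-- The phase of `η_{d-1}` is pulled to the right and merged with the evolution under `Q̃`.
Inserting `Vᴴ V = 1` then separates `P` from the Floquet factor. -/
theorem shiftedU_eq (c : ToneIndex n → ℝ) (q : Fin (n + 1) → ℝ) (t : ℝ) :
    shiftedU n e c q ω t = shiftedP n e c (t • ω) *
      floquetFactor (hurwitzTorus n (assignAngles n c 0)) (quasienergy n q) t := by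
  have hV := (mem_specialUnitaryGroup_iff.1 (hurwitzTorus_mem n (assignAngles n c 0))).1
  rw [shiftedU, hurwitzTorus_assignAngles, Matrix.mul_assoc _ (diagonal _),
    leadPhase_mul_diagEvolution, shiftedP, floquetFactor, Matrix.mul_assoc _ _ᴴ,
    ← Matrix.mul_assoc _ᴴ, ← Matrix.mul_assoc _ᴴ, conjTranspose_mul_self hV, one_mul,
    Matrix.mul_assoc]
  simp only [Pi.smul_apply, smul_eq_mul, mul_comm t]

end Singular

/-! ### Equidistribution of the drive -/

/-- The new frequencies differ from the family `(q, ω)` only by a reordering and the replacement of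
one `ω` by `ω - q_1`, an invertible integral change of basis. -/
theorem linearIndependent_eulerFrequencies (n : ℕ) {m : ℕ} (e : ToneIndex n ≃ Fin m)
    {q : Fin (n + 1) → ℝ} {ω : Fin m → ℝ} (h : LinearIndependent ℤ (Sum.elim q ω)) :
    LinearIndependent ℤ (Sum.elim (assignAngles n (fun i => ω (e i)) (q 0))
      fun α : Fin n => q α.succ) := by
  rw [Fintype.linearIndependent_iff] at h ⊢
  intro a ha
  -- In a relation among the new frequencies, `q_1` occurs through `η_{d-1}` and, with the opposite
  -- sign, through `φ_{1,d-1}`. So its coefficient is a difference, and the coefficient of `η_{d-1}`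
  -- is recovered last.
  have hb := h (Sum.elim (Fin.cons (α := fun _ => ℤ)
    (a (Sum.inl (Sum.inr (Sum.inr (Fin.last n)))) -
      a (Sum.inl (Sum.inr (Sum.inl (lastPair n))))) fun α => a (Sum.inr α))
    (fun j => (Sum.elim (fun p => a (Sum.inl (Sum.inl p)))
      (Sum.elim (fun p => a (Sum.inl (Sum.inr (Sum.inl p))))
        fun j => a (Sum.inl (Sum.inr (Sum.inr j.castSucc)))) : ToneIndex n → ℤ) (e.symm j))) (by
    simp only [Fintype.sum_sum_type, Sum.elim_inl, Sum.elim_inr, assignAngles,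
      Fin.sum_univ_castSucc (n := n), Fin.snoc_castSucc, Fin.snoc_last, smul_sub,
      Finset.sum_sub_distrib, smul_ite, smul_zero, Finset.sum_ite_eq',
      Finset.mem_univ, if_true] at ha
    simp only [Fintype.sum_sum_type, Sum.elim_inl, Sum.elim_inr, Fin.sum_univ_succ (n := n),
      Fin.cons_zero, Fin.cons_succ, sub_smul]
    rw [← e.sum_comp]
    simp only [Equiv.symm_apply_apply, Fintype.sum_sum_type, Sum.elim_inl, Sum.elim_inr]
    linear_combination ha)
  have h1 : ∀ i : ToneIndex n, (Sum.elim (fun p => a (Sum.inl (Sum.inl p)))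
      (Sum.elim (fun p => a (Sum.inl (Sum.inr (Sum.inl p))))
        fun j => a (Sum.inl (Sum.inr (Sum.inr j.castSucc)))) : ToneIndex n → ℤ) i = 0 := by
    intro i
    have := hb (Sum.inr (e i))
    simpa using this
  have h2 := hb (Sum.inl 0)
  simp only [Sum.elim_inl, Fin.cons_zero] at h2
  rintro ((p | p | j) | α)
  · exact h1 (Sum.inl p)
  · exact h1 (Sum.inr (Sum.inl p))
  · refine Fin.lastCases ?_ (fun j => ?_) j
    · have h3 : a (Sum.inl (Sum.inr (Sum.inl (lastPair n)))) = 0 := h1 (Sum.inr (Sum.inl _))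
      omega
    · exact h1 (Sum.inr (Sum.inr j))
  · have := hb (Sum.inl α.succ)
    simpa using this

/-- The phases `exp(-i diag(-∑ y, 0, y_1, …))`. -/
def tailPhase (n : ℕ) (y : Fin n → ℝ) : Matrix (Fin (n + 2)) (Fin (n + 2)) ℂ :=
  diagEvolution (reducedQuasienergy n (Fin.cons (α := fun _ => ℝ) 0 y)) 1

theorem tailPhase_mul (n : ℕ) (q : Fin (n + 1) → ℝ) (t : ℝ) :
    tailPhase n (fun α => q α.succ * t) = diagEvolution (reducedQuasienergy n q) t := by
  rw [tailPhase, diagEvolution, diagEvolution]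
  congr 1
  funext α
  refine Fin.cases ?_ (fun β => Fin.cases ?_ (fun γ => ?_) β) α
  · simp [reducedQuasienergy, Finset.sum_mul]
  · simp [reducedQuasienergy]
  · simp [reducedQuasienergy]

theorem tailPhase_add_int (n : ℕ) (y : Fin n → ℝ) (k : Fin n → ℤ) :
    tailPhase n (fun α => y α + k α * (2 * Real.pi)) = tailPhase n y := by
  rw [tailPhase, tailPhase, diagEvolution, diagEvolution]
  congr 1
  funext α
  refine Fin.cases ?_ (fun β => Fin.cases ?_ (fun γ => ?_) β) α
  · simp only [reducedQuasienergy, Fin.cons_zero, Fin.cons_succ, mul_one]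
    have : -∑ α, (y α + k α * (2 * Real.pi)) = -∑ α, y α + ((-∑ α, k α : ℤ) : ℝ) * (2 * Real.pi) := by
      push_cast
      rw [Finset.sum_add_distrib, neg_mul, Finset.sum_mul]
      ring
    rw [this, exp_neg_I_mul_add_int]
  · simp [reducedQuasienergy]
  · simp only [reducedQuasienergy, Fin.cons_succ, mul_one]
    rw [exp_neg_I_mul_add_int]

theorem continuous_tailPhase (n : ℕ) : Continuous (tailPhase n) := by
  refine Continuous.matrix_diagonal (continuous_pi fun α => ?_)
  refine Fin.cases ?_ (fun β => Fin.cases ?_ (fun γ => ?_) β) α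
  · simp only [reducedQuasienergy, Fin.cons_zero, Fin.cons_succ]
    fun_prop
  · simp only [reducedQuasienergy, Fin.cons_zero, Fin.cons_succ]
    fun_prop
  · simp only [reducedQuasienergy, Fin.cons_succ]
    fun_prop

theorem tailPhase_mem (n : ℕ) (y : Fin n → ℝ) :
    tailPhase n y ∈ specialUnitaryGroup (Fin (n + 2)) ℂ := by
  refine mem_specialUnitaryGroup_iff.2 ⟨diagEvolution_mem _ _, det_diagEvolution _ ?_ _⟩
  rw [Fin.sum_univ_succ, Fin.sum_univ_succ]
  simp [reducedQuasienergy]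

theorem equidistributesModPhase_shiftedU (n : ℕ) {m : ℕ} (e : ToneIndex n ≃ Fin m)
    (c : ToneIndex n → ℝ) {q : Fin (n + 1) → ℝ} {ω : Fin m → ℝ}
    (h : LinearIndependent ℤ (Sum.elim q ω)) :
    EquidistributesModPhase (shiftedU n e c q ω) := by
  intro F hF hphase
  let V : Matrix (Fin (n + 2)) (Fin (n + 2)) ℂ := hurwitzTorus n (assignAngles n c 0)
  have hV : Vᴴ ∈ specialUnitaryGroup (Fin (n + 2)) ℂ := by
    have := (star (⟨V, hurwitzTorus_mem n _⟩ : specialUnitaryGroup (Fin (n + 2)) ℂ)).2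
    exact this
  -- The phases generated by `q_2, …, q_{d-1}` are treated as additional torus coordinates, so that
  -- `F (U(t))` is a continuous function of one linear flow.
  let f : (EulerIndex n ⊕ Fin n → ℝ) → ℂ := fun x =>
    F (hurwitzTorus n (x ∘ Sum.inl) * tailPhase n (x ∘ Sum.inr) * Vᴴ)
  have hf : Continuous f := by
    refine hF.comp ((Continuous.matrix_mul ?_ ?_).matrix_mul continuous_const)
    · exact (continuous_hurwitzTorus n).comp (by fun_prop)
    · exact (continuous_tailPhase n).comp (by fun_prop)
  have hper : ∀ (x : EulerIndex n ⊕ Fin n → ℝ) (k : EulerIndex n ⊕ Fin n → ℤ),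
      f (fun i => x i + k i * (2 * Real.pi)) = f x := by
    intro x k
    have h1 := hurwitzTorus_add_int n (x ∘ Sum.inl) (k ∘ Sum.inl)
    have h2 := tailPhase_add_int n (x ∘ Sum.inr) (k ∘ Sum.inr)
    simp only [f, Function.comp_def] at h1 h2 ⊢
    rw [h1, h2]
  have key := hasTimeAverage_linearFlow (linearIndependent_eulerFrequencies n e h)
    (Sum.elim (assignAngles n c 0) 0) hf hper
  have hpath : (fun t : ℝ => F (shiftedU n e c q ω t)) = fun t => f fun i =>
      Sum.elim (assignAngles n c 0) 0 i + Sum.elim (assignAngles n (fun i => ω (e i)) (q 0))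
        (fun α : Fin n => q α.succ) i * t := by
    funext t
    have h1 := assignAngles_add_mul n (fun i => ω (e i)) c (q 0) 0 t
    rw [add_zero] at h1
    simp only [f, shiftedU, Function.comp_def, Sum.elim_inl, Sum.elim_inr, Pi.zero_apply, zero_add]
    rw [h1, tailPhase_mul]
  have hint : ∫ x, f x ∂Measure.pi (fun _ : EulerIndex n ⊕ Fin n => unifAngle) =
      ∫ W : unitaryGroup (Fin (n + 2)) ℂ, F W.1 ∂haarU (n + 2) := by
    have hinj : Function.Injective (Sum.elim (Sum.inr : Fin n → EulerIndex n ⊕ Fin n) Sum.inl) := by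
      rintro (a | a) (b | b) hab <;> simp_all
    have hmp := measurePreserving_comp_prod unifAngle hinj
    let g : (Fin n → ℝ) × (EulerIndex n → ℝ) → specialUnitaryGroup (Fin (n + 2)) ℂ := fun z =>
      hurwitzSU n z.2 * (⟨tailPhase n z.1, tailPhase_mem n z.1⟩ * ⟨Vᴴ, hV⟩)
    have hg : Continuous g := ((continuous_hurwitzSU n).comp continuous_snd).mul
      ((((continuous_tailPhase n).comp continuous_fst).subtype_mk _).mul continuous_const)
    have hF' : Continuous fun M : specialUnitaryGroup (Fin (n + 2)) ℂ => F M.1 :=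
      hF.comp continuous_subtype_val
    have hfg : ∀ x, f x = F (g (x ∘ Sum.inr, x ∘ Sum.inl)).1 := fun x => by
      simp only [f, g, hurwitzSU, Submonoid.coe_mul, Matrix.mul_assoc]
    calc ∫ x, f x ∂Measure.pi (fun _ : EulerIndex n ⊕ Fin n => unifAngle)
        = ∫ x : EulerIndex n ⊕ Fin n → ℝ, F (g (x ∘ Sum.inr, x ∘ Sum.inl)).1
            ∂Measure.pi (fun _ : EulerIndex n ⊕ Fin n => unifAngle) := by simp only [hfg]
      _ = ∫ z, F (g z).1 ∂((Measure.pi fun _ : Fin n => unifAngle).prod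
            (Measure.pi fun _ : EulerIndex n => unifAngle)) := by
          rw [← hmp.map_eq, integral_map hmp.measurable.aemeasurable]
          exact (hF'.comp hg).measurable.aestronglyMeasurable
      _ = ∫ y, ∫ x, F (g (y, x)).1 ∂torusMeasure n ∂(Measure.pi fun _ : Fin n => unifAngle) :=
          integral_prod _ (integrable_of_continuous_compact _ hF' hg.measurable)
      -- For fixed tail phases the Euler angles produce a Haar matrix, and right invariance absorbs
      -- the tail phases and `Vᴴ`.
      _ = ∫ _y : Fin n → ℝ, (∫ W : unitaryGroup (Fin (n + 2)) ℂ, F W.1 ∂haarU (n + 2))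
            ∂(Measure.pi fun _ : Fin n => unifAngle) := by
          congr 1
          funext y
          have hm := (continuous_hurwitzSU n).measurable
          rw [← integral_haarSU_eq_haarU (Nat.succ_pos _) hF hphase,
            ← integral_mul_right_eq_self (μ := haarSU (n + 2))
              (fun M : specialUnitaryGroup (Fin (n + 2)) ℂ => F M.1)
              (⟨tailPhase n y, tailPhase_mem n y⟩ * ⟨Vᴴ, hV⟩), ← map_hurwitzSU n,
            integral_map hm.aemeasurable]
          exact (hF'.comp (continuous_mul_const _)).measurable.aestronglyMeasurable
      _ = _ := by simp
  rw [hint] at key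
  rwa [hpath]

theorem isErgodicDrive_shifted (n : ℕ) {m : ℕ} (e : ToneIndex n ≃ Fin m)
    {c : ToneIndex n → ℝ} (hc : ∀ p, ∃ k : ℤ, c (Sum.inl p) = k * Real.pi)
    {q : Fin (n + 1) → ℝ} {ω : Fin m → ℝ} (h : LinearIndependent ℤ (Sum.elim q ω)) :
    IsErgodicDrive ω (driveS n e) (parentHamiltonian ω (driveS n e) (shiftedP n e c)
      (hurwitzTorus n (assignAngles n c 0) * diagonal (fun α => (quasienergy n q α : ℂ)) *
        (hurwitzTorus n (assignAngles n c 0))ᴴ))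
      (shiftedU n e c q ω) (shiftedP n e c)
      (hurwitzTorus n (assignAngles n c 0) * diagonal (fun α => (quasienergy n q α : ℂ)) *
        (hurwitzTorus n (assignAngles n c 0))ᴴ) (quasienergy n q) := by
  have hω : LinearIndependent ℤ ω := h.comp Sum.inr Sum.inr_injective
  have hV := hurwitzTorus_mem n (assignAngles n c 0)
  have hVu := (mem_specialUnitaryGroup_iff.1 hV).1
  refine isErgodicDrive_of_regular hω (isClosed_driveS n e) (volume_driveS n e)
    (countable_line_driveS n e fun j => hω.ne_zero j) (torusPeriodic_driveS n e)
    (entriesIn_shiftedP (fun j => hω.ne_zero j) hc) (torusPeriodic_shiftedP c) (fun θ => ?_) ?_ hVu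
    (sum_quasienergy n q) (shiftedU_eq c q) (equidistributesModPhase_shiftedU n e c h)
  · exact mul_mem (hurwitzTorus_mem n _)
      (star (⟨_, hV⟩ : specialUnitaryGroup (Fin (n + 2)) ℂ)).2
  · simp only [shiftedP, Pi.zero_apply, zero_add]
    exact mul_conjTranspose_self hVu

theorem isErgodicDrive_drive (n : ℕ) {m : ℕ} (e : ToneIndex n ≃ Fin m)
    {q : Fin (n + 1) → ℝ} {ω : Fin m → ℝ} (h : LinearIndependent ℤ (Sum.elim q ω)) :
    IsErgodicDrive ω (driveS n e) (parentHamiltonian ω (driveS n e) (driveP n e) (driveQ n q))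
      (driveU n e q ω) (driveP n e) (driveQ n q) (quasienergy n q) := by
  have key := isErgodicDrive_shifted n e (c := fun _ => 0) (fun _ => ⟨0, by simp⟩) h
  have hU : driveU n e q ω = shiftedU n e (fun _ => 0) q ω := by
    funext t
    simp only [driveU, shiftedU, add_zero, assignAngles_zero, diagEvolution]
  have hP : driveP n e = shiftedP n e (fun _ => 0) := by
    funext θ
    simp only [driveP, shiftedP, add_zero, assignAngles_zero]
  rw [assignAngles_zero] at key
  rw [hU, hP]
  exact key

/-- Rationally independent families of reals of any finite size exist. -/
theorem exists_linearIndependent_int (ι : Type) [Fintype ι] :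
    ∃ v : ι → ℝ, LinearIndependent ℤ v := by
  have hinf : Cardinal.aleph0 ≤ Module.rank ℚ ℝ := by
    rw [Real.rank_rat_real]
    exact Cardinal.aleph0_le_continuum
  obtain ⟨f, hf⟩ := exists_linearIndependent_of_le_rank
    (R := ℚ) (M := ℝ) (n := Fintype.card ι) (le_trans (Cardinal.natCast_lt_aleph0).le hinf)
  exact ⟨f ∘ Fintype.equivFin ι, (hf.restrict_scalars (R := ℤ) fun a b hab => by
    simpa using hab).comp _ (Equiv.injective _)⟩

/-! ### The qubit drive as a drive with shifted tones -/

theorem anglePair_zero_eq (p : AnglePair 0) : p = lastPair 0 := by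
  rcases p with ⟨j, r⟩
  obtain rfl : j = Fin.last 0 := Fin.ext (by omega)
  obtain rfl : r = 0 := Fin.ext (Nat.lt_one_iff.1 r.2)
  rfl

/-- The two tones of the qubit drive. -/
def qubitTones : ToneIndex 0 ≃ Fin 2 where
  toFun := Sum.elim (fun _ => 0) (Sum.elim (fun _ => 1) Fin.elim0)
  invFun := ![Sum.inl (lastPair 0), Sum.inr (Sum.inl (lastPair 0))]
  left_inv := by
    rintro (p | p | j)
    · simp [anglePair_zero_eq p]
    · simp [anglePair_zero_eq p]
    · exact j.elim0
  right_inv := by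
    intro i
    fin_cases i <;> rfl

/-- The shift of the tones which exchanges sine and cosine. -/
def qubitShift : ToneIndex 0 → ℝ := Sum.elim (fun _ => Real.pi) fun _ => 0

theorem hurwitzTorus_zero_apply (x : EulerIndex 0 → ℝ) :
    hurwitzTorus 0 x = rot 2 0 (xiOf 1 (x (Sum.inl (lastPair 0))))
      (x (Sum.inr (Sum.inl (lastPair 0)))) (x (Sum.inr (Sum.inr 0))) := by
  simp [hurwitzTorus, hurwitzV, hurwitzE, lastPair]

theorem rot_two_zero (ξ φ η : ℝ) : rot 2 0 ξ φ η =
    !![(Real.cos ξ : ℂ) * Complex.exp (Complex.I * η),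
      -(Real.sin ξ * Complex.exp (Complex.I * φ));
      Real.sin ξ * Complex.exp (-(Complex.I * φ)),
      Real.cos ξ * Complex.exp (-(Complex.I * η))] := by
  ext a b
  fin_cases a <;> fin_cases b <;> simp [rot]

theorem qubitXi_zero : qubitXi 0 = 0 := by
  have : angleMod 0 = 0 := by simp [angleMod]
  simp [qubitXi, this]

/-- At `θ = π` the angle `ξ` vanishes, so the shifted drive starts from the identity and its `Q` is
already diagonal. -/
theorem hurwitzTorus_qubitShift : hurwitzTorus 0 (assignAngles 0 qubitShift 0) = 1 := by
  have h : xiOf 1 Real.pi = 0 := by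
    rw [← qubitXi_zero, qubitXi_eq_xiOf, zero_add]
  rw [hurwitzTorus_zero_apply]
  ext a b
  fin_cases a <;> fin_cases b <;> simp [rot, assignAngles, qubitShift, h, Fin.snoc]

theorem shiftedP_qubit : shiftedP 0 qubitTones qubitShift = qubitP := by
  funext θ
  rw [shiftedP, hurwitzTorus_qubitShift, conjTranspose_one, mul_one, hurwitzTorus_zero_apply,
    rot_two_zero, qubitP, qubitXi_eq_xiOf]
  simp [assignAngles, qubitShift, qubitTones, Fin.snoc]

theorem shiftedU_qubit (ω : Fin 2 → ℝ) (q : ℝ) :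
    shiftedU 0 qubitTones qubitShift (fun _ => q) ω = qubitU ω q := by
  funext t
  -- For `d = 2` the matrix `Q̃` vanishes.
  have h : diagEvolution (reducedQuasienergy 0 fun _ => q) t = 1 := by
    rw [diagEvolution, ← diagonal_one]
    congr 1
    funext α
    fin_cases α <;> simp [reducedQuasienergy]
  rw [shiftedU, hurwitzTorus_qubitShift, conjTranspose_one, mul_one, h, mul_one,
    hurwitzTorus_zero_apply, rot_two_zero, qubitU, qubitXi_eq_xiOf]
  simp [assignAngles, qubitShift, qubitTones, Fin.snoc, sub_mul]

theorem driveS_qubit : driveS 0 qubitTones = qubitS := by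
  ext θ
  refine ⟨fun ⟨p, h⟩ => h, fun h => ⟨lastPair 0, h⟩⟩

theorem quasienergy_qubit (q : ℝ) : quasienergy 0 (fun _ => q) = ![-q, q] := by
  funext α
  fin_cases α <;> simp [quasienergy]

theorem qubitQ_eq (q : ℝ) : qubitQ q = diagonal fun α => ((![-q, q] : Fin 2 → ℝ) α : ℂ) := by
  rw [qubitQ]
  congr 1
  funext α
  fin_cases α <;> simp

theorem isErgodicDrive_qubit {ω : Fin 2 → ℝ} {q : ℝ} (h : LinearIndependent ℤ ![ω 0, ω 1, q]) :
    IsErgodicDrive ω qubitS (parentHamiltonian ω qubitS qubitP (qubitQ q)) (qubitU ω q) qubitP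
      (qubitQ q) ![-q, q] := by
  have h' : LinearIndependent ℤ (Sum.elim (fun _ : Fin 1 => q) ω) := by
    have hinj : Function.Injective (Sum.elim (fun _ : Fin 1 => 2) ![0, 1] : Fin 1 ⊕ Fin 2 → Fin 3) := by
      decide
    have := h.comp _ hinj
    convert this using 1
    funext i
    rcases i with i | i
    · rfl
    · fin_cases i <;> rfl
  have key := isErgodicDrive_shifted 0 qubitTones (c := qubitShift) (fun _ => ⟨1, by simp [qubitShift]⟩) h'
  rw [shiftedP_qubit, shiftedU_qubit, driveS_qubit, hurwitzTorus_qubitShift, quasienergy_qubit,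
    one_mul, conjTranspose_one, mul_one, ← qubitQ_eq] at key
  exact key

/-! ### The qubit drive needs two tones -/

/-- `|U₀₀|²` is a triangle wave in `ω 0 * t`. Applying `cos (π ·)` makes it smooth, so it can be
differentiated without distinguishing half periods. -/
theorem cos_pi_mul_normSq_qubitU (ω : Fin 2 → ℝ) (q t : ℝ) :
    Real.cos (Real.pi * ‖qubitU ω q t 0 0‖ ^ 2) = -Real.cos (ω 0 * t) := by
  have h1 : ‖qubitU ω q t 0 0‖ = |Real.cos (qubitXi (ω 0 * t))| := by
    simp only [qubitU, of_apply, cons_val_zero, norm_mul, mul_comm Complex.I,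
      Complex.norm_exp_ofReal_mul_I, mul_one, Complex.norm_real, Real.norm_eq_abs, cons_val']
  have h2 : |1 - angleMod (ω 0 * t) / Real.pi| ≤ 1 := by
    rw [abs_one_sub_angleMod_div_pi]
    exact (div_le_one Real.pi_pos).2 (Real.arccos_le_pi _)
  rw [h1, sq_abs, qubitXi, Real.cos_arccos (neg_one_lt_zero.le.trans
    (Real.sqrt_nonneg _)) (Real.sqrt_le_one.2 h2), Real.sq_sqrt (abs_nonneg _),
    abs_one_sub_angleMod_div_pi, mul_div_cancel₀ _ Real.pi_pos.ne', Real.cos_arccos]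
  · linarith [Real.cos_le_one (ω 0 * t)]
  · linarith [Real.neg_one_le_cos (ω 0 * t)]

/-- The Hamiltonian of the qubit drive has non-zero off-diagonal elements off the singular times. -/
theorem qubit_offDiagonal_ne_zero {ω : Fin 2 → ℝ} {q : ℝ}
    (h : LinearIndependent ℤ ![ω 0, ω 1, q]) {t : ℝ} (ht : t • ω ∉ qubitS) :
    parentHamiltonian ω qubitS qubitP (qubitQ q) (t • ω) 0 1 ≠ 0 := by
  intro h01
  have hd := isErgodicDrive_qubit h
  obtain ⟨hdiff, hH⟩ := hd.schroedinger t ht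
  set H := parentHamiltonian ω qubitS qubitP (qubitQ q) (t • ω) with hHdef
  have hUu : (qubitU ω q t)ᴴ * qubitU ω q t = 1 :=
    conjTranspose_mul_self (mem_specialUnitaryGroup_iff.1 (hd.evolution_unitary t)).1
  have h1 : H * qubitU ω q t = Complex.I • Matrix.of fun a b => deriv (fun τ => qubitU ω q τ a b) t := by
    rw [hH, Matrix.smul_mul, Matrix.mul_assoc, hUu, mul_one]
  -- If `H₀₁` vanished, `U₀₀` would only rotate in phase, `H₀₀` being real. Then `|U₀₀|²` would be
  -- stationary, whereas `-cos (ω 0 * t)` has derivative `ω 0 * sin (ω 0 * t) ≠ 0` at regular times.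
  have h2 : deriv (fun τ => qubitU ω q τ 0 0) t = -Complex.I * (H 0 0 * qubitU ω q t 0 0) := by
    have h3 := congrFun (congrFun h1 0) 0
    rw [Matrix.mul_apply, Fin.sum_univ_two, h01, zero_mul, add_zero] at h3
    rw [h3]
    simp only [Matrix.smul_apply, of_apply, smul_eq_mul]
    rw [← mul_assoc, neg_mul, Complex.I_mul_I, neg_neg, one_mul]
  have hreal : (H 0 0).im = 0 := by
    have := (hd.parent_hermitian (t • ω)).apply 0 0
    exact Complex.conj_eq_iff_im.1 this
  have h4 := (hdiff 0 0).hasDerivAt.norm_sq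
  have h5 : inner ℝ (qubitU ω q t 0 0) (deriv (fun τ => qubitU ω q τ 0 0) t) = 0 := by
    rw [h2, Complex.inner]
    simp only [Complex.mul_re, Complex.mul_im, Complex.conj_re, Complex.conj_im, Complex.neg_re,
      Complex.neg_im, Complex.I_re, Complex.I_im, hreal]
    ring
  rw [h5, mul_zero] at h4
  have h6 := (h4.const_mul Real.pi).cos
  simp only [cos_pi_mul_normSq_qubitU] at h6
  have h7 := ((hasDerivAt_id t).const_mul (ω 0)).cos.fun_neg
  have h8 := h6.unique h7
  simp only [id, mul_one, mul_zero, neg_mul, neg_neg] at h8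
  have h9 : ω 0 ≠ 0 := h.ne_zero 0
  have h10 : Real.sin (ω 0 * t) = 0 := by
    rcases mul_eq_zero.1 h8.symm with h | h
    · exact h
    · exact absurd h h9
  obtain ⟨k, hk⟩ := Real.sin_eq_zero_iff.1 h10
  exact ht ⟨k, by rw [hk, Pi.smul_apply, smul_eq_mul, mul_comm]⟩

/-- Shifting the second tone conjugates `P` by the constant matrix `diag (e^{ia}, 1)`. This matrix
commutes with `Q` and with the derivative along `ω`, so the parent Hamiltonian is conjugated in the
same way. -/
theorem qubit_offDiagonal_shift (ω : Fin 2 → ℝ) (q : ℝ) (θ : Fin 2 → ℝ) (a : ℝ) :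
    parentHamiltonian ω qubitS qubitP (qubitQ q) (θ + ![0, a]) 0 1 =
      Complex.exp (Complex.I * a) * parentHamiltonian ω qubitS qubitP (qubitQ q) θ 0 1 := by
  have hS : θ + ![0, a] ∈ qubitS ↔ θ ∈ qubitS := by
    change (∃ k : ℤ, (θ + ![0, a]) 0 = k * Real.pi) ↔ ∃ k : ℤ, θ 0 = k * Real.pi
    simp
  by_cases hθ : θ ∈ qubitS
  · rw [parentHamiltonian, parentHamiltonian, if_pos hθ, if_pos (hS.2 hθ)]
    simp
  have hadd : ∀ s : ℝ, θ + ![0, a] + s • ω = θ + s • ω + ![0, a] := fun s => add_right_comm _ _ _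
  have hc1 : (starRingEnd ℂ) (Complex.exp (-(Complex.I * a))) = Complex.exp (Complex.I * a) :=
    conj_exp_neg_I_mul_ofReal a
  have p00 : ∀ x, qubitP (x + ![0, a]) 0 0 = qubitP x 0 0 := fun x => by simp [qubitP]
  have p11 : ∀ x, qubitP (x + ![0, a]) 1 1 = qubitP x 1 1 := fun x => by simp [qubitP]
  have p01 : ∀ x, qubitP (x + ![0, a]) 0 1 = Complex.exp (Complex.I * a) * qubitP x 0 1 := fun x => by
    simp only [qubitP, of_apply, cons_val', cons_val_zero, cons_val_one, Pi.add_apply, add_zero,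
      Complex.ofReal_add, mul_add, Complex.exp_add]
    ring
  have p10 : ∀ x, qubitP (x + ![0, a]) 1 0 = Complex.exp (-(Complex.I * a)) * qubitP x 1 0 :=
    fun x => by
    simp only [qubitP, of_apply, cons_val', cons_val_zero, cons_val_one, Pi.add_apply, add_zero,
      Complex.ofReal_add, mul_add, neg_add, Complex.exp_add]
    ring
  have d00 : flowDeriv ω qubitP (θ + ![0, a]) 0 0 = flowDeriv ω qubitP θ 0 0 := by
    simp only [flowDeriv, of_apply, lineDeriv, hadd, p00]
  have d01 : flowDeriv ω qubitP (θ + ![0, a]) 0 1 =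
      Complex.exp (Complex.I * a) * flowDeriv ω qubitP θ 0 1 := by
    simp only [flowDeriv, of_apply, lineDeriv, hadd, p01]
    exact deriv_const_mul_field _
  rw [parentHamiltonian_of_notMem hθ, parentHamiltonian_of_notMem fun h => hθ (hS.1 h)]
  simp only [Matrix.add_apply, Matrix.smul_apply, smul_eq_mul, Matrix.mul_apply, Fin.sum_univ_two,
    conjTranspose_apply, qubitQ, diagonal_apply_eq, RCLike.star_def, p00, p01, p10, p11, d00, d01,
    map_mul, hc1, ne_eq, zero_ne_one, one_ne_zero, not_false_eq_true, diagonal_apply_ne, mul_zero,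
    add_zero, zero_add]
  ring

/-- With no tone `H` would be constant, but it is zero at `t = 0` and nonzero later. With one tone
it would have a period `T`. The zeros of `H₀₁` then force `T * ω 0 ∈ πℤ`, and its rotation with the
second tone forces `T * ω 1 ∈ πℤ`, contradicting independence. -/
theorem not_hasTones_qubit {ω : Fin 2 → ℝ} {q : ℝ} (h : LinearIndependent ℤ ![ω 0, ω 1, q])
    {m : ℕ} (hm : m < 2) : ¬ HasTones m fun t : ℝ =>
      parentHamiltonian ω qubitS qubitP (qubitQ q) (t • ω) := by
  rintro ⟨ω', G, hω', hper, -, hG⟩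
  have hω0 : ω 0 ≠ 0 := h.ne_zero 0
  -- The time `0` is singular, where the parent is zero by convention.
  have hzero : parentHamiltonian ω qubitS qubitP (qubitQ q) ((0 : ℝ) • ω) = 0 := by
    rw [parentHamiltonian, if_pos]
    exact ⟨0, by simp⟩
  -- A regular time: `ω 0 * t0 = π / 2` lies midway between two hyperplanes.
  let t0 : ℝ := Real.pi / (2 * ω 0)
  have ht0 : t0 • ω ∉ qubitS := by
    rintro ⟨k, hk⟩
    have h1 : t0 * ω 0 = Real.pi / 2 := by
      simp only [t0]
      field_simp
    rw [Pi.smul_apply, smul_eq_mul, h1] at hk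
    have h2 : (1 : ℝ) = 2 * k := by
      have := Real.pi_pos
      nlinarith
    have h3 : (1 : ℤ) = 2 * k := by exact_mod_cast h2
    omega
  have hne := qubit_offDiagonal_ne_zero h ht0
  interval_cases m
  · refine hne ?_
    have h1 := hG t0
    dsimp only at h1
    rw [h1, Subsingleton.elim (t0 • ω') ((0 : ℝ) • ω'), ← hG 0]
    exact congrFun (congrFun hzero 0) 1
  · have hw : ω' 0 ≠ 0 := hω'.ne_zero 0
    let T : ℝ := 2 * Real.pi / ω' 0
    have hTw : T * ω' 0 = 2 * Real.pi := div_mul_cancel₀ _ hw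
    have hT : T ≠ 0 := div_ne_zero Real.two_pi_pos.ne' hw
    have hperT : ∀ t, parentHamiltonian ω qubitS qubitP (qubitQ q) ((t + T) • ω) =
        parentHamiltonian ω qubitS qubitP (qubitQ q) (t • ω) := by
      intro t
      have h1 := hG (t + T)
      have h2 := hG t
      dsimp only at h1 h2
      rw [h1, h2, ← hper (t • ω') fun _ => 1]
      congr 1
      funext j
      obtain rfl : j = 0 := Subsingleton.elim _ _
      simp only [Pi.smul_apply, smul_eq_mul, add_mul, hTw, Int.cast_one, one_mul]
    obtain ⟨k, hk⟩ : ∃ k : ℤ, T * ω 0 = k * Real.pi := by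
      by_contra hcon
      refine qubit_offDiagonal_ne_zero h (t := T) (fun hmem => hcon hmem) ?_
      have h1 := hperT 0
      rw [zero_add] at h1
      rw [h1, hzero]
      rfl
    -- Two periods are needed: `T` moves the first tone by `k π` only, while `2 T` moves it by `2 π
    -- k`, a period of the torus, and leaves a pure shift of the second tone.
    have h2T : parentHamiltonian ω qubitS qubitP (qubitQ q) ((t0 + T + T) • ω) 0 1 =
        Complex.exp (Complex.I * (2 * T * ω 1 : ℝ)) *
          parentHamiltonian ω qubitS qubitP (qubitQ q) (t0 • ω) 0 1 := by
      rw [← qubit_offDiagonal_shift, ← (isErgodicDrive_qubit h).parent_periodic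
        (t0 • ω + ![0, 2 * T * ω 1]) ![k, 0]]
      congr 1
      funext j
      fin_cases j
      · simp
        linear_combination 2 * hk
      · simp
        ring
    rw [hperT, hperT] at h2T
    have hexp : Complex.exp (Complex.I * (2 * T * ω 1 : ℝ)) = 1 :=
      mul_right_cancel₀ hne (by rw [← h2T, one_mul])
    obtain ⟨l, hl⟩ := Complex.exp_eq_one_iff.1 hexp
    have hl' : T * ω 1 = l * Real.pi := by
      have h1 := congrArg Complex.im hl
      simp at h1
      linarith
    -- From `T * ω 0 = k π` and `T * ω 1 = l π` comes the relation `l * ω 0 - k * ω 1 = 0`.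
    -- Independence gives `k = 0`, but `T * ω 0 ≠ 0`.
    have hdep := Fintype.linearIndependent_iff.1 h ![l, -k, 0] (by
      have h1 : T * (l * ω 0 - k * ω 1) = 0 := by
        linear_combination (l : ℝ) * hk - (k : ℝ) * hl'
      have h2 := (mul_eq_zero.1 h1).resolve_left hT
      simp [Fin.sum_univ_three]
      linarith)
    have hk0 : k = 0 := by simpa using hdep 1
    rw [hk0, Int.cast_zero, zero_mul] at hk
    exact (mul_ne_zero hT hω0) hk

end QuasiErgodic

end

/-! ### Assembly of the parametrization, the general drive and the qubit drive. -/

theorem mainTheorem4 :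
    -- the parametrization is measure preserving from the torus onto `SU(d)`, `d = n + 2`
    (∀ n : ℕ,
      MeasurePreserving (QuasiErgodic.hurwitzTorus n) (QuasiErgodic.torusMeasure n)
        ((QuasiErgodic.haarSU (n + 2)).map
          (fun V : Matrix.specialUnitaryGroup (Fin (n + 2)) ℂ => (V : Matrix (Fin (n + 2)) (Fin (n + 2)) ℂ))) ∧
      QuasiErgodic.hurwitzTorus n '' (Set.univ.pi fun _ => Set.Ico (0 : ℝ) (2 * Real.pi)) =
        (Matrix.specialUnitaryGroup (Fin (n + 2)) ℂ :
          Set (Matrix (Fin (n + 2)) (Fin (n + 2)) ℂ))) ∧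
    -- the drive with `d² - 2` tones
    (∀ n : ℕ,
      (∃ (q : Fin (n + 1) → ℝ) (ω : Fin ((n + 2) ^ 2 - 2) → ℝ),
        LinearIndependent ℤ (Sum.elim q ω)) ∧
      ∀ (e : QuasiErgodic.ToneIndex n ≃ Fin ((n + 2) ^ 2 - 2)) (q : Fin (n + 1) → ℝ)
        (ω : Fin ((n + 2) ^ 2 - 2) → ℝ), LinearIndependent ℤ (Sum.elim q ω) →
        QuasiErgodic.IsErgodicDrive ω (QuasiErgodic.driveS n e)
          (QuasiErgodic.parentHamiltonian ω (QuasiErgodic.driveS n e)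
            (QuasiErgodic.driveP n e) (QuasiErgodic.driveQ n q))
          (QuasiErgodic.driveU n e q ω) (QuasiErgodic.driveP n e) (QuasiErgodic.driveQ n q)
          (QuasiErgodic.quasienergy n q)) ∧
    -- the qubit drive with two tones, which cannot be written with fewer tones
    (∀ (ω : Fin 2 → ℝ) (q : ℝ), LinearIndependent ℤ ![ω 0, ω 1, q] →
      QuasiErgodic.IsErgodicDrive ω QuasiErgodic.qubitS
        (QuasiErgodic.parentHamiltonian ω QuasiErgodic.qubitS
          QuasiErgodic.qubitP (QuasiErgodic.qubitQ q))
        (QuasiErgodic.qubitU ω q) QuasiErgodic.qubitP (QuasiErgodic.qubitQ q) ![-q, q] ∧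
      ∀ m < 2, ¬ QuasiErgodic.HasTones m (fun t : ℝ =>
        QuasiErgodic.parentHamiltonian ω QuasiErgodic.qubitS
          QuasiErgodic.qubitP (QuasiErgodic.qubitQ q) (t • ω))) := by
  refine ⟨fun n => ⟨QuasiErgodic.measurePreserving_hurwitzTorus n,
    QuasiErgodic.image_hurwitzTorus n⟩, fun n => ⟨?_, fun e q ω h =>
    QuasiErgodic.isErgodicDrive_drive n e h⟩, fun ω q h => ⟨QuasiErgodic.isErgodicDrive_qubit h,
    fun m hm => QuasiErgodic.not_hasTones_qubit h hm⟩⟩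
  obtain ⟨v, hv⟩ := QuasiErgodic.exists_linearIndependent_int
    (Fin (n + 1) ⊕ Fin ((n + 2) ^ 2 - 2))
  refine ⟨v ∘ Sum.inl, v ∘ Sum.inr, ?_⟩
  rwa [Sum.elim_comp_inl_inr]
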